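/- Let $X\in\mathbb R^{n\times p}$ be a fixed design matrix of rank $r_x$ and put $\bar r=\min(r_x,q)$. For $Y\in\mathbb R^{n\times q}$ let $\widehat Y=X(X^\top X)^+X^\top Y$ be the least squares fit ($^+$ denotes the Moore–Penrose inverse), and let $\widehat Y=\sum_{k=1}^{\bar r}d_kw_kv_k^\top$ be any singular value decomposition of it, with orthonormal $w_k\in\mathbb R^n$, orthonormal $v_k\in\mathbb R^q$ and $d_1\ge\dots\ge d_{\bar r}\ge0$. For a tuning parameter $\lambda$ let $s_k(\cdot,\lambda):(0,\infty)\to[0,1]$, $1\le k\le\bar r$, be weight functions such that $s_1(d_1,\lambda)\ge\dots\ge s_{\bar r}(d_{\bar r},\lambda)$ whenever $d_1\ge\dots\ge d_{\bar r}>0$, and consider the reduced-rank estimator $$\tilde Y(\lambda)=\sum_{k=1}^{\bar r}s_k(d_k,\lambda)\,d_k\,w_kv_k^\top$$ (a term with $d_k=0$ is zero). Write $s_k=s_k(d_k,\lambda)$, $s_k'=\partial s_k(d_k,\lambda)/\partial d_k$, $\tilde r=\max\{k:s_k>0\}$ (with $\tilde r=0$ if all $s_k$ vanish), and $$\tilde{df}(\lambda)=\max(r_x,q)\sum_{k=1}^{\tilde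 r}s_k+\sum_{k=1}^{\tilde r}\sum_{l=\tilde r+1}^{\bar r}\frac{s_k(d_k^2+d_l^2)}{d_k^2-d_l^2}+\sum_{k=1}^{\tilde r}\sum_{\substack{l=1\\ l\ne k}}^{\tilde r}\frac{d_k^2(s_k-s_l)}{d_k^2-d_l^2}+\sum_{k=1}^{\tilde r}d_ks_k',$$ where the second sum is absent if $\tilde r=\bar r$. Then: (a) At every $Y$ for which $d_1>\dots>d_{\bar r}>0$ (in particular $\operatorname{rank}\widehat Y=\bar r$) and each $s_k(\cdot,\lambda)$ is differentiable at $d_k$, all partial derivatives of $\tilde Y(\lambda)$ with respect to the entries of $Y$ exist, and $$\operatorname{tr}\left\{\frac{\partial\operatorname{vec}(\tilde Y(\lambda))}{\partial\operatorname{vec}(Y)}\right\}=\tilde{df}(\lambda).$$ (b) $\tilde{df}(\lambda)$ is an unbiased estimator of the effective degrees of freedom under Gaussian errors: if $Y=M+E$ with a fixed mean matrix $M\in\mathbb R^{n\times q}$ (for instance $M=XB$) and independent errors $E_{ij}\sim N(0,\sigma^2)$, $\sigma^2>0$, if each $s_k(\cdot,\lambda)$ is locally Lipschitz on $(0,\infty)$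 and if $\mathbb E|d_ks_k'|<\infty$ for every $k$, then the entries of $\tilde Y(\lambda)$ are square integrable, $\tilde{df}(\lambda)$ is integrable and $$\mathbb E\,\tilde{df}(\lambda)=\frac1{\sigma^2}\sum_{i=1}^n\sum_{j=1}^q\operatorname{cov}\bigl(\tilde Y_{ij}(\lambda),Y_{ij}\bigr).$$ -/

import Mathlib

open MeasureTheory ProbabilityTheory
open scoped NNReal ENNReal Matrix

namespace ReducedRank

noncomputable section

/-- `G` satisfies the four Penrose equations for the real matrix `A`. -/
structure IsMoorePenrose {m n : ℕ} (A : Matrix (Fin m) (Fin n) ℝ)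
    (G : Matrix (Fin n) (Fin m) ℝ) : Prop where
  mul_mul_self : A * G * A = A
  self_mul_mul : G * A * G = G
  symm_left : (A * G)ᵀ = A * G
  symm_right : (G * A)ᵀ = G * A

/-- The Moore–Penrose inverse `Q diag(μ⁻¹) Qᵀ` of a real symmetric matrix `A = Q diag(μ) Qᵀ`
(with the convention `0⁻¹ = 0`). -/
def symmPinv {p : ℕ} (A : Matrix (Fin p) (Fin p) ℝ) (hA : A.IsHermitian) :
    Matrix (Fin p) (Fin p) ℝ :=
  (hA.eigenvectorUnitary : Matrix (Fin p) (Fin p) ℝ)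
    * Matrix.diagonal (fun i => (hA.eigenvalues i)⁻¹)
    * (hA.eigenvectorUnitary : Matrix (Fin p) (Fin p) ℝ)ᵀ

theorem symmPinv_isMoorePenrose {p : ℕ} (A : Matrix (Fin p) (Fin p) ℝ) (hA : A.IsHermitian) :
    IsMoorePenrose A (symmPinv A hA) := by
  have hUU : (hA.eigenvectorUnitary : Matrix (Fin p) (Fin p) ℝ)ᵀ
      * (hA.eigenvectorUnitary : Matrix (Fin p) (Fin p) ℝ) = 1 := by
    have h := Unitary.coe_star_mul_self hA.eigenvectorUnitary
    rwa [Matrix.star_eq_conjTranspose, Matrix.conjTranspose_eq_transpose_of_trivial] at h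
  have hspec : A = (hA.eigenvectorUnitary : Matrix (Fin p) (Fin p) ℝ)
      * Matrix.diagonal hA.eigenvalues
      * (hA.eigenvectorUnitary : Matrix (Fin p) (Fin p) ℝ)ᵀ := by
    have h := hA.spectral_theorem
    rw [Unitary.conjStarAlgAut_apply, Matrix.star_eq_conjTranspose,
      Matrix.conjTranspose_eq_transpose_of_trivial] at h
    exact h
  unfold symmPinv
  generalize hU : (hA.eigenvectorUnitary : Matrix (Fin p) (Fin p) ℝ) = U at *
  generalize hA.eigenvalues = e at *
  have key : ∀ f g : Fin p → ℝ, U * Matrix.diagonal f * Uᵀ * (U * Matrix.diagonal g * Uᵀ)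
      = U * Matrix.diagonal (fun i => f i * g i) * Uᵀ := by
    intro f g
    calc U * Matrix.diagonal f * Uᵀ * (U * Matrix.diagonal g * Uᵀ)
        = U * Matrix.diagonal f * (Uᵀ * U) * Matrix.diagonal g * Uᵀ := by
          simp only [Matrix.mul_assoc]
      _ = _ := by
          rw [hUU, Matrix.mul_one, Matrix.mul_assoc U, Matrix.diagonal_mul_diagonal]
  have ksym : ∀ f : Fin p → ℝ, (U * Matrix.diagonal f * Uᵀ)ᵀ = U * Matrix.diagonal f * Uᵀ := by
    intro f
    simp [Matrix.transpose_mul, Matrix.mul_assoc]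
  have hi : (fun i => e i * (e i)⁻¹ * e i) = e := by
    funext i
    exact mul_inv_mul_cancel (e i)
  have hi' : (fun i => (e i)⁻¹ * e i * (e i)⁻¹) = fun i => (e i)⁻¹ := by
    funext i
    simpa using mul_inv_mul_cancel (e i)⁻¹
  refine ⟨?_, ?_, ?_, ?_⟩
  · rw [hspec, key, key, hi]
  · rw [hspec, key, key, hi']
  · rw [hspec, key, ksym]
  · rw [hspec, key, ksym]

/-- The least squares fit `Ŷ = X (XᵀX)⁺ Xᵀ Y`. -/
def lsFit {n p q : ℕ} (X : Matrix (Fin n) (Fin p) ℝ) (Y : Matrix (Fin n) (Fin q) ℝ) :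
    Matrix (Fin n) (Fin q) ℝ :=
  X * symmPinv (Xᵀ * X) (Matrix.isHermitian_conjTranspose_mul_self X) * Xᵀ * Y

/-- `A = W diag(d) Vᵀ` is a (thin) singular value decomposition with `r` nonincreasing,
nonnegative singular values. -/
structure IsThinSVD {n q r : ℕ} (A : Matrix (Fin n) (Fin q) ℝ)
    (W : Matrix (Fin n) (Fin r) ℝ) (d : Fin r → ℝ) (V : Matrix (Fin q) (Fin r) ℝ) : Prop where
  left_orthonormal : Wᵀ * W = 1
  right_orthonormal : Vᵀ * V = 1
  antitone : Antitone d
  nonneg : ∀ k, 0 ≤ d k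
  eq_mul : A = W * Matrix.diagonal d * Vᵀ

/-- The shrunken matrix `∑ₖ aₖ dₖ wₖ vₖᵀ`, where `wₖ`, `vₖ` are the `k`-th columns of `W`, `V`. -/
def shrink {n q r : ℕ} (W : Matrix (Fin n) (Fin r) ℝ) (d : Fin r → ℝ)
    (V : Matrix (Fin q) (Fin r) ℝ) (a : Fin r → ℝ) : Matrix (Fin n) (Fin q) ℝ :=
  ∑ k, (a k * d k) • Matrix.vecMulVec (W.col k) (V.col k)

/-- The Jacobian matrix `∂ vec(F(Y)) / ∂ vec(Y)` of a matrix function; the index `(i, j)` stands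
for the matrix entry in row `i` and column `j`. -/
def jacobian {n q : ℕ} (F : Matrix (Fin n) (Fin q) ℝ → Matrix (Fin n) (Fin q) ℝ)
    (Y : Matrix (Fin n) (Fin q) ℝ) : Matrix (Fin n × Fin q) (Fin n × Fin q) ℝ :=
  Matrix.of fun a b =>
    lineDeriv ℝ (fun Z => F Z a.1 a.2) Y (Matrix.single b.1 b.2 (1 : ℝ))

/-- All partial derivatives of all entries of `F` exist at `Y`. -/
def HasPartials {n q : ℕ} (F : Matrix (Fin n) (Fin q) ℝ → Matrix (Fin n) (Fin q) ℝ)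
    (Y : Matrix (Fin n) (Fin q) ℝ) : Prop :=
  ∀ a b : Fin n × Fin q,
    LineDifferentiableAt ℝ (fun Z => F Z a.1 a.2) Y (Matrix.single b.1 b.2 (1 : ℝ))

open Classical in
/-- `max {k : aₖ > 0}` with one-based indices `k`, and `0` if all `aₖ` vanish; the element
`k : Fin r` has the one-based index `k + 1`. -/
def effRank {r : ℕ} (a : Fin r → ℝ) : ℕ :=
  (Finset.univ.filter fun k : Fin r => 0 < a k).sup fun k => (k : ℕ) + 1

/-- The closed form of the degrees of freedom estimator. Here `d` are the singular values, `a` the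
weights `sₖ`, `a'` the derivatives `sₖ'`; `(k : ℕ) < effRank a` says that the one-based index of
`k` is at most `max {k : aₖ > 0}`. -/
def dfClosed {r : ℕ} (rx q : ℕ) (d a a' : Fin r → ℝ) : ℝ :=
  let rt := effRank a
  let low : Finset (Fin r) := Finset.univ.filter fun k => (k : ℕ) < rt
  let high : Finset (Fin r) := Finset.univ.filter fun k => rt ≤ (k : ℕ)
  if rt < r then
    ((max rx q : ℕ) : ℝ) * ∑ k ∈ low, a k
      + ∑ k ∈ low, ∑ l ∈ high, a k * (d k ^ 2 + d l ^ 2) / (d k ^ 2 - d l ^ 2)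
      + ∑ k ∈ low, ∑ l ∈ low.erase k, d k ^ 2 * (a k - a l) / (d k ^ 2 - d l ^ 2)
      + ∑ k ∈ low, d k * a' k
  else
    ((max rx q : ℕ) : ℝ) * ∑ k ∈ low, a k
      + ∑ k ∈ low, ∑ l ∈ low.erase k, d k ^ 2 * (a k - a l) / (d k ^ 2 - d l ^ 2)
      + ∑ k ∈ low, d k * a' k

/-- The effective degrees of freedom `∑ᵢⱼ cov(Ỹᵢⱼ, Yᵢⱼ) / σ²` of the fit `F(Y)` to the random
response `Y` with error variance `v = σ²`. -/
def effectiveDf {Ω : Type*} [MeasurableSpace Ω] (P : Measure Ω) {n q : ℕ} (v : ℝ)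
    (F : Matrix (Fin n) (Fin q) ℝ → Matrix (Fin n) (Fin q) ℝ)
    (Y : Ω → Matrix (Fin n) (Fin q) ℝ) : ℝ :=
  (∑ i, ∑ j, covariance (fun ω => F (Y ω) i j) (fun ω => Y ω i j) P) / v

end

end ReducedRank

/-!
The estimator is `Ỹ = A V diag(s(d)) Vᵀ` with `A = P Y`, where `P` is the orthogonal projection onto
the column space of the design matrix: the left singular vectors drop out (`IsThinSVD.shrink_eq`),
and `V diag(s(d)) Vᵀ` is a spectral function of the Gram matrix `AᵀA`. The singular vectors are
arbitrary and need not depend continuously on `Y`, so everything is expressed through the spectral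
projections, which are continuous where the singular values are distinct and positive.

*Divergence.* For two symmetric matrices `S`, `S'` with spectral projections `Πₗ`, `Πₘ'` one has
`Πₗ (S' - S) Πₘ' = (λₘ' - λₗ) Πₗ Πₘ'`. Summing over `l`, `m` gives an exact finite-difference form of
the Daletskii–Krein formula (`conj_diagonal_sub`), from which continuity, local Lipschitz bounds and
directional derivatives of spectral functions are read off. Taking the trace over all directions
(`sum_fitDeriv`) gives
`div Ỹ = max(rₓ, q) ∑ₖ sₖ + ∑ₖₗ dₖ² (sₖ - sₗ) / (dₖ² - dₗ²) + ∑ₖ dₖ sₖ'`,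
which equals the closed form by `dfClosed_eq`, because `sₖ' = 0` wherever the weight attains its
minimal value `0`.

*Unbiasedness.* This is Stein's identity `E div Ỹ = σ⁻² E ⟨Y - M, Ỹ⟩`. The estimator is not
globally Lipschitz, since its derivative can blow up at ties of the singular values, and integrability
of the divergence is part of the claim. Let `δ` be the product of the squared singular values and of
their pairwise differences. The identity is applied to `Ỹ` multiplied by the cutoffs `Θ(m δ - 1)` and
`Θ(2 - ‖Y‖² / m)`, a locally Lipschitz function with compact support (`stein_identity`,
`locallyLipschitz_cutFit`). The decisive point is that the first cutoff does no harm: along `Ỹ` the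
logarithmic derivative of `δ` is `b + c ∑ₖ sₖ` with a constant `c`, where
`b = max(rₓ, q) ∑ₖ sₖ + ∑ₖₗ dₖ² (sₖ - sₗ) / (dₖ² - dₗ²)` is the divergence without the derivatives of
the weights (`sum_logDeriv_discr`). Since the weights are ordered, `b ≥ 0`. So the extra term has the
same sign as the main one up to bounded quantities, Fatou's lemma shows that `b` is integrable, and
dominated convergence removes the cutoffs (`integral_eq_of_cutoff`).

Almost every response has distinct positive singular values, because this is the nonvanishing of a
polynomial (`ae_isSimple`). The weights are differentiable at almost all of them, by Rademacher's
theorem in one dimension and the homogeneity of the singular values (`ae_differentiableAt_weight`).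
-/

namespace ReducedRank

open Filter Topology Matrix

/-! ### Reduced spectral decompositions and their perturbation -/

section Spectral

variable {q r : ℕ}

/-- `S = V diag(lam) Vᵀ` with orthonormal columns of `V` and nonincreasing, nonnegative `lam`: a
reduced spectral decomposition, in which the orthogonal complement of the columns of `V` carries
the eigenvalue `0`. -/
structure IsSpectral (S : Matrix (Fin q) (Fin q) ℝ) (lam : Fin r → ℝ)
    (V : Matrix (Fin q) (Fin r) ℝ) : Prop where
  orth : Vᵀ * V = 1
  anti : Antitone lam
  nonneg : ∀ k, 0 ≤ lam k
  eq_mul : S = V * diagonal lam * Vᵀ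

/-- The values `lam` are positive and strictly decreasing; for the nonincreasing families of
eigenvalues and singular values this says that they are positive and pairwise distinct. -/
def IsSimple (lam : Fin r → ℝ) : Prop := StrictAnti lam ∧ ∀ k, 0 < lam k

/-- The orthogonal projections onto the columns of `V` (index `some k`) and onto their common
orthogonal complement (index `none`). -/
noncomputable def proj (V : Matrix (Fin q) (Fin r) ℝ) :
    Option (Fin r) → Matrix (Fin q) (Fin q) ℝ
  | none => 1 - V * Vᵀ
  | some k => V * diagonal (Pi.single k (1 : ℝ)) * Vᵀ

/-- Extension of a family of values by `0` at the index of the complementary projection. -/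
def ext0 (a : Fin r → ℝ) : Option (Fin r) → ℝ := fun o => o.elim 0 a

@[simp] lemma ext0_none (a : Fin r → ℝ) : ext0 a none = 0 := rfl

@[simp] lemma ext0_some (a : Fin r → ℝ) (k : Fin r) : ext0 a (some k) = a k := rfl

lemma ext0_injective {lam : Fin r → ℝ} (h : IsSimple lam) : Function.Injective (ext0 lam) := by
  rintro (_ | k) (_ | l) hkl
  · rfl
  · exact absurd hkl (h.2 l).ne
  · exact absurd hkl (h.2 k).ne'
  · rw [h.1.injective hkl]

variable {S S' : Matrix (Fin q) (Fin q) ℝ} {lam lam' : Fin r → ℝ} {V V' : Matrix (Fin q) (Fin r) ℝ}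

lemma conj_diagonal_mul (hV : Vᵀ * V = 1) (a b : Fin r → ℝ) :
    (V * diagonal a * Vᵀ) * (V * diagonal b * Vᵀ) = V * diagonal (fun k => a k * b k) * Vᵀ := by
  calc (V * diagonal a * Vᵀ) * (V * diagonal b * Vᵀ)
      = V * diagonal a * (Vᵀ * V) * diagonal b * Vᵀ := by simp only [Matrix.mul_assoc]
    _ = _ := by rw [hV, Matrix.mul_one, Matrix.mul_assoc V, diagonal_mul_diagonal]

lemma conj_diagonal_transpose (a : Fin r → ℝ) :
    (V * diagonal a * Vᵀ)ᵀ = V * diagonal a * Vᵀ := by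
  simp [Matrix.transpose_mul, Matrix.mul_assoc]

lemma trace_conj_diagonal (hV : Vᵀ * V = 1) (a : Fin r → ℝ) :
    (V * diagonal a * Vᵀ).trace = ∑ k, a k := by
  rw [Matrix.mul_assoc, Matrix.trace_mul_comm, Matrix.mul_assoc, hV, Matrix.mul_one, trace_diagonal]

lemma conj_diagonal_eq_sum (a : Fin r → ℝ) :
    V * diagonal a * Vᵀ = ∑ k, a k • proj V (some k) := by
  have h : diagonal a = ∑ k, a k • diagonal (Pi.single k (1 : ℝ)) := by
    ext i j
    rw [Matrix.sum_apply]
    by_cases hij : i = j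
    · subst hij
      simp [Pi.single_apply]
    · simp [hij]
  conv_lhs => rw [h]
  simp [proj, Matrix.mul_sum, Matrix.sum_mul]

/-- A spectral function is also a combination of the projections including the complementary one,
which form a resolution of the identity. -/
lemma conj_diagonal_eq_sum_option (a : Fin r → ℝ) :
    V * diagonal a * Vᵀ = ∑ o, ext0 a o • proj V o := by
  rw [conj_diagonal_eq_sum, Fintype.sum_option]
  simp

lemma sum_proj (V : Matrix (Fin q) (Fin r) ℝ) : ∑ o, proj V o = 1 := by
  have h := conj_diagonal_eq_sum (V := V) (fun _ => 1)
  simp only [one_smul] at h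
  rw [Fintype.sum_option, ← h, diagonal_one, Matrix.mul_one]
  simp [proj]

lemma proj_transpose (V : Matrix (Fin q) (Fin r) ℝ) (o : Option (Fin r)) :
    (proj V o)ᵀ = proj V o := by
  cases o with
  | none => simp [proj]
  | some k => exact conj_diagonal_transpose _

lemma conj_diagonal_mul_proj (hV : Vᵀ * V = 1) (a : Fin r → ℝ) (o : Option (Fin r)) :
    (V * diagonal a * Vᵀ) * proj V o = ext0 a o • proj V o := by
  cases o with
  | none =>
    simp only [proj, ext0_none, zero_smul, Matrix.mul_sub, Matrix.mul_one]
    rw [Matrix.mul_assoc (V * diagonal a), ← Matrix.mul_assoc Vᵀ, hV, Matrix.one_mul, sub_self]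
  | some k =>
    have : (fun i => a i * (Pi.single k 1 : Fin r → ℝ) i) = a k • (Pi.single k 1 : Fin r → ℝ) := by
      funext i
      by_cases h : i = k
      · subst h; simp
      · simp [h]
    simp only [proj, ext0_some]
    rw [conj_diagonal_mul hV, this, diagonal_smul]
    simp

lemma proj_mul_conj_diagonal (hV : Vᵀ * V = 1) (a : Fin r → ℝ) (o : Option (Fin r)) :
    proj V o * (V * diagonal a * Vᵀ) = ext0 a o • proj V o := by
  have h := congrArg Matrix.transpose (conj_diagonal_mul_proj hV a o)
  rwa [Matrix.transpose_mul, proj_transpose, conj_diagonal_transpose, Matrix.transpose_smul,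
    proj_transpose] at h

lemma proj_mul_proj (hV : Vᵀ * V = 1) (o o' : Option (Fin r)) :
    proj V o * proj V o' = if o = o' then proj V o else 0 := by
  have key : ∀ k o', proj V (some k) * proj V o' = if some k = o' then proj V (some k) else 0 := by
    intro k o'
    rw [show proj V (some k) = V * diagonal (Pi.single k (1 : ℝ)) * Vᵀ from rfl,
      conj_diagonal_mul_proj hV]
    cases o' with
    | none => simp
    | some l =>
      by_cases h : k = l
      · subst h; simp [proj]
      · simp [h, Ne.symm h]
  cases o with
  | some k => exact key k o'
  | none =>
    have h1 : proj V none = 1 - ∑ k, proj V (some k) := by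
      rw [← sum_proj V, Fintype.sum_option]; simp
    rw [h1, Matrix.sub_mul, Matrix.sum_mul, Matrix.one_mul]
    simp only [key]
    cases o' with
    | none => simp [h1]
    | some l => simp

lemma trace_proj_some (hV : Vᵀ * V = 1) (k : Fin r) : (proj V (some k)).trace = 1 := by
  rw [show proj V (some k) = V * diagonal (Pi.single k (1 : ℝ)) * Vᵀ from rfl, trace_conj_diagonal hV]
  simp

lemma trace_proj_none (hV : Vᵀ * V = 1) : (proj V none).trace = q - r := by
  simp [proj, Matrix.trace_mul_comm V, hV]

/-- The entries of a symmetric idempotent are at most `1` in absolute value. -/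
lemma abs_entry_le_one {A : Matrix (Fin q) (Fin q) ℝ} (hT : Aᵀ = A) (hA : A * A = A)
    (i j : Fin q) : |A i j| ≤ 1 := by
  have hd : ∀ i, A i i = ∑ k, A i k ^ 2 := by
    intro i
    conv_lhs => rw [← hA]
    rw [Matrix.mul_apply]
    refine Finset.sum_congr rfl fun k _ => ?_
    have : A k i = A i k := congrFun (congrFun hT i) k
    rw [this, sq]
  have h1 : ∀ j, A i j ^ 2 ≤ A i i := by
    intro j
    rw [hd i]
    exact Finset.single_le_sum (f := fun k => A i k ^ 2) (fun k _ => sq_nonneg _)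
      (Finset.mem_univ j)
  have h2 : A i i ≤ 1 := by nlinarith [h1 i]
  have h3 := h1 j
  exact abs_le_one_iff_mul_self_le_one.2 (by nlinarith)

lemma abs_proj_le_one (hV : Vᵀ * V = 1) (o : Option (Fin r)) (i j : Fin q) :
    |proj V o i j| ≤ 1 :=
  abs_entry_le_one (proj_transpose V o) (by rw [proj_mul_proj hV]; simp) i j

/-- The commutation identity behind all perturbation formulas. -/
lemma proj_mul_sub_mul_proj (h : IsSpectral S lam V) (h' : IsSpectral S' lam' V')
    (l m : Option (Fin r)) :
    proj V l * (S' - S) * proj V' m = (ext0 lam' m - ext0 lam l) • (proj V l * proj V' m) := by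
  have h1 : proj V l * S = ext0 lam l • proj V l := by
    rw [h.eq_mul, proj_mul_conj_diagonal h.orth]
  have h2 : S' * proj V' m = ext0 lam' m • proj V' m := by
    rw [h'.eq_mul, conj_diagonal_mul_proj h'.orth]
  rw [Matrix.mul_sub, Matrix.sub_mul, Matrix.mul_assoc, h2, h1, Matrix.mul_smul, Matrix.smul_mul,
    sub_smul]

/-- The increment of a spectral function `V diag(a) Vᵀ`, expressed through the increment of the
matrix itself: the exact finite-difference form of the Daletskii–Krein formula. -/
lemma conj_diagonal_sub (h : IsSpectral S lam V) (h' : IsSpectral S' lam' V')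
    (hne : ∀ l m : Option (Fin r), l ≠ m → ext0 lam' m ≠ ext0 lam l) (a a' : Fin r → ℝ) :
    V' * diagonal a' * V'ᵀ - V * diagonal a * Vᵀ =
      ∑ k, (a' k - a k) • (proj V (some k) * proj V' (some k)) +
      ∑ l, ∑ m, if l = m then 0 else
        ((ext0 a' m - ext0 a l) / (ext0 lam' m - ext0 lam l)) •
          (proj V l * (S' - S) * proj V' m) := by
  have h1 : V' * diagonal a' * V'ᵀ = ∑ l, ∑ m, ext0 a' m • (proj V l * proj V' m) := by
    rw [← Matrix.one_mul (V' * diagonal a' * V'ᵀ), ← sum_proj V, conj_diagonal_eq_sum_option,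
      Finset.sum_mul_sum]
    simp
  have h2 : V * diagonal a * Vᵀ = ∑ l, ∑ m, ext0 a l • (proj V l * proj V' m) := by
    rw [← Matrix.mul_one (V * diagonal a * Vᵀ), ← sum_proj V', conj_diagonal_eq_sum_option,
      Finset.sum_mul_sum]
    simp
  have h3 : ∑ k, (a' k - a k) • (proj V (some k) * proj V' (some k)) =
      ∑ l, ∑ m, if l = m then (ext0 a' m - ext0 a l) • (proj V l * proj V' m) else 0 := by
    simp [Fintype.sum_option]
  rw [h1, h2, h3, ← Finset.sum_sub_distrib, ← Finset.sum_add_distrib]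
  refine Finset.sum_congr rfl fun l _ => ?_
  rw [← Finset.sum_sub_distrib, ← Finset.sum_add_distrib]
  refine Finset.sum_congr rfl fun m _ => ?_
  by_cases hlm : l = m
  · simp [hlm, sub_smul]
  · rw [if_neg hlm, if_neg hlm, zero_add, proj_mul_sub_mul_proj h h', smul_smul,
      div_mul_cancel₀ _ (sub_ne_zero.2 (hne l m hlm)), sub_smul]

lemma dotProduct_conj_diagonal (a : Fin r → ℝ) (x : Fin q → ℝ) :
    x ⬝ᵥ ((V * diagonal a * Vᵀ) *ᵥ x) = ∑ i, a i * (Vᵀ *ᵥ x) i ^ 2 := by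
  rw [← Matrix.mulVec_mulVec, ← Matrix.mulVec_mulVec, Matrix.dotProduct_mulVec,
    ← Matrix.mulVec_transpose, dotProduct]
  refine Finset.sum_congr rfl fun i _ => ?_
  rw [Matrix.mulVec_diagonal]
  ring

/-- Bessel's inequality. -/
lemma sum_sq_transpose_mulVec_le (hV : Vᵀ * V = 1) (x : Fin q → ℝ) :
    ∑ i, (Vᵀ *ᵥ x) i ^ 2 ≤ x ⬝ᵥ x := by
  have h1 : ∑ i, (Vᵀ *ᵥ x) i ^ 2 = x ⬝ᵥ ((V * Vᵀ) *ᵥ x) := by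
    have := dotProduct_conj_diagonal (V := V) (fun _ => 1) x
    rw [diagonal_one, Matrix.mul_one] at this
    rw [this]
    simp
  have hP : (V * Vᵀ) * (V * Vᵀ) = V * Vᵀ := by
    rw [Matrix.mul_assoc, ← Matrix.mul_assoc Vᵀ, hV, Matrix.one_mul]
  have h2 : (x - (V * Vᵀ) *ᵥ x) ⬝ᵥ (x - (V * Vᵀ) *ᵥ x) = x ⬝ᵥ x - x ⬝ᵥ ((V * Vᵀ) *ᵥ x) := by
    have h3 : ((V * Vᵀ) *ᵥ x) ⬝ᵥ ((V * Vᵀ) *ᵥ x) = x ⬝ᵥ ((V * Vᵀ) *ᵥ x) := by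
      conv_rhs => rw [← hP, ← Matrix.mulVec_mulVec, Matrix.dotProduct_mulVec,
        ← Matrix.mulVec_transpose]
      simp
    rw [sub_dotProduct, dotProduct_sub, dotProduct_sub, h3,
      dotProduct_comm ((V * Vᵀ) *ᵥ x) x]
    ring
  have h4 : 0 ≤ (x - (V * Vᵀ) *ᵥ x) ⬝ᵥ (x - (V * Vᵀ) *ᵥ x) :=
    Finset.sum_nonneg fun i _ => mul_self_nonneg _
  linarith

/-- Weyl's inequality for the ordered eigenvalues, by intersecting the span of the first `k + 1`
eigenvectors of one matrix with the orthogonal complement of the first `k` of the other. -/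
lemma eigenvalue_sub_le (h : IsSpectral S lam V) (h' : IsSpectral S' lam' V') (k : Fin r) :
    lam k - lam' k ≤ ∑ a, ∑ b, |S a b - S' a b| := by
  -- coefficients `c` of a vector `V c` in the intersection
  obtain ⟨c, hc, hck, hc0⟩ : ∃ c : Fin r → ℝ, c ≠ 0 ∧ (∀ i, k < i → c i = 0) ∧
      ∀ i, i < k → (V'ᵀ *ᵥ (V *ᵥ c)) i = 0 := by
    let L : ({i : Fin r // i ≤ k} → ℝ) →ₗ[ℝ] ({i : Fin r // i < k} → ℝ) :=
      (LinearMap.funLeft ℝ ℝ (fun i : {i : Fin r // i < k} => (i : Fin r))) ∘ₗ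
        (V'ᵀ * V).mulVecLin ∘ₗ
        (Function.ExtendByZero.linearMap ℝ (fun i : {i : Fin r // i ≤ k} => (i : Fin r)))
    have hdim : Module.finrank ℝ ({i : Fin r // i < k} → ℝ) <
        Module.finrank ℝ ({i : Fin r // i ≤ k} → ℝ) := by
      rw [Module.finrank_pi, Module.finrank_pi, Fintype.card_subtype, Fintype.card_subtype]
      refine Finset.card_lt_card (Finset.ssubset_iff_subset_ne.2 ⟨?_, fun h => ?_⟩)
      · exact Finset.monotone_filter_right _ fun i _ hi => le_of_lt hi
      · simpa using congrArg (k ∈ ·) h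
    obtain ⟨y, hy, hy0⟩ := (Submodule.ne_bot_iff _).1 (L.ker_ne_bot_of_finrank_lt hdim)
    refine ⟨Function.extend (fun i : {i : Fin r // i ≤ k} => (i : Fin r)) y 0, ?_, ?_, ?_⟩
    · intro h0
      apply hy0
      funext i
      have := congrFun h0 (i : Fin r)
      rwa [Subtype.val_injective.extend_apply] at this
    · intro i hi
      rw [Function.extend_apply']
      · rfl
      · rintro ⟨j, rfl⟩
        exact absurd j.2 (not_le.2 hi)
    · intro i hi
      have := congrFun (LinearMap.mem_ker.1 hy) ⟨i, hi⟩
      rw [Matrix.mulVec_mulVec]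
      exact this
  set x := V *ᵥ c with hx
  have hVx : Vᵀ *ᵥ x = c := by rw [hx, Matrix.mulVec_mulVec, h.orth, Matrix.one_mulVec]
  have hxx : x ⬝ᵥ x = ∑ i, c i ^ 2 := by
    conv_lhs => rw [hx, Matrix.dotProduct_mulVec, ← Matrix.mulVec_transpose, hVx]
    exact Finset.sum_congr rfl fun i _ => (sq _).symm
  have hpos : 0 < x ⬝ᵥ x := by
    rw [hxx]
    obtain ⟨i, hi⟩ := Function.ne_iff.1 hc
    exact Finset.sum_pos' (fun i _ => sq_nonneg _) ⟨i, Finset.mem_univ _, by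
      have : c i ≠ 0 := hi
      positivity⟩
  have hS : lam k * (x ⬝ᵥ x) ≤ x ⬝ᵥ (S *ᵥ x) := by
    rw [h.eq_mul, dotProduct_conj_diagonal, hVx, hxx, Finset.mul_sum]
    refine Finset.sum_le_sum fun i _ => ?_
    rcases le_or_gt i k with hik | hik
    · exact mul_le_mul_of_nonneg_right (h.anti hik) (sq_nonneg _)
    · simp [hck i hik]
  have hS' : x ⬝ᵥ (S' *ᵥ x) ≤ lam' k * (x ⬝ᵥ x) := by
    rw [h'.eq_mul, dotProduct_conj_diagonal]
    refine le_trans ?_ (mul_le_mul_of_nonneg_left (sum_sq_transpose_mulVec_le h'.orth x)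
      (h'.nonneg k))
    rw [Finset.mul_sum]
    refine Finset.sum_le_sum fun i _ => ?_
    rcases le_or_gt k i with hik | hik
    · exact mul_le_mul_of_nonneg_right (h'.anti hik) (sq_nonneg _)
    · simp [hc0 i hik]
  have hdiff : x ⬝ᵥ (S *ᵥ x) - x ⬝ᵥ (S' *ᵥ x) ≤ (∑ a, ∑ b, |S a b - S' a b|) * (x ⬝ᵥ x) := by
    rw [← dotProduct_sub, ← Matrix.sub_mulVec]
    simp only [dotProduct, Matrix.mulVec]
    rw [Finset.sum_mul]
    refine Finset.sum_le_sum fun a _ => ?_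
    rw [Finset.sum_mul, Finset.mul_sum]
    refine Finset.sum_le_sum fun b _ => ?_
    have hab : |x a * x b| ≤ ∑ i, x i * x i := by
      have ha := Finset.single_le_sum (f := fun i => x i * x i) (fun i _ => mul_self_nonneg _)
        (Finset.mem_univ a)
      have hb := Finset.single_le_sum (f := fun i => x i * x i) (fun i _ => mul_self_nonneg _)
        (Finset.mem_univ b)
      rw [abs_le]
      constructor <;> nlinarith [sq_nonneg (x a + x b), sq_nonneg (x a - x b)]
    calc x a * ((S - S') a b * x b) = (S a b - S' a b) * (x a * x b) := by
          rw [Matrix.sub_apply]; ring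
      _ ≤ |(S a b - S' a b) * (x a * x b)| := le_abs_self _
      _ = |S a b - S' a b| * |x a * x b| := abs_mul _ _
      _ ≤ _ := mul_le_mul_of_nonneg_left hab (abs_nonneg _)
  have := le_of_mul_le_mul_right (a := x ⬝ᵥ x) (b := lam k - lam' k)
    (c := ∑ a, ∑ b, |S a b - S' a b|) (by linarith) hpos
  exact this

lemma abs_eigenvalue_sub_le (h : IsSpectral S lam V) (h' : IsSpectral S' lam' V') (k : Fin r) :
    |lam k - lam' k| ≤ ∑ a, ∑ b, |S a b - S' a b| := by
  rw [abs_sub_le_iff]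
  refine ⟨eigenvalue_sub_le h h' k, (eigenvalue_sub_le h' h k).trans_eq ?_⟩
  simp only [abs_sub_comm]

/-- The eigenvalues of a reduced spectral decomposition are determined by the matrix. -/
lemma IsSpectral.eigenvalue_unique (h : IsSpectral S lam V) (h' : IsSpectral S lam' V') :
    lam = lam' := by
  funext k
  have := abs_eigenvalue_sub_le h h' k
  simp only [sub_self, abs_zero, Finset.sum_const_zero, abs_nonpos_iff, sub_eq_zero] at this
  exact this

end Spectral

/-! ### Derivatives along lines of spectral functions -/

section Perturbation

variable {q r : ℕ}

/-- The sum of the absolute values of the entries. -/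
def entrySum (D : Matrix (Fin q) (Fin q) ℝ) : ℝ := ∑ a, ∑ b, |D a b|

lemma entrySum_nonneg (D : Matrix (Fin q) (Fin q) ℝ) : 0 ≤ entrySum D :=
  Finset.sum_nonneg fun _ _ => Finset.sum_nonneg fun _ _ => abs_nonneg _

lemma continuous_entrySum : Continuous (entrySum (q := q)) := by
  unfold entrySum
  fun_prop

lemma abs_mul_mul_entry_le {P Q : Matrix (Fin q) (Fin q) ℝ} (hP : ∀ i j, |P i j| ≤ 1)
    (hQ : ∀ i j, |Q i j| ≤ 1) (D : Matrix (Fin q) (Fin q) ℝ) (i j : Fin q) :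
    |(P * D * Q) i j| ≤ entrySum D := by
  rw [entrySum, Finset.sum_comm, Matrix.mul_apply]
  refine (Finset.abs_sum_le_sum_abs _ _).trans (Finset.sum_le_sum fun b _ => ?_)
  rw [abs_mul, Matrix.mul_apply]
  refine (mul_le_of_le_one_right (abs_nonneg _) (hQ _ _)).trans ?_
  refine (Finset.abs_sum_le_sum_abs _ _).trans (Finset.sum_le_sum fun a _ => ?_)
  rw [abs_mul]
  exact mul_le_of_le_one_left (abs_nonneg _) (hP _ _)

lemma abs_mul_entry_le {P Q : Matrix (Fin q) (Fin q) ℝ} (hP : ∀ i j, |P i j| ≤ 1)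
    (hQ : ∀ i j, |Q i j| ≤ 1) (i j : Fin q) : |(P * Q) i j| ≤ q := by
  rw [Matrix.mul_apply]
  refine (Finset.abs_sum_le_sum_abs _ _).trans ?_
  refine (Finset.sum_le_sum (g := fun _ => (1 : ℝ)) fun b _ => ?_).trans_eq (by simp)
  rw [abs_mul]
  exact mul_le_one₀ (hP _ _) (abs_nonneg _) (hQ _ _)

/-- The quantitative form of `conj_diagonal_sub`; the projections enter only through the bound `1`
on their entries. -/
lemma abs_conj_diagonal_sub_le {S S' : Matrix (Fin q) (Fin q) ℝ} {lam lam' : Fin r → ℝ}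
    {V V' : Matrix (Fin q) (Fin r) ℝ} (h : IsSpectral S lam V) (h' : IsSpectral S' lam' V')
    (hne : ∀ l m : Option (Fin r), l ≠ m → ext0 lam' m ≠ ext0 lam l) (a a' : Fin r → ℝ)
    (i j : Fin q) :
    |(V' * diagonal a' * V'ᵀ - V * diagonal a * Vᵀ) i j| ≤ q * ∑ k, |a' k - a k| +
      (∑ l, ∑ m, if l = m then 0 else
        |(ext0 a' m - ext0 a l) / (ext0 lam' m - ext0 lam l)|) * entrySum (S' - S) := by
  rw [conj_diagonal_sub h h' hne, Matrix.add_apply, Matrix.sum_apply, Matrix.sum_apply]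
  refine (abs_add_le _ _).trans (add_le_add ?_ ?_)
  · rw [Finset.mul_sum]
    refine (Finset.abs_sum_le_sum_abs _ _).trans (Finset.sum_le_sum fun k _ => ?_)
    rw [Matrix.smul_apply, smul_eq_mul, abs_mul, mul_comm]
    exact mul_le_mul_of_nonneg_right
      (abs_mul_entry_le (abs_proj_le_one h.orth _) (abs_proj_le_one h'.orth _) i j) (abs_nonneg _)
  · rw [Finset.sum_mul]
    refine (Finset.abs_sum_le_sum_abs _ _).trans (Finset.sum_le_sum fun l _ => ?_)
    rw [Finset.sum_mul, Matrix.sum_apply]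
    refine (Finset.abs_sum_le_sum_abs _ _).trans (Finset.sum_le_sum fun m _ => ?_)
    by_cases hlm : l = m
    · simp [hlm]
    · rw [if_neg hlm, if_neg hlm, Matrix.smul_apply, smul_eq_mul, abs_mul]
      exact mul_le_mul_of_nonneg_left (abs_mul_mul_entry_le (abs_proj_le_one h.orth _)
        (abs_proj_le_one h'.orth _) _ i j) (abs_nonneg _)

section Continuity

variable {T : Type*} [TopologicalSpace T] {S : T → Matrix (Fin q) (Fin q) ℝ} {lam : T → Fin r → ℝ}
  {V : T → Matrix (Fin q) (Fin r) ℝ} {t₀ : T}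

lemma tendsto_entrySum_sub (hS : ContinuousAt S t₀) :
    Tendsto (fun t => entrySum (S t - S t₀)) (𝓝 t₀) (𝓝 0) := by
  have h1 : ContinuousAt (fun t => entrySum (S t - S t₀)) t₀ :=
    continuous_entrySum.continuousAt.comp (hS.sub continuousAt_const)
  have h2 : entrySum (S t₀ - S t₀) = 0 := by simp [entrySum]
  rw [← h2]
  exact h1

lemma continuousAt_eigenvalue (h : ∀ t, IsSpectral (S t) (lam t) (V t)) (hS : ContinuousAt S t₀) :
    ContinuousAt lam t₀ := by
  refine tendsto_pi_nhds.2 fun k => ?_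
  rw [tendsto_iff_norm_sub_tendsto_zero]
  exact squeeze_zero (fun _ => norm_nonneg _)
    (fun t => abs_eigenvalue_sub_le (h t) (h t₀) k) (tendsto_entrySum_sub hS)

lemma eventually_isSimple (hlam : ContinuousAt lam t₀) (h0 : IsSimple (lam t₀)) :
    ∀ᶠ t in 𝓝 t₀, IsSimple (lam t) := by
  have hk : ∀ k, ContinuousAt (fun t => lam t k) t₀ := fun k => tendsto_pi_nhds.1 hlam k
  have h1 : ∀ᶠ t in 𝓝 t₀, ∀ k, 0 < lam t k :=
    eventually_all.2 fun k => (hk k).eventually_const_lt (h0.2 k)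
  have h2 : ∀ᶠ t in 𝓝 t₀, ∀ k l, k < l → lam t l < lam t k := by
    refine eventually_all.2 fun k => eventually_all.2 fun l => ?_
    by_cases hkl : k < l
    · filter_upwards [(hk l).eventually_lt (hk k) (h0.1 hkl)] with t ht _ using ht
    · exact Eventually.of_forall fun t h => absurd h hkl
  filter_upwards [h1, h2] with t h1 h2 using ⟨fun k l hkl => h2 k l hkl, h1⟩

lemma continuousAt_ext0 {a : T → Fin r → ℝ} (ha : ContinuousAt a t₀) (o : Option (Fin r)) :
    ContinuousAt (fun t => ext0 (a t) o) t₀ := by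
  cases o with
  | none => exact continuousAt_const
  | some k => exact tendsto_pi_nhds.1 ha k

/-- Near a pair of equal parameters with simple eigenvalues, distinct indices carry distinct
eigenvalues, also between the two matrices. -/
lemma eventually_ext0_ne (hlam : ContinuousAt lam t₀) (h0 : IsSimple (lam t₀)) :
    ∀ᶠ p in 𝓝 (t₀, t₀), ∀ l m : Option (Fin r), l ≠ m →
      ext0 (lam p.2) m ≠ ext0 (lam p.1) l := by
  refine eventually_all.2 fun l => eventually_all.2 fun m => ?_
  by_cases hlm : l = m
  · exact Eventually.of_forall fun p h => absurd hlm h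
  · have h1 : ContinuousAt (fun p : T × T => ext0 (lam p.2) m) (t₀, t₀) :=
      ContinuousAt.comp (f := Prod.snd) (g := fun t => ext0 (lam t) m) (continuousAt_ext0 hlam m)
        continuousAt_snd
    have h2 : ContinuousAt (fun p : T × T => ext0 (lam p.1) l) (t₀, t₀) :=
      ContinuousAt.comp (f := Prod.fst) (g := fun t => ext0 (lam t) l) (continuousAt_ext0 hlam l)
        continuousAt_fst
    have h3 := (h1.sub h2).eventually_ne (y := 0)
      (sub_ne_zero.2 fun h => hlm (ext0_injective h0 h).symm)
    filter_upwards [h3] with p hp _ using sub_ne_zero.1 hp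

lemma eventually_ext0_ne_right (hlam : ContinuousAt lam t₀) (h0 : IsSimple (lam t₀)) :
    ∀ᶠ t in 𝓝 t₀, ∀ l m : Option (Fin r), l ≠ m → ext0 (lam t) m ≠ ext0 (lam t₀) l :=
  (Continuous.prodMk_right t₀).continuousAt.eventually (eventually_ext0_ne hlam h0)

lemma continuousAt_conj_diagonal (h : ∀ t, IsSpectral (S t) (lam t) (V t))
    (hS : ContinuousAt S t₀) (h0 : IsSimple (lam t₀)) {a : T → Fin r → ℝ}
    (ha : ContinuousAt a t₀) :
    ContinuousAt (fun t => V t * diagonal (a t) * (V t)ᵀ) t₀ := by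
  have hlam := continuousAt_eigenvalue h hS
  refine tendsto_pi_nhds.2 fun i => tendsto_pi_nhds.2 fun j => ?_
  rw [tendsto_iff_norm_sub_tendsto_zero]
  have hb := (eventually_ext0_ne_right hlam h0).mono fun t ht =>
    abs_conj_diagonal_sub_le (h t₀) (h t) ht (a t₀) (a t) i j
  refine squeeze_zero' (Eventually.of_forall fun _ => norm_nonneg _) hb ?_
  have h1 : Tendsto (fun t => q * ∑ k, |a t k - a t₀ k|) (𝓝 t₀) (𝓝 (q * ∑ k : Fin r, 0)) := by
    refine (tendsto_finsetSum _ fun k _ => ?_).const_mul _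
    have := tendsto_iff_norm_sub_tendsto_zero.1 (tendsto_pi_nhds.1 ha k)
    exact this
  have h2 : Tendsto (fun t => ∑ l, ∑ m, if l = m then 0 else
      |(ext0 (a t) m - ext0 (a t₀) l) / (ext0 (lam t) m - ext0 (lam t₀) l)|) (𝓝 t₀)
      (𝓝 (∑ l, ∑ m, if l = m then 0 else
      |(ext0 (a t₀) m - ext0 (a t₀) l) / (ext0 (lam t₀) m - ext0 (lam t₀) l)|)) := by
    refine tendsto_finsetSum _ fun l _ => tendsto_finsetSum _ fun m _ => ?_
    by_cases hlm : l = m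
    · simp [hlm]
    · simp only [if_neg hlm]
      refine Tendsto.abs (Tendsto.div ?_ ?_ (sub_ne_zero.2 fun h => hlm (ext0_injective h0 h).symm))
      · exact (continuousAt_ext0 ha m).sub continuousAt_const
      · exact (continuousAt_ext0 hlam m).sub continuousAt_const
  simpa using h1.add (h2.mul (tendsto_entrySum_sub hS))

lemma continuousAt_proj (h : ∀ t, IsSpectral (S t) (lam t) (V t))
    (hS : ContinuousAt S t₀) (h0 : IsSimple (lam t₀)) (o : Option (Fin r)) :
    ContinuousAt (fun t => proj (V t) o) t₀ := by
  cases o with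
  | some k => exact continuousAt_conj_diagonal h hS h0 continuousAt_const
  | none =>
    have := continuousAt_conj_diagonal h hS h0 (a := fun _ _ => 1) continuousAt_const
    simp only [diagonal_one, Matrix.mul_one] at this
    exact continuousAt_const.sub this

end Continuity

section Derivative

variable {S : ℝ → Matrix (Fin q) (Fin q) ℝ} {lam : ℝ → Fin r → ℝ}
  {V : ℝ → Matrix (Fin q) (Fin r) ℝ} {dS : Matrix (Fin q) (Fin q) ℝ}

/-- First-order perturbation of a simple eigenvalue: the quotient of the traces of
`Πₖ (S t - S 0) Πₖ(t) = (λₖ(t) - λₖ(0)) Πₖ Πₖ(t)` and of `Πₖ Πₖ(t)`. -/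
lemma tendsto_slope_eigenvalue (h : ∀ t, IsSpectral (S t) (lam t) (V t)) (hS : ContinuousAt S 0)
    (h0 : IsSimple (lam 0)) (hdS : Tendsto (fun t : ℝ => t⁻¹ • (S t - S 0)) (𝓝[≠] 0) (𝓝 dS))
    (k : Fin r) :
    Tendsto (fun t => t⁻¹ * (lam t k - lam 0 k)) (𝓝[≠] 0)
      (𝓝 (proj (V 0) (some k) * dS).trace) := by
  set P := proj (V 0) (some k) with hP
  have hP' : Tendsto (fun t => proj (V t) (some k)) (𝓝[≠] 0) (𝓝 P) :=
    (continuousAt_proj h hS h0 (some k)).tendsto.mono_left nhdsWithin_le_nhds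
  have hPP : P * P = P := by rw [hP, proj_mul_proj (h 0).orth]; simp
  have htr : Continuous fun A : Matrix (Fin q) (Fin q) ℝ => A.trace := by fun_prop
  have hden : Tendsto (fun t => (P * proj (V t) (some k)).trace) (𝓝[≠] 0) (𝓝 1) := by
    have := (htr.tendsto _).comp ((tendsto_const_nhds (x := P)).mul hP')
    rwa [hPP, hP, trace_proj_some (h 0).orth] at this
  have hnum : Tendsto (fun t => (P * (t⁻¹ • (S t - S 0)) * proj (V t) (some k)).trace) (𝓝[≠] 0)
      (𝓝 (P * dS).trace) := by
    have := (htr.tendsto _).comp (((tendsto_const_nhds (x := P)).mul hdS).mul hP')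
    rwa [Matrix.trace_mul_comm, ← Matrix.mul_assoc, hPP] at this
  have hq := hnum.div hden one_ne_zero
  rw [div_one] at hq
  refine hq.congr' ?_
  filter_upwards [hden.eventually_ne one_ne_zero] with t ht
  rw [Pi.div_apply, Matrix.mul_smul, Matrix.smul_mul, proj_mul_sub_mul_proj (h 0) (h t)]
  simp only [ext0_some, Matrix.trace_smul, smul_eq_mul]
  rw [← mul_assoc, mul_div_assoc, div_self ht, mul_one]

/-- The derivative of a spectral function along a curve (the Daletskii–Krein formula), where the
values `a` may depend on the parameter. -/
lemma tendsto_slope_conj_diagonal (h : ∀ t, IsSpectral (S t) (lam t) (V t))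
    (hS : ContinuousAt S 0) (h0 : IsSimple (lam 0))
    (hdS : Tendsto (fun t : ℝ => t⁻¹ • (S t - S 0)) (𝓝[≠] 0) (𝓝 dS)) {a : ℝ → Fin r → ℝ}
    (ha : ContinuousAt a 0) {da : Fin r → ℝ}
    (hda : ∀ k, Tendsto (fun t => t⁻¹ * (a t k - a 0 k)) (𝓝[≠] 0) (𝓝 (da k))) :
    Tendsto (fun t => t⁻¹ • (V t * diagonal (a t) * (V t)ᵀ - V 0 * diagonal (a 0) * (V 0)ᵀ))
      (𝓝[≠] 0) (𝓝 (∑ k, da k • proj (V 0) (some k) + ∑ l, ∑ m, if l = m then 0 else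
        ((ext0 (a 0) m - ext0 (a 0) l) / (ext0 (lam 0) m - ext0 (lam 0) l)) •
          (proj (V 0) l * dS * proj (V 0) m))) := by
  have hlam := continuousAt_eigenvalue h hS
  have hP : ∀ o, Tendsto (fun t => proj (V t) o) (𝓝[≠] 0) (𝓝 (proj (V 0) o)) := fun o =>
    (continuousAt_proj h hS h0 o).tendsto.mono_left nhdsWithin_le_nhds
  have hev := (eventually_ext0_ne_right hlam h0).filter_mono
    (nhdsWithin_le_nhds (s := {(0 : ℝ)}ᶜ))
  have hlim : Tendsto (fun t => ∑ k, (t⁻¹ * (a t k - a 0 k)) •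
        (proj (V 0) (some k) * proj (V t) (some k)) + ∑ l, ∑ m, if l = m then 0 else
        ((ext0 (a t) m - ext0 (a 0) l) / (ext0 (lam t) m - ext0 (lam 0) l)) •
          (proj (V 0) l * (t⁻¹ • (S t - S 0)) * proj (V t) m)) (𝓝[≠] 0)
      (𝓝 (∑ k, da k • (proj (V 0) (some k) * proj (V 0) (some k)) +
        ∑ l, ∑ m, if l = m then 0 else
        ((ext0 (a 0) m - ext0 (a 0) l) / (ext0 (lam 0) m - ext0 (lam 0) l)) •
          (proj (V 0) l * dS * proj (V 0) m))) := by
    refine Tendsto.add ?_ ?_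
    · exact tendsto_finsetSum _ fun k _ => (hda k).smul (tendsto_const_nhds.mul (hP _))
    · refine tendsto_finsetSum _ fun l _ => tendsto_finsetSum _ fun m _ => ?_
      by_cases hlm : l = m
      · simp [hlm]
      · simp only [if_neg hlm]
        refine Tendsto.smul (Tendsto.div ?_ ?_ ?_) ((tendsto_const_nhds.mul hdS).mul (hP _))
        · exact ((continuousAt_ext0 ha m).tendsto.mono_left nhdsWithin_le_nhds).sub_const _
        · exact ((continuousAt_ext0 hlam m).tendsto.mono_left nhdsWithin_le_nhds).sub_const _
        · exact sub_ne_zero.2 fun h => hlm (ext0_injective h0 h).symm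
  simp only [proj_mul_proj (h 0).orth, if_true] at hlim
  refine hlim.congr' ?_
  filter_upwards [hev] with t ht
  rw [conj_diagonal_sub (h 0) (h t) ht, smul_add, Finset.smul_sum, Finset.smul_sum]
  congr 1
  · exact Finset.sum_congr rfl fun k _ => by rw [smul_smul]
  · refine Finset.sum_congr rfl fun l _ => ?_
    rw [Finset.smul_sum]
    refine Finset.sum_congr rfl fun m _ => ?_
    by_cases hlm : l = m
    · simp [hlm]
    · rw [if_neg hlm, if_neg hlm, Matrix.mul_smul, Matrix.smul_mul, smul_smul, smul_smul, mul_comm]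

end Derivative

end Perturbation

/-! ### The divergence of a shrunken projection -/

section Divergence

variable {n q r : ℕ}

lemma mul_single_mul_apply (B : Matrix (Fin n) (Fin n) ℝ) (C : Matrix (Fin q) (Fin q) ℝ)
    (i a : Fin n) (j b : Fin q) :
    (B * Matrix.single i j (1 : ℝ) * C) a b = B a i * C j b := by
  rw [Matrix.mul_apply, Finset.sum_eq_single j]
  · simp
  · intro k _ hk
    simp [Matrix.mul_single_apply_of_ne, hk]
  · simp

lemma sum_mul_single_mul (B : Matrix (Fin n) (Fin n) ℝ) (C : Matrix (Fin q) (Fin q) ℝ) :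
    ∑ i : Fin n, ∑ j : Fin q, (B * Matrix.single i j (1 : ℝ) * C) i j = B.trace * C.trace := by
  simp only [mul_single_mul_apply, Matrix.trace, Finset.sum_mul_sum, Matrix.diag]

lemma sum_mul_single_transpose_mul (B C : Matrix (Fin n) (Fin q) ℝ) :
    ∑ i : Fin n, ∑ j : Fin q, (B * (Matrix.single i j (1 : ℝ))ᵀ * C) i j = (Bᵀ * C).trace := by
  have : ∀ (i : Fin n) (j : Fin q), (B * (Matrix.single i j (1 : ℝ))ᵀ * C) i j = B i j * C i j := by
    intro i j
    rw [Matrix.mul_apply, Finset.sum_eq_single i]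
    · simp [Matrix.transpose_single]
    · intro k _ hk
      simp [Matrix.transpose_single, Matrix.mul_single_apply_of_ne, hk]
    · simp
  simp only [this, Matrix.trace, Matrix.diag, Matrix.mul_apply, Matrix.transpose_apply]
  exact Finset.sum_comm

lemma trace_transpose_mul_eq_sum (B C : Matrix (Fin n) (Fin q) ℝ) :
    (Bᵀ * C).trace = ∑ i : Fin n, ∑ j : Fin q, B i j * C i j := by
  simp only [Matrix.trace, Matrix.diag, Matrix.mul_apply, Matrix.transpose_apply]
  exact Finset.sum_comm

variable {P : Matrix (Fin n) (Fin n) ℝ} {lam : Matrix (Fin n) (Fin q) ℝ → Fin r → ℝ}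
  {V : Matrix (Fin n) (Fin q) ℝ → Matrix (Fin q) (Fin r) ℝ}

/-- The Gram matrix `(P Y)ᵀ (P Y)`. -/
def gram (P : Matrix (Fin n) (Fin n) ℝ) (Y : Matrix (Fin n) (Fin q) ℝ) :
    Matrix (Fin q) (Fin q) ℝ := (P * Y)ᵀ * (P * Y)

lemma continuous_gram (P : Matrix (Fin n) (Fin n) ℝ) : Continuous (gram (q := q) P) := by
  unfold gram
  fun_prop

lemma gram_add_smul (hPT : Pᵀ = P) (hPP : P * P = P) (Y H : Matrix (Fin n) (Fin q) ℝ) (t : ℝ) :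
    gram P (Y + t • H) - gram P Y =
      t • (Hᵀ * (P * Y) + (P * Y)ᵀ * H) + (t * t) • (Hᵀ * (P * H)) := by
  have h : ∀ U W : Matrix (Fin n) (Fin q) ℝ, (P * U)ᵀ * (P * W) = Uᵀ * (P * W) := by
    intro U W
    rw [Matrix.transpose_mul, hPT, Matrix.mul_assoc, ← Matrix.mul_assoc P P, hPP]
  have h' : (P * Y)ᵀ * H = Yᵀ * (P * H) := by
    rw [Matrix.transpose_mul, hPT, Matrix.mul_assoc]
  rw [h', gram, gram, h, h]
  simp only [Matrix.mul_add, Matrix.transpose_add, Matrix.add_mul, Matrix.mul_smul,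
    Matrix.transpose_smul, Matrix.smul_mul, smul_add, smul_smul]
  abel

lemma tendsto_slope_gram (hPT : Pᵀ = P) (hPP : P * P = P) (Y H : Matrix (Fin n) (Fin q) ℝ) :
    Tendsto (fun t : ℝ => t⁻¹ • (gram P (Y + t • H) - gram P (Y + (0 : ℝ) • H))) (𝓝[≠] 0)
      (𝓝 (Hᵀ * (P * Y) + (P * Y)ᵀ * H)) := by
  have h1 : Tendsto (fun t : ℝ => Hᵀ * (P * Y) + (P * Y)ᵀ * H + t • (Hᵀ * (P * H))) (𝓝[≠] 0)
      (𝓝 (Hᵀ * (P * Y) + (P * Y)ᵀ * H + (0 : ℝ) • (Hᵀ * (P * H)))) :=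
    tendsto_const_nhds.add ((tendsto_id.mono_left nhdsWithin_le_nhds).smul_const _)
  rw [zero_smul, add_zero] at h1
  refine h1.congr' ?_
  filter_upwards [self_mem_nhdsWithin] with t (ht : t ≠ 0)
  rw [zero_smul, add_zero, gram_add_smul hPT hPP, smul_add, smul_smul, smul_smul,
    inv_mul_cancel₀ ht, one_smul, ← mul_assoc, inv_mul_cancel₀ ht, one_mul]

lemma continuous_line (Y H : Matrix (Fin n) (Fin q) ℝ) : Continuous fun t : ℝ => Y + t • H := by
  fun_prop

/-- The gradient of the `k`-th eigenvalue of the Gram matrix is `2 A Πₖ` with `A = P Y`. -/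
lemma hasLineDerivAt_eigenvalue (hPT : Pᵀ = P) (hPP : P * P = P)
    (h : ∀ Y, IsSpectral (gram P Y) (lam Y) (V Y)) {Y : Matrix (Fin n) (Fin q) ℝ}
    (h0 : IsSimple (lam Y)) (H : Matrix (Fin n) (Fin q) ℝ) (k : Fin r) :
    HasLineDerivAt ℝ (fun Z => lam Z k)
      (2 * ((P * Y * proj (V Y) (some k))ᵀ * H).trace) Y H := by
  have hY : Y + (0 : ℝ) • H = Y := by simp
  have key := tendsto_slope_eigenvalue (fun t : ℝ => h (Y + t • H))
    ((continuous_gram P).comp (continuous_line Y H)).continuousAt (by rwa [hY])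
    (tendsto_slope_gram hPT hPP Y H) k
  rw [hY] at key
  have htr : (proj (V Y) (some k) * (Hᵀ * (P * Y) + (P * Y)ᵀ * H)).trace =
      2 * ((P * Y * proj (V Y) (some k))ᵀ * H).trace := by
    rw [Matrix.mul_add, Matrix.trace_add, two_mul, Matrix.transpose_mul (P * Y), proj_transpose,
      Matrix.mul_assoc]
    congr 1
    rw [← Matrix.trace_transpose]
    simp only [Matrix.transpose_mul, Matrix.transpose_transpose, proj_transpose]
    rw [Matrix.trace_mul_comm]
  rw [htr] at key
  rw [HasLineDerivAt, hasDerivAt_iff_tendsto_slope_zero]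
  simpa using key

lemma hasLineDerivAt_eigenvalue_single (hPT : Pᵀ = P) (hPP : P * P = P)
    (h : ∀ Y, IsSpectral (gram P Y) (lam Y) (V Y)) {Y : Matrix (Fin n) (Fin q) ℝ}
    (h0 : IsSimple (lam Y)) (i : Fin n) (j : Fin q) (k : Fin r) :
    HasLineDerivAt ℝ (fun Z => lam Z k)
      (2 * (P * Y * proj (V Y) (some k)) i j) Y (Matrix.single i j 1) := by
  have := hasLineDerivAt_eigenvalue hPT hPP h h0 (Matrix.single i j 1) k
  convert this using 2
  rw [trace_transpose_mul_eq_sum, Finset.sum_eq_single i, Finset.sum_eq_single j]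
  · simp
  · intro b _ hb
    simp [Ne.symm hb]
  · simp
  · intro b _ hb
    simp [Ne.symm hb]
  · simp

/-- The derivative of `Y ↦ P Y V diag(a) Vᵀ` in a direction `H`, where `da` is the derivative of
the weights `a` in that direction. -/
noncomputable def fitDeriv (P : Matrix (Fin n) (Fin n) ℝ) (lam a da : Fin r → ℝ)
    (V : Matrix (Fin q) (Fin r) ℝ) (Y H : Matrix (Fin n) (Fin q) ℝ) :
    Matrix (Fin n) (Fin q) ℝ :=
  P * H * (V * diagonal a * Vᵀ) + P * Y * (∑ k, da k • proj V (some k) +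
    ∑ l, ∑ m, if l = m then 0 else ((ext0 a m - ext0 a l) / (ext0 lam m - ext0 lam l)) •
      (proj V l * (Hᵀ * (P * Y) + (P * Y)ᵀ * H) * proj V m))

/-- The product rule, with the Daletskii–Krein formula for the spectral factor. -/
lemma hasLineDerivAt_fit (hPT : Pᵀ = P) (hPP : P * P = P)
    (h : ∀ Y, IsSpectral (gram P Y) (lam Y) (V Y)) {Y : Matrix (Fin n) (Fin q) ℝ}
    (h0 : IsSimple (lam Y)) {a : Matrix (Fin n) (Fin q) ℝ → Fin r → ℝ} {da : Fin r → ℝ}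
    {H : Matrix (Fin n) (Fin q) ℝ} (hda : ∀ k, HasLineDerivAt ℝ (fun Z => a Z k) (da k) Y H)
    (i : Fin n) (j : Fin q) :
    HasLineDerivAt ℝ (fun Z => (P * Z * (V Z * diagonal (a Z) * (V Z)ᵀ)) i j)
      (fitDeriv P (lam Y) (a Y) da (V Y) Y H i j) Y H := by
  have hY : Y + (0 : ℝ) • H = Y := by simp
  have hS := ((continuous_gram P).comp (continuous_line Y H)).continuousAt (x := (0 : ℝ))
  have ha : ContinuousAt (fun t : ℝ => a (Y + t • H)) 0 :=
    tendsto_pi_nhds.2 fun k => (HasDerivAt.continuousAt (hda k))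
  have key := tendsto_slope_conj_diagonal (fun t : ℝ => h (Y + t • H)) hS (by rwa [hY])
    (tendsto_slope_gram hPT hPP Y H) ha (da := da)
    (fun k => by simpa using hasDerivAt_iff_tendsto_slope_zero.1 (hda k))
  have hR : ContinuousAt (fun t : ℝ => V (Y + t • H) * diagonal (a (Y + t • H)) *
      (V (Y + t • H))ᵀ) 0 :=
    continuousAt_conj_diagonal (fun t : ℝ => h (Y + t • H)) hS (by rwa [hY]) ha
  have hR' := hR.tendsto.mono_left (nhdsWithin_le_nhds (s := {(0 : ℝ)}ᶜ))
  simp only [hY] at key hR'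
  have hlim : Tendsto (fun t : ℝ => P * H * (V (Y + t • H) * diagonal (a (Y + t • H)) *
      (V (Y + t • H))ᵀ) + P * Y * (t⁻¹ • (V (Y + t • H) * diagonal (a (Y + t • H)) *
      (V (Y + t • H))ᵀ - V Y * diagonal (a Y) * (V Y)ᵀ))) (𝓝[≠] 0)
      (𝓝 (fitDeriv P (lam Y) (a Y) da (V Y) Y H)) := by
    refine Tendsto.add ?_ ?_
    · exact ((by fun_prop : Continuous fun M : Matrix (Fin q) (Fin q) ℝ =>
        P * H * M).tendsto _).comp hR'
    · exact ((by fun_prop : Continuous fun M : Matrix (Fin q) (Fin q) ℝ =>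
        P * Y * M).tendsto _).comp key
  rw [HasLineDerivAt, hasDerivAt_iff_tendsto_slope_zero]
  refine (tendsto_pi_nhds.1 (tendsto_pi_nhds.1 hlim i) j).congr' ?_
  filter_upwards [self_mem_nhdsWithin] with t (ht : t ≠ 0)
  have : P * H * (V (Y + t • H) * diagonal (a (Y + t • H)) *
      (V (Y + t • H))ᵀ) + P * Y * (t⁻¹ • (V (Y + t • H) * diagonal (a (Y + t • H)) *
      (V (Y + t • H))ᵀ - V Y * diagonal (a Y) * (V Y)ᵀ)) =
      t⁻¹ • (P * (Y + t • H) * (V (Y + t • H) * diagonal (a (Y + t • H)) * (V (Y + t • H))ᵀ) -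
        P * Y * (V Y * diagonal (a Y) * (V Y)ᵀ)) := by
    generalize V (Y + t • H) * diagonal (a (Y + t • H)) * (V (Y + t • H))ᵀ = R'
    generalize V Y * diagonal (a Y) * (V Y)ᵀ = R
    simp only [Matrix.mul_add, Matrix.add_mul, Matrix.mul_sub, Matrix.mul_smul, Matrix.smul_mul,
      smul_sub, smul_add, smul_smul, inv_mul_cancel₀ ht, one_smul]
    abel
  rw [this]
  simp only [zero_add, hY]
  rfl

/-- The degrees of freedom without the contribution of the derivatives of the weights. In the
double sum the diagonal terms vanish, as `0 / 0 = 0`. -/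
noncomputable def baseDf (rx q : ℕ) (d a : Fin r → ℝ) : ℝ :=
  ((max rx q : ℕ) : ℝ) * ∑ k, a k +
    ∑ k, ∑ l, d k ^ 2 * (a k - a l) / (d k ^ 2 - d l ^ 2)

lemma proj_mul_gram_mul_proj {Y : Matrix (Fin n) (Fin q) ℝ} {lam : Fin r → ℝ}
    {V : Matrix (Fin q) (Fin r) ℝ} (h : IsSpectral (gram P Y) lam V) (l m : Option (Fin r)) :
    (P * Y * proj V l)ᵀ * (P * Y * proj V m) = if l = m then ext0 lam l • proj V l else 0 := by
  rw [Matrix.transpose_mul (P * Y), proj_transpose]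
  calc proj V l * (P * Y)ᵀ * (P * Y * proj V m) = proj V l * gram P Y * proj V m := by
        simp only [gram, Matrix.mul_assoc]
    _ = _ := by
        rw [h.eq_mul, proj_mul_conj_diagonal h.orth, Matrix.smul_mul, proj_mul_proj h.orth]
        simp

/-- The divergence of `Y ↦ P Y V diag(a) Vᵀ` for weights `aₖ = sₖ(dₖ)` with `a'ₖ = sₖ'(dₖ)`: then `da`
is `a'ₖ` times the gradient `A Πₖ / dₖ` of the singular value. -/
lemma sum_fitDeriv (hPP : P * P = P) {rx : ℕ} (hrx : P.trace = rx)
    (hr : r = min rx q) {Y : Matrix (Fin n) (Fin q) ℝ} {d a a' : Fin r → ℝ}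
    {V : Matrix (Fin q) (Fin r) ℝ} (h : IsSpectral (gram P Y) (fun k => d k ^ 2) V)
    (h0 : IsSimple d) {da : Fin n → Fin q → Fin r → ℝ}
    (hda : ∀ i j k, da i j k = a' k / d k * (P * Y * proj V (some k)) i j) :
    ∑ i : Fin n, ∑ j : Fin q, fitDeriv P (fun k => d k ^ 2) a (da i j) V Y (Matrix.single i j 1) i j =
      baseDf rx q d a + ∑ k, d k * a' k := by
  set A := P * Y with hA
  have hPA : P * A = A := by rw [hA, ← Matrix.mul_assoc, hPP]
  have htr : ∀ l m : Option (Fin r), l ≠ m → ∑ i : Fin n, ∑ j : Fin q, (A * (proj V l *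
      ((Matrix.single i j (1 : ℝ))ᵀ * A + Aᵀ * Matrix.single i j (1 : ℝ)) * proj V m)) i j =
      ext0 (fun k => d k ^ 2) l * (proj V l).trace * (proj V m).trace := by
    intro l m hlm
    have hsplit : ∀ (i : Fin n) (j : Fin q), A * (proj V l *
        ((Matrix.single i j (1 : ℝ))ᵀ * A + Aᵀ * Matrix.single i j (1 : ℝ)) * proj V m) =
        (A * proj V l) * (Matrix.single i j (1 : ℝ))ᵀ * (A * proj V m) +
        (A * proj V l * Aᵀ) * Matrix.single i j (1 : ℝ) * proj V m := by
      intro i j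
      simp only [Matrix.mul_add, Matrix.add_mul, Matrix.mul_assoc]
    simp only [hsplit, Matrix.add_apply, Finset.sum_add_distrib]
    rw [sum_mul_single_transpose_mul, sum_mul_single_mul, proj_mul_gram_mul_proj h, if_neg hlm,
      Matrix.trace_zero, zero_add]
    congr 1
    have := congrArg Matrix.trace (proj_mul_gram_mul_proj h l l)
    rw [if_pos rfl, Matrix.trace_smul, smul_eq_mul] at this
    rw [← this, Matrix.trace_mul_comm _ (A * proj V l), Matrix.transpose_mul A, proj_transpose]
    congr 1
    rw [← Matrix.mul_assoc, Matrix.mul_assoc A (proj V l) (proj V l), proj_mul_proj h.orth,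
      if_pos rfl]
  have h1 : ∑ i : Fin n, ∑ j : Fin q, (P * Matrix.single i j (1 : ℝ) * (V * diagonal a * Vᵀ)) i j =
      rx * ∑ k, a k := by
    rw [sum_mul_single_mul, hrx, trace_conj_diagonal h.orth]
  have h2 : ∑ i : Fin n, ∑ j : Fin q, (A * (∑ k, da i j k • proj V (some k))) i j = ∑ k, d k * a' k := by
    simp only [Matrix.mul_sum, Matrix.sum_apply, Matrix.mul_smul, Matrix.smul_apply, smul_eq_mul,
      hda]
    rw [Finset.sum_congr rfl fun i _ => Finset.sum_comm, Finset.sum_comm]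
    refine Finset.sum_congr rfl fun k _ => ?_
    simp only [mul_assoc, ← Finset.mul_sum]
    rw [← trace_transpose_mul_eq_sum, proj_mul_gram_mul_proj h, if_pos rfl, Matrix.trace_smul,
      trace_proj_some h.orth]
    have := (h0.2 k).ne'
    simp only [ext0_some, smul_eq_mul]
    field_simp
  have h3 : ∑ i : Fin n, ∑ j : Fin q, (A * (∑ l, ∑ m, if l = m then 0 else
      ((ext0 a m - ext0 a l) / (ext0 (fun k => d k ^ 2) m - ext0 (fun k => d k ^ 2) l)) •
      (proj V l * ((Matrix.single i j (1 : ℝ))ᵀ * A + Aᵀ * Matrix.single i j (1 : ℝ)) *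
        proj V m))) i j =
      ∑ l, ∑ m, if l = m then 0 else
      ((ext0 a m - ext0 a l) / (ext0 (fun k => d k ^ 2) m - ext0 (fun k => d k ^ 2) l)) *
        (ext0 (fun k => d k ^ 2) l * (proj V l).trace * (proj V m).trace) := by
    simp only [Matrix.mul_sum, Matrix.sum_apply]
    rw [Finset.sum_congr rfl fun i _ => Finset.sum_comm, Finset.sum_comm]
    refine Finset.sum_congr rfl fun l _ => ?_
    rw [Finset.sum_congr rfl fun i _ => Finset.sum_comm, Finset.sum_comm]
    refine Finset.sum_congr rfl fun m _ => ?_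
    by_cases hlm : l = m
    · simp [hlm]
    · simp only [if_neg hlm, Matrix.mul_smul, Matrix.smul_apply, smul_eq_mul, ← Finset.mul_sum]
      rw [htr l m hlm]
  -- the complementary projection has rank `q - r` and contributes the multiple `q - r` of `∑ aₖ`
  have h4 : ∑ l, ∑ m, (if l = m then 0 else
      ((ext0 a m - ext0 a l) / (ext0 (fun k => d k ^ 2) m - ext0 (fun k => d k ^ 2) l)) *
        (ext0 (fun k => d k ^ 2) l * (proj V l).trace * (proj V m).trace)) =
      (q - r : ℝ) * ∑ k, a k + ∑ k, ∑ l, d k ^ 2 * (a k - a l) / (d k ^ 2 - d l ^ 2) := by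
    rw [Fintype.sum_option]
    simp only [ext0_none, zero_mul, mul_zero, ite_self, Finset.sum_const_zero, zero_add]
    simp only [Fintype.sum_option, Finset.sum_add_distrib, ext0_none, ext0_some,
      trace_proj_some h.orth, trace_proj_none h.orth, mul_one, Finset.mul_sum]
    congr 1
    · refine Finset.sum_congr rfl fun k _ => ?_
      have := (h0.2 k).ne'
      simp
      field_simp
    · refine Finset.sum_congr rfl fun k _ => Finset.sum_congr rfl fun l _ => ?_
      by_cases hkl : k = l
      · simp [hkl]
      · rw [if_neg (by simpa using hkl), ← neg_sub (a k), ← neg_sub (d k ^ 2), neg_div_neg_eq,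
          div_mul_eq_mul_div, mul_comm]
  -- this is where `r = min rx q` enters
  have h5 : (rx : ℝ) + (q - r) = ((max rx q : ℕ) : ℝ) := by
    have : rx + q = max rx q + r := by omega
    have := congrArg (Nat.cast (R := ℝ)) this
    push_cast at this ⊢
    linarith
  simp only [fitDeriv, Matrix.add_apply, Matrix.mul_add A, Finset.sum_add_distrib, ← hA]
  rw [h1, h2, h3, h4, baseDf, ← h5]
  ring

end Divergence

/-! ### The closed form, the hat matrix and the singular value decomposition -/

section ClosedForm

variable {n p q r : ℕ}

lemma lt_effRank_iff {a : Fin r → ℝ} (ha : Antitone a) (k : Fin r) :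
    (k : ℕ) < effRank a ↔ 0 < a k := by
  classical
  rw [effRank, Finset.lt_sup_iff]
  constructor
  · rintro ⟨l, hl, hkl⟩
    have h1 : 0 < a l := by simpa using hl
    exact h1.trans_le (ha (Fin.le_def.2 (Nat.lt_succ_iff.1 hkl)))
  · exact fun h => ⟨k, by simpa using h, Nat.lt_succ_self _⟩

/-- The closed form with its sums split at the effective rank agrees with the unsplit expression:
the terms in which a weight vanishes either cancel or combine into the middle sum. -/
lemma dfClosed_eq (rx q : ℕ) {d a a' : Fin r → ℝ} (ha : Antitone a) (ha0 : ∀ k, 0 ≤ a k)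
    (ha' : ∀ k, a k = 0 → a' k = 0) :
    dfClosed rx q d a a' = baseDf rx q d a + ∑ k, d k * a' k := by
  classical
  set low : Finset (Fin r) := Finset.univ.filter fun k => (k : ℕ) < effRank a with hlow
  set high : Finset (Fin r) := Finset.univ.filter fun k => effRank a ≤ (k : ℕ) with hhigh
  have hz : ∀ k ∈ high, a k = 0 := by
    intro k hk
    refine le_antisymm (not_lt.1 fun h => ?_) (ha0 k)
    exact absurd ((lt_effRank_iff ha k).2 h) (not_lt.2 (by simpa [hhigh] using hk))
  have hsplit : ∀ f : Fin r → ℝ, ∑ k, f k = ∑ k ∈ low, f k + ∑ k ∈ high, f k := by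
    intro f
    rw [← Finset.sum_filter_add_sum_filter_not Finset.univ (fun k : Fin r => (k : ℕ) < effRank a)]
    simp only [not_lt, hlow, hhigh]
  have h1 : ∑ k, a k = ∑ k ∈ low, a k := by
    rw [hsplit, Finset.sum_eq_zero hz, add_zero]
  have h2 : ∑ k, d k * a' k = ∑ k ∈ low, d k * a' k := by
    have h0 : ∑ k ∈ high, d k * a' k = 0 :=
      Finset.sum_eq_zero fun k hk => by rw [ha' k (hz k hk), mul_zero]
    rw [hsplit, h0, add_zero]
  have h3 : ∑ k, ∑ l, d k ^ 2 * (a k - a l) / (d k ^ 2 - d l ^ 2) =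
      ∑ k ∈ low, ∑ l ∈ high, a k * (d k ^ 2 + d l ^ 2) / (d k ^ 2 - d l ^ 2) +
      ∑ k ∈ low, ∑ l ∈ low.erase k, d k ^ 2 * (a k - a l) / (d k ^ 2 - d l ^ 2) := by
    rw [hsplit]
    simp only [hsplit fun l => d _ ^ 2 * (a _ - a l) / (d _ ^ 2 - d l ^ 2),
      Finset.sum_add_distrib]
    have hhh : ∑ k ∈ high, ∑ l ∈ high, d k ^ 2 * (a k - a l) / (d k ^ 2 - d l ^ 2) = 0 :=
      Finset.sum_eq_zero fun k hk => Finset.sum_eq_zero fun l hl => by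
        rw [hz k hk, hz l hl]; simp
    have hll : ∑ k ∈ low, ∑ l ∈ low, d k ^ 2 * (a k - a l) / (d k ^ 2 - d l ^ 2) =
        ∑ k ∈ low, ∑ l ∈ low.erase k, d k ^ 2 * (a k - a l) / (d k ^ 2 - d l ^ 2) := by
      refine Finset.sum_congr rfl fun k hk => ?_
      rw [← Finset.add_sum_erase _ _ hk]
      simp
    have hlh : ∑ k ∈ low, ∑ l ∈ high, a k * (d k ^ 2 + d l ^ 2) / (d k ^ 2 - d l ^ 2) =
        ∑ k ∈ low, ∑ l ∈ high, d k ^ 2 * (a k - a l) / (d k ^ 2 - d l ^ 2) +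
        ∑ k ∈ high, ∑ l ∈ low, d k ^ 2 * (a k - a l) / (d k ^ 2 - d l ^ 2) := by
      rw [Finset.sum_comm (s := high), ← Finset.sum_add_distrib]
      refine Finset.sum_congr rfl fun k _ => ?_
      rw [← Finset.sum_add_distrib]
      refine Finset.sum_congr rfl fun l hl => ?_
      rw [hz l hl, zero_sub, mul_neg, ← neg_sub (d k ^ 2) (d l ^ 2), neg_div_neg_eq, ← add_div]
      ring_nf
    rw [hhh, hll, hlh]
    ring
  rw [baseDf, h1, h2, h3, dfClosed]
  simp only [← hlow, ← hhigh]
  split_ifs with hrt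
  · ring
  · have hhe : high = ∅ := by
      refine Finset.filter_eq_empty_iff.2 fun k _ => ?_
      have := k.2
      omega
    rw [hhe]
    simp only [Finset.sum_empty, Finset.sum_const_zero]
    ring

/-- Since weights and singular values are ordered in the same way, every difference quotient is
nonnegative. -/
lemma baseDf_nonneg (rx q : ℕ) {d a : Fin r → ℝ} (hd : IsSimple d) (ha : Antitone a)
    (ha0 : ∀ k, 0 ≤ a k) : 0 ≤ baseDf rx q d a := by
  refine add_nonneg (mul_nonneg (Nat.cast_nonneg _) (Finset.sum_nonneg fun k _ => ha0 k))
    (Finset.sum_nonneg fun k _ => Finset.sum_nonneg fun l _ => ?_)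
  have hmono : ∀ {k l}, k < l → d l ^ 2 < d k ^ 2 := fun {k l} hkl =>
    pow_lt_pow_left₀ (hd.1 hkl) (hd.2 l).le two_ne_zero
  rcases lt_trichotomy k l with hkl | rfl | hkl
  · exact div_nonneg (mul_nonneg (sq_nonneg _) (sub_nonneg.2 (ha hkl.le)))
      (sub_nonneg.2 (hmono hkl).le)
  · simp
  · exact div_nonneg_of_nonpos (mul_nonpos_of_nonneg_of_nonpos (sq_nonneg _)
      (sub_nonpos.2 (ha hkl.le))) (sub_nonpos.2 (hmono hkl).le)

end ClosedForm

section HatMatrix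

variable {n p q r : ℕ}

/-- The orthogonal projection `X (XᵀX)⁺ Xᵀ` onto the column space of `X`. -/
noncomputable def hatMatrix (X : Matrix (Fin n) (Fin p) ℝ) : Matrix (Fin n) (Fin n) ℝ :=
  X * symmPinv (Xᵀ * X) (Matrix.isHermitian_conjTranspose_mul_self X) * Xᵀ

lemma symmPinv_transpose (A : Matrix (Fin p) (Fin p) ℝ) (hA : A.IsHermitian) :
    (symmPinv A hA)ᵀ = symmPinv A hA := conj_diagonal_transpose _

lemma hatMatrix_transpose (X : Matrix (Fin n) (Fin p) ℝ) : (hatMatrix X)ᵀ = hatMatrix X := by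
  have key : ∀ G : Matrix (Fin p) (Fin p) ℝ, Gᵀ = G → (X * G * Xᵀ)ᵀ = X * G * Xᵀ := by
    intro G hG
    rw [Matrix.transpose_mul, Matrix.transpose_mul, hG, Matrix.transpose_transpose,
      Matrix.mul_assoc]
  exact key _ (symmPinv_transpose _ _)

lemma hatMatrix_mul_self (X : Matrix (Fin n) (Fin p) ℝ) :
    hatMatrix X * hatMatrix X = hatMatrix X := by
  have h := (symmPinv_isMoorePenrose (Xᵀ * X)
    (Matrix.isHermitian_conjTranspose_mul_self X)).self_mul_mul
  simp only [hatMatrix]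
  conv_rhs => rw [← h]
  simp only [Matrix.mul_assoc]

lemma eigenvectorUnitary_orth {A : Matrix (Fin p) (Fin p) ℝ} (hA : A.IsHermitian) :
    (hA.eigenvectorUnitary : Matrix (Fin p) (Fin p) ℝ)ᵀ
      * (hA.eigenvectorUnitary : Matrix (Fin p) (Fin p) ℝ) = 1 := by
  have h := Unitary.coe_star_mul_self hA.eigenvectorUnitary
  rwa [Matrix.star_eq_conjTranspose, Matrix.conjTranspose_eq_transpose_of_trivial] at h

lemma symmPinv_mul_self_eq (A : Matrix (Fin p) (Fin p) ℝ) (hA : A.IsHermitian) :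
    symmPinv A hA * A = (hA.eigenvectorUnitary : Matrix (Fin p) (Fin p) ℝ) *
      diagonal (fun i => (hA.eigenvalues i)⁻¹ * hA.eigenvalues i) *
      (hA.eigenvectorUnitary : Matrix (Fin p) (Fin p) ℝ)ᵀ := by
  have hspec : A = (hA.eigenvectorUnitary : Matrix (Fin p) (Fin p) ℝ)
      * Matrix.diagonal hA.eigenvalues
      * (hA.eigenvectorUnitary : Matrix (Fin p) (Fin p) ℝ)ᵀ := by
    have h := hA.spectral_theorem
    rw [Unitary.conjStarAlgAut_apply, Matrix.star_eq_conjTranspose,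
      Matrix.conjTranspose_eq_transpose_of_trivial] at h
    exact h
  conv_lhs => rw [symmPinv]; rhs; rw [hspec]
  exact conj_diagonal_mul (eigenvectorUnitary_orth hA) _ _

lemma hatMatrix_trace (X : Matrix (Fin n) (Fin p) ℝ) : (hatMatrix X).trace = X.rank := by
  have hA := Matrix.isHermitian_conjTranspose_mul_self X
  rw [Matrix.conjTranspose_eq_transpose_of_trivial] at hA
  have h1 : (hatMatrix X).trace = (symmPinv (Xᵀ * X) hA * (Xᵀ * X)).trace := by
    rw [hatMatrix, Matrix.mul_assoc, Matrix.trace_mul_comm, Matrix.mul_assoc]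
  rw [h1, symmPinv_mul_self_eq, trace_conj_diagonal (eigenvectorUnitary_orth hA),
    ← Matrix.rank_transpose_mul_self X, hA.rank_eq_card_non_zero_eigs, Fintype.card_subtype,
    Finset.card_filter]
  push_cast
  refine Finset.sum_congr rfl fun i _ => ?_
  by_cases h : hA.eigenvalues i = 0
  · simp [h]
  · simp [h]

lemma hatMatrix_mul (X : Matrix (Fin n) (Fin p) ℝ) : hatMatrix X * X = X := by
  have h := (symmPinv_isMoorePenrose (Xᵀ * X)
    (Matrix.isHermitian_conjTranspose_mul_self X)).mul_mul_self
  rw [← sub_eq_zero, ← Matrix.conjTranspose_mul_self_eq_zero,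
    Matrix.conjTranspose_eq_transpose_of_trivial]
  have h2 : Xᵀ * (hatMatrix X * X - X) = 0 := by
    rw [Matrix.mul_sub, sub_eq_zero]
    conv_rhs => rw [← h]
    simp only [hatMatrix, Matrix.mul_assoc]
  rw [Matrix.transpose_sub, Matrix.transpose_mul, hatMatrix_transpose, Matrix.sub_mul,
    Matrix.mul_assoc, h2, sub_zero, Matrix.mul_sub, ← Matrix.mul_assoc, hatMatrix_mul_self,
    sub_self, Matrix.mul_zero]

end HatMatrix

section SVD

variable {n p q r : ℕ} {P : Matrix (Fin n) (Fin n) ℝ} {Y : Matrix (Fin n) (Fin q) ℝ}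
  {W : Matrix (Fin n) (Fin r) ℝ} {d : Fin r → ℝ} {V : Matrix (Fin q) (Fin r) ℝ}

lemma IsThinSVD.isSpectral (h : IsThinSVD (P * Y) W d V) :
    IsSpectral (gram P Y) (fun k => d k ^ 2) V where
  orth := h.right_orthonormal
  anti := fun k l hkl => pow_le_pow_left₀ (h.nonneg l) (h.antitone hkl) 2
  nonneg := fun _ => sq_nonneg _
  eq_mul := by
    have : (P * Y)ᵀ * (P * Y) = V * diagonal d * (Wᵀ * W) * diagonal d * Vᵀ := by
      rw [h.eq_mul]
      simp only [Matrix.transpose_mul, Matrix.transpose_transpose, diagonal_transpose,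
        Matrix.mul_assoc]
    rw [gram, this, h.left_orthonormal, Matrix.mul_one, Matrix.mul_assoc V, diagonal_mul_diagonal]
    simp only [sq]

/-- Shrinking the singular values multiplies the matrix by a spectral function of its Gram matrix;
the left singular vectors are not needed. -/
lemma IsThinSVD.shrink_eq {A : Matrix (Fin n) (Fin q) ℝ} (h : IsThinSVD A W d V)
    (a : Fin r → ℝ) : shrink W d V a = A * (V * diagonal a * Vᵀ) := by
  have h1 : A * (V * diagonal a * Vᵀ) = W * diagonal (fun k => d k * a k) * Vᵀ := by
    calc A * (V * diagonal a * Vᵀ) = W * diagonal d * (Vᵀ * V) * diagonal a * Vᵀ := by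
          rw [h.eq_mul]; simp only [Matrix.mul_assoc]
      _ = _ := by
          rw [h.right_orthonormal, Matrix.mul_one, Matrix.mul_assoc W, diagonal_mul_diagonal]
  rw [h1, shrink]
  ext i j
  rw [Matrix.sum_apply, Matrix.mul_apply]
  refine Finset.sum_congr rfl fun k _ => ?_
  rw [Matrix.mul_diagonal]
  simp [Matrix.vecMulVec_apply]
  ring

lemma isSimple_sq (hd : IsSimple d) : IsSimple fun k => d k ^ 2 :=
  ⟨fun _ l hkl => pow_lt_pow_left₀ (hd.1 hkl) (hd.2 l).le two_ne_zero,
    fun k => pow_pos (hd.2 k) 2⟩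

lemma isSimple_of_sq (h0 : ∀ k, 0 ≤ d k) (hd : IsSimple fun k => d k ^ 2) : IsSimple d :=
  ⟨fun k l hkl => lt_of_pow_lt_pow_left₀ 2 (h0 k) (hd.1 hkl),
    fun k => (h0 k).lt_of_ne fun h => (hd.2 k).ne' (by simp [← h])⟩

end SVD

section Fit

variable {n q r : ℕ} {P : Matrix (Fin n) (Fin n) ℝ}
  {W : Matrix (Fin n) (Fin q) ℝ → Matrix (Fin n) (Fin r) ℝ}
  {d : Matrix (Fin n) (Fin q) ℝ → Fin r → ℝ}
  {V : Matrix (Fin n) (Fin q) ℝ → Matrix (Fin q) (Fin r) ℝ}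

lemma hasLineDerivAt_singularValue (hPT : Pᵀ = P) (hPP : P * P = P)
    (h : ∀ Y, IsThinSVD (P * Y) (W Y) (d Y) (V Y)) {Y : Matrix (Fin n) (Fin q) ℝ}
    (h0 : IsSimple (d Y)) (i : Fin n) (j : Fin q) (k : Fin r) :
    HasLineDerivAt ℝ (fun Z => d Z k)
      ((P * Y * proj (V Y) (some k)) i j / d Y k) Y (Matrix.single i j 1) := by
  have h1 := hasLineDerivAt_eigenvalue_single hPT hPP (fun Z => (h Z).isSpectral)
    (isSimple_sq h0) i j k
  have hY : Y + (0 : ℝ) • Matrix.single i j (1 : ℝ) = Y := by simp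
  have h2 := HasDerivAt.sqrt h1 (by rw [hY]; exact (pow_pos (h0.2 k) 2).ne')
  rw [hY, Real.sqrt_sq (h0.2 k).le, mul_div_mul_left _ _ two_ne_zero] at h2
  refine h2.congr_of_eventuallyEq (Eventually.of_forall fun t => ?_)
  exact (Real.sqrt_sq ((h _).nonneg k)).symm

variable {s : Fin r → ℝ → ℝ}

/-- The shrinkage estimator `Y ↦ A V diag(s(d)) Vᵀ` with `A = P Y`. The values of the weights at `0` are
irrelevant, since `A` vanishes on the corresponding right singular vectors. -/
noncomputable def fit (P : Matrix (Fin n) (Fin n) ℝ) (d : Matrix (Fin n) (Fin q) ℝ → Fin r → ℝ)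
    (V : Matrix (Fin n) (Fin q) ℝ → Matrix (Fin q) (Fin r) ℝ) (s : Fin r → ℝ → ℝ)
    (Y : Matrix (Fin n) (Fin q) ℝ) : Matrix (Fin n) (Fin q) ℝ :=
  P * Y * (V Y * diagonal (fun k => s k (d Y k)) * (V Y)ᵀ)

lemma hasLineDerivAt_fit_single (hPT : Pᵀ = P) (hPP : P * P = P)
    (h : ∀ Y, IsThinSVD (P * Y) (W Y) (d Y) (V Y)) {Y : Matrix (Fin n) (Fin q) ℝ}
    (h0 : IsSimple (d Y)) (hs : ∀ k, DifferentiableAt ℝ (s k) (d Y k))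
    (i i' : Fin n) (j j' : Fin q) :
    HasLineDerivAt ℝ (fun Z => fit P d V s Z i' j')
      (fitDeriv P (fun k => d Y k ^ 2) (fun k => s k (d Y k))
        (fun k => deriv (s k) (d Y k) / d Y k * (P * Y * proj (V Y) (some k)) i j) (V Y) Y
        (Matrix.single i j 1) i' j') Y (Matrix.single i j 1) := by
  refine hasLineDerivAt_fit hPT hPP (fun Z => (h Z).isSpectral) (isSimple_sq h0)
    (a := fun Z k => s k (d Z k)) (fun k => ?_) i' j'
  have hY : Y + (0 : ℝ) • Matrix.single i j (1 : ℝ) = Y := by simp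
  have h1 := (hs k).hasDerivAt
  rw [← hY] at h1
  have h2 := HasDerivAt.comp (0 : ℝ) h1 (hasLineDerivAt_singularValue hPT hPP h h0 i j k)
  rw [hY, mul_div_assoc', mul_div_right_comm] at h2
  exact h2

/-- The divergence of the shrinkage estimator at a response with simple, positive singular
values. -/
lemma sum_lineDeriv_fit (hPT : Pᵀ = P) (hPP : P * P = P) {rx : ℕ} (hrx : P.trace = rx)
    (hr : r = min rx q) (h : ∀ Y, IsThinSVD (P * Y) (W Y) (d Y) (V Y))
    {Y : Matrix (Fin n) (Fin q) ℝ} (h0 : IsSimple (d Y))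
    (hs : ∀ k, DifferentiableAt ℝ (s k) (d Y k)) :
    ∑ i : Fin n, ∑ j : Fin q,
        lineDeriv ℝ (fun Z => fit P d V s Z i j) Y (Matrix.single i j 1) =
      baseDf rx q (d Y) (fun k => s k (d Y k)) + ∑ k, d Y k * deriv (s k) (d Y k) := by
  rw [← sum_fitDeriv hPP hrx hr (h Y).isSpectral h0 (a' := fun k => deriv (s k) (d Y k))
    (da := fun i j k => deriv (s k) (d Y k) / d Y k * (P * Y * proj (V Y) (some k)) i j)
    fun _ _ _ => rfl]
  exact Finset.sum_congr rfl fun i _ => Finset.sum_congr rfl fun j _ =>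
    (hasLineDerivAt_fit_single hPT hPP h h0 hs i i j j).lineDeriv

/-- A nonnegative function has derivative `0` at its zeros; the junk value of `deriv` covers the case
of a function that is not differentiable. -/
lemma deriv_eq_zero_of_nonneg {f : ℝ → ℝ} (hf : ∀ x, 0 < x → 0 ≤ f x) {x : ℝ} (hx : 0 < x)
    (h : f x = 0) : deriv f x = 0 := by
  refine IsLocalMin.deriv_eq_zero ?_
  filter_upwards [lt_mem_nhds hx] with y hy
  rw [h]
  exact hf y hy

/-- The scalar product of the estimator with the gradient of the `k`-th squared singular value. -/
lemma sum_gradient_mul_fit (h : ∀ Y, IsThinSVD (P * Y) (W Y) (d Y) (V Y))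
    (Y : Matrix (Fin n) (Fin q) ℝ) (k : Fin r) :
    ∑ i : Fin n, ∑ j : Fin q, 2 * (P * Y * proj (V Y) (some k)) i j * fit P d V s Y i j =
      2 * (d Y k ^ 2 * s k (d Y k)) := by
  simp only [mul_assoc, ← Finset.mul_sum]
  rw [← trace_transpose_mul_eq_sum]
  congr 1
  rw [fit, conj_diagonal_eq_sum, Matrix.mul_sum, Matrix.mul_sum, Matrix.trace_sum,
    Finset.sum_eq_single k]
  · rw [Matrix.mul_smul, Matrix.mul_smul, Matrix.trace_smul, proj_mul_gram_mul_proj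
      (h Y).isSpectral, if_pos rfl, Matrix.trace_smul, trace_proj_some (h Y).right_orthonormal]
    simp [mul_comm]
  · intro l _ hl
    rw [Matrix.mul_smul, Matrix.mul_smul, Matrix.trace_smul, proj_mul_gram_mul_proj
      (h Y).isSpectral, if_neg (by simpa using Ne.symm hl)]
    simp
  · simp

/-- The scalar product of the estimator with the response. -/
lemma sum_mul_fit (hPT : Pᵀ = P) (hPP : P * P = P)
    (h : ∀ Y, IsThinSVD (P * Y) (W Y) (d Y) (V Y)) (Y : Matrix (Fin n) (Fin q) ℝ) :
    ∑ i, ∑ j, Y i j * fit P d V s Y i j = ∑ k, d Y k ^ 2 * s k (d Y k) := by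
  have hg : Yᵀ * (P * Y) = gram P Y := by
    rw [gram, Matrix.transpose_mul, hPT, Matrix.mul_assoc, ← Matrix.mul_assoc P P, hPP]
  rw [← trace_transpose_mul_eq_sum, fit, ← Matrix.mul_assoc, hg, (h Y).isSpectral.eq_mul,
    conj_diagonal_mul (h Y).right_orthonormal, trace_conj_diagonal (h Y).right_orthonormal]

/-- Projecting contracts the Frobenius norm. -/
lemma sum_sq_singularValue_le (hPT : Pᵀ = P) (hPP : P * P = P)
    (h : ∀ Y, IsThinSVD (P * Y) (W Y) (d Y) (V Y)) (Y : Matrix (Fin n) (Fin q) ℝ) :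
    ∑ k, d Y k ^ 2 ≤ ∑ i, ∑ j, Y i j ^ 2 := by
  have h1 : ∑ k, d Y k ^ 2 = (Yᵀ * (P * Y)).trace := by
    have hg : Yᵀ * (P * Y) = gram P Y := by
      rw [gram, Matrix.transpose_mul, hPT, Matrix.mul_assoc, ← Matrix.mul_assoc P P, hPP]
    rw [hg, (h Y).isSpectral.eq_mul, trace_conj_diagonal (h Y).right_orthonormal]
  have h2 : (((1 - P) * Y)ᵀ * ((1 - P) * Y)).trace = (Yᵀ * Y).trace - (Yᵀ * (P * Y)).trace := by
    rw [← Matrix.trace_sub, ← Matrix.mul_sub]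
    congr 1
    have h3 : (1 - P) * (1 - P) = 1 - P := by
      rw [Matrix.mul_sub, Matrix.sub_mul 1 P P, hPP]; simp
    rw [Matrix.transpose_mul, Matrix.mul_assoc, ← Matrix.mul_assoc (1 - P)ᵀ,
      Matrix.transpose_sub, hPT, Matrix.transpose_one, h3, Matrix.sub_mul, Matrix.one_mul]
  have h4 : 0 ≤ (((1 - P) * Y)ᵀ * ((1 - P) * Y)).trace := by
    rw [trace_transpose_mul_eq_sum]
    exact Finset.sum_nonneg fun i _ => Finset.sum_nonneg fun j _ => mul_self_nonneg _
  rw [h1]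
  have h5 : (Yᵀ * Y).trace = ∑ i, ∑ j, Y i j ^ 2 := by
    rw [trace_transpose_mul_eq_sum]
    simp only [sq]
  linarith

/-- Shrinking contracts the Frobenius norm. -/
lemma sum_sq_fit_le (hPT : Pᵀ = P) (hPP : P * P = P)
    (h : ∀ Y, IsThinSVD (P * Y) (W Y) (d Y) (V Y)) (hs : ∀ k x, 0 < x → s k x ∈ Set.Icc (0 : ℝ) 1)
    (Y : Matrix (Fin n) (Fin q) ℝ) :
    ∑ i, ∑ j, fit P d V s Y i j ^ 2 ≤ ∑ i, ∑ j, Y i j ^ 2 := by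
  refine le_trans (le_of_eq ?_) ((Finset.sum_le_sum (f := fun k => d Y k ^ 2 * s k (d Y k) ^ 2)
    fun k _ => ?_).trans (sum_sq_singularValue_le hPT hPP h Y))
  · simp only [sq (fit P d V s Y _ _)]
    rw [← trace_transpose_mul_eq_sum, fit, Matrix.transpose_mul (P * Y), conj_diagonal_transpose]
    rw [Matrix.mul_assoc, ← Matrix.mul_assoc (P * Y)ᵀ, ← gram, (h Y).isSpectral.eq_mul,
      conj_diagonal_mul (h Y).right_orthonormal, conj_diagonal_mul (h Y).right_orthonormal,
      trace_conj_diagonal (h Y).right_orthonormal]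
    exact Finset.sum_congr rfl fun k _ => by ring
  · rcases ((h Y).nonneg k).eq_or_lt with h0 | h0
    · rw [← h0]; simp
    · have := hs k _ h0
      exact mul_le_of_le_one_right (sq_nonneg _) (pow_le_one₀ this.1 this.2)

end Fit

/-! ### Almost every response has simple singular values -/

section Discriminant

variable {n p q r : ℕ}

/-- The Hankel determinant of the power sums `tr Sᵐ`, `m ≥ 2`: a polynomial in the entries of `S`
that equals `(∏ λₖ ∏_{k < l} (λₗ - λₖ))²` when `S` has rank at most `r`. Being a polynomial in `S`, it
can be evaluated without reference to eigenvalues, over any commutative ring. -/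
noncomputable def momentDet {R : Type*} [CommRing R] (r : ℕ) (S : Matrix (Fin q) (Fin q) R) : R :=
  (Matrix.of fun i j : Fin r => (S ^ ((i : ℕ) + j + 2)).trace).det

lemma map_momentDet {R R' : Type*} [CommRing R] [CommRing R'] (f : R →+* R') (r : ℕ)
    (S : Matrix (Fin q) (Fin q) R) : f (momentDet r S) = momentDet r (S.map f) := by
  rw [momentDet, momentDet, RingHom.map_det]
  congr 1
  ext i j
  have h := map_pow f.mapMatrix S ((i : ℕ) + j + 2)
  simp only [RingHom.mapMatrix_apply] at h
  simp only [RingHom.mapMatrix_apply, Matrix.map_apply, Matrix.of_apply, ← h]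
  exact AddMonoidHom.map_trace f.toAddMonoidHom _

lemma continuous_momentDet (r : ℕ) : Continuous (momentDet (q := q) (R := ℝ) r) := by
  unfold momentDet
  fun_prop

variable {S : Matrix (Fin q) (Fin q) ℝ} {lam : Fin r → ℝ} {V : Matrix (Fin q) (Fin r) ℝ}

lemma IsSpectral.pow_succ (h : IsSpectral S lam V) (m : ℕ) :
    S ^ (m + 1) = V * diagonal (fun k => lam k ^ (m + 1)) * Vᵀ := by
  induction m with
  | zero => simpa using h.eq_mul
  | succ m ih =>
    rw [_root_.pow_succ, ih]
    conv_lhs => rw [h.eq_mul]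
    rw [conj_diagonal_mul h.orth]
    simp only [← _root_.pow_succ]

/-- The Hankel matrix is `BᵀB`, where `B` has the rows `λₖ (1, λₖ, λₖ², …)`. -/
lemma IsSpectral.momentDet_eq (h : IsSpectral S lam V) :
    momentDet r S = ((∏ k, lam k) * (Matrix.vandermonde lam).det) ^ 2 := by
  have h1 : (Matrix.of fun i j : Fin r => (S ^ ((i : ℕ) + j + 2)).trace) =
      (diagonal lam * Matrix.vandermonde lam)ᵀ * (diagonal lam * Matrix.vandermonde lam) := by
    ext i j
    rw [Matrix.of_apply, show (i : ℕ) + j + 2 = (i + j + 1) + 1 from rfl, h.pow_succ,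
      trace_conj_diagonal h.orth, Matrix.mul_apply]
    refine Finset.sum_congr rfl fun k _ => ?_
    rw [Matrix.transpose_apply, Matrix.diagonal_mul, Matrix.diagonal_mul,
      Matrix.vandermonde_apply, Matrix.vandermonde_apply]
    ring
  rw [momentDet, h1, det_mul, det_transpose, det_mul, det_diagonal, sq]

lemma IsSpectral.momentDet_ne_zero_iff (h : IsSpectral S lam V) :
    momentDet r S ≠ 0 ↔ IsSimple lam := by
  rw [h.momentDet_eq, pow_ne_zero_iff two_ne_zero, mul_ne_zero_iff, Finset.prod_ne_zero_iff,
    Matrix.det_vandermonde_ne_zero_iff]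
  constructor
  · rintro ⟨h1, h2⟩
    exact ⟨h.anti.strictAnti_of_injective h2,
      fun k => (h.nonneg k).lt_of_ne (h1 k (Finset.mem_univ _)).symm⟩
  · exact fun h1 => ⟨fun k _ => (h1.2 k).ne', h1.1.injective⟩

/-- There is a matrix whose projection to the column space of `X` has the maximal number of nonzero
singular values, all of them distinct. -/
lemma exists_isSpectral_isSimple (X : Matrix (Fin n) (Fin p) ℝ) (hrX : r ≤ X.rank) (hrq : r ≤ q) :
    ∃ (H : Matrix (Fin n) (Fin q) ℝ) (lam : Fin r → ℝ) (V : Matrix (Fin q) (Fin r) ℝ),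
      IsSpectral (gram (hatMatrix X) H) lam V ∧ IsSimple lam := by
  have hA : (Xᵀ * X).IsHermitian := Matrix.isHermitian_conjTranspose_mul_self X
  have hpos : ∀ i, 0 ≤ hA.eigenvalues i :=
    (Matrix.posSemidef_conjTranspose_mul_self X).eigenvalues_nonneg
  set Q := (hA.eigenvectorUnitary : Matrix (Fin p) (Fin p) ℝ) with hQ
  have hQQ : Qᵀ * Q = 1 := eigenvectorUnitary_orth hA
  have hspec : Qᵀ * (Xᵀ * X) * Q = diagonal hA.eigenvalues := by
    have h := hA.spectral_theorem
    rw [Unitary.conjStarAlgAut_apply, Matrix.star_eq_conjTranspose,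
      Matrix.conjTranspose_eq_transpose_of_trivial] at h
    have h' : Xᵀ * X = Q * diagonal hA.eigenvalues * Qᵀ := h
    conv_lhs => rw [h']
    calc Qᵀ * (Q * diagonal hA.eigenvalues * Qᵀ) * Q
        = (Qᵀ * Q) * diagonal hA.eigenvalues * (Qᵀ * Q) := by simp only [Matrix.mul_assoc]
      _ = _ := by rw [hQQ, Matrix.one_mul, Matrix.mul_one]
  have hcard : Fintype.card (Fin r) ≤ Fintype.card {i // hA.eigenvalues i ≠ 0} := by
    rw [← hA.rank_eq_card_non_zero_eigs, Matrix.rank_transpose_mul_self, Fintype.card_fin]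
    exact hrX
  obtain ⟨e⟩ := Function.Embedding.nonempty_of_card_le hcard
  have hμ : ∀ k, 0 < hA.eigenvalues (e k) := fun k => (hpos _).lt_of_ne (e k).2.symm
  set U : Matrix (Fin n) (Fin r) ℝ :=
    X * (Q.submatrix id (fun k => (e k : Fin p)) *
      diagonal fun k => (√(hA.eigenvalues (e k)))⁻¹) with hU
  have hUU : Uᵀ * U = 1 := by
    have h1 : Uᵀ * U = diagonal (fun k => (√(hA.eigenvalues (e k)))⁻¹) *
        (Qᵀ * (Xᵀ * X) * Q).submatrix (fun k => (e k : Fin p)) (fun k => (e k : Fin p)) *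
        diagonal (fun k => (√(hA.eigenvalues (e k)))⁻¹) := by
      have h2 : (Qᵀ * (Xᵀ * X) * Q).submatrix (fun k => (e k : Fin p)) (fun k => (e k : Fin p)) =
          (Q.submatrix id (fun k => (e k : Fin p)))ᵀ * (Xᵀ * X) *
            Q.submatrix id (fun k => (e k : Fin p)) := by
        rfl
      rw [h2, hU]
      simp only [Matrix.transpose_mul, diagonal_transpose, Matrix.mul_assoc]
    rw [h1, hspec]
    ext k l
    rw [Matrix.mul_diagonal, Matrix.diagonal_mul, Matrix.submatrix_apply]
    by_cases hkl : k = l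
    · subst hkl
      have h3 := Real.mul_self_sqrt (hpos (e k))
      have h4 := (Real.sqrt_pos.2 (hμ k)).ne'
      rw [diagonal_apply_eq, Matrix.one_apply_eq]
      field_simp
      linarith [h3]
    · have : (e k : Fin p) ≠ e l := fun h => hkl (e.injective (Subtype.ext h))
      rw [diagonal_apply_ne _ this, Matrix.one_apply_ne hkl]
      simp
  have hPU : hatMatrix X * U = U := by rw [hU, ← Matrix.mul_assoc, hatMatrix_mul]
  set E : Matrix (Fin q) (Fin r) ℝ := (1 : Matrix (Fin q) (Fin q) ℝ).submatrix id (Fin.castLE hrq)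
    with hE
  have hEE : Eᵀ * E = 1 := by
    have : Eᵀ * E = ((1 : Matrix (Fin q) (Fin q) ℝ)ᵀ * 1).submatrix (Fin.castLE hrq)
      (Fin.castLE hrq) := rfl
    rw [this, Matrix.transpose_one, Matrix.one_mul,
      Matrix.submatrix_one _ (Fin.castLE_injective hrq)]
  -- any strictly decreasing positive sequence serves as singular values
  set δ : Fin r → ℝ := fun k => (r : ℝ) - k with hδ
  have hδ0 : IsSimple δ := by
    refine ⟨fun k l hkl => ?_, fun k => ?_⟩
    · have : ((k : ℕ) : ℝ) < (l : ℕ) := Nat.cast_lt.2 hkl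
      simp only [hδ]
      linarith
    · have : ((k : ℕ) : ℝ) < r := Nat.cast_lt.2 k.2
      simp only [hδ]
      linarith
  have hsvd : IsThinSVD (hatMatrix X * (U * diagonal δ * Eᵀ)) U δ E :=
    { left_orthonormal := hUU
      right_orthonormal := hEE
      antitone := hδ0.1.antitone
      nonneg := fun k => (hδ0.2 k).le
      eq_mul := by rw [← Matrix.mul_assoc, ← Matrix.mul_assoc, hPU] }
  exact ⟨_, _, _, hsvd.isSpectral, isSimple_sq hδ0⟩

/-- On a line through a point `H` with nonvanishing discriminant, the discriminant is a nonzero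
polynomial and hence has only finitely many zeros. -/
lemma finite_momentDet_eq_zero (P : Matrix (Fin n) (Fin n) ℝ) (Y H : Matrix (Fin n) (Fin q) ℝ)
    (hH : momentDet r (gram P H) ≠ 0) :
    {t : ℝ | momentDet r (gram P (t • Y + (1 - t) • H)) = 0}.Finite := by
  set Z : Matrix (Fin n) (Fin q) (Polynomial ℝ) := (Polynomial.X : Polynomial ℝ) •
    Y.map Polynomial.C + (1 - Polynomial.X : Polynomial ℝ) • H.map Polynomial.C with hZ
  set PZ := P.map (Polynomial.C : ℝ →+* Polynomial ℝ) * Z with hPZ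
  set f : Polynomial ℝ := momentDet r (PZᵀ * PZ) with hf
  have hev : ∀ t : ℝ, f.eval t = momentDet r (gram P (t • Y + (1 - t) • H)) := by
    intro t
    have h1 : Z.map (Polynomial.evalRingHom t) = t • Y + (1 - t) • H := by
      ext i j
      simp [hZ, mul_comm t]
    have h2 : PZ.map (Polynomial.evalRingHom t) = P * (t • Y + (1 - t) • H) := by
      rw [hPZ, Matrix.map_mul, h1]
      congr 1
      ext i j
      simp
    rw [← Polynomial.coe_evalRingHom, hf, map_momentDet, Matrix.map_mul, Matrix.transpose_map, h2,
      gram]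
  have hf0 : f ≠ 0 := by
    intro h0
    apply hH
    have := hev 0
    rw [h0] at this
    simpa using this.symm
  refine (f.roots.toFinset.finite_toSet).subset fun t ht => ?_
  simp only [Finset.mem_coe, Multiset.mem_toFinset, Polynomial.mem_roots hf0, Polynomial.IsRoot]
  rw [hev]
  exact ht

end Discriminant

section Null

/-- A set that is met in a null set by every line through a fixed point is a null set. -/
lemma volume_eq_zero_of_lines {ι : Type*} [Fintype ι] {B : Set (ι → ℝ)} (hB : MeasurableSet B)
    (h : ι → ℝ) (hl : ∀ y, ∀ᵐ t : ℝ, t • y + (1 - t) • h ∉ B) : volume B = 0 := by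
  have hm : MeasurableSet {x : (ι → ℝ) × ℝ | x.2 • x.1 + (1 - x.2) • h ∉ B} := by
    have hc : Continuous fun x : (ι → ℝ) × ℝ => x.2 • x.1 + (1 - x.2) • h := by fun_prop
    exact hc.measurable hB.compl
  have h1 : ∀ᵐ t : ℝ, ∀ᵐ y : ι → ℝ, t • y + (1 - t) • h ∉ B :=
    (Measure.ae_ae_comm hm).1 (Eventually.of_forall hl)
  have h2 : ∀ᵐ t : ℝ, t ≠ 0 := by simp [ae_iff]
  obtain ⟨t, ht, ht0⟩ := (h1.and h2).exists
  have h3 : volume ((t • ·) ⁻¹' ((· + (1 - t) • h) ⁻¹' B)) = 0 := by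
    rw [ae_iff] at ht
    simp only [not_not] at ht
    exact ht
  rw [Measure.addHaar_preimage_smul _ ht0, measure_preimage_add_right] at h3
  refine (mul_eq_zero.1 h3).resolve_left ?_
  rw [ENNReal.ofReal_eq_zero, not_le]
  positivity

/-- Rademacher's theorem on the half-line. -/
lemma ae_differentiableAt_of_locallyLipschitzOn {f : ℝ → ℝ}
    (hf : LocallyLipschitzOn (Set.Ioi 0) f) : ∀ᵐ x : ℝ, 0 < x → DifferentiableAt ℝ f x := by
  have h1 : ∀ m : ℕ, ∀ᵐ x : ℝ, x ∈ Set.Icc ((1 : ℝ) / (m + 1)) (m + 1) →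
      DifferentiableWithinAt ℝ f (Set.Icc ((1 : ℝ) / (m + 1)) (m + 1)) x := by
    intro m
    obtain ⟨K, hK⟩ := LocallyLipschitzOn.exists_lipschitzOnWith_of_compact
      (isCompact_Icc (a := (1 : ℝ) / (m + 1)) (b := m + 1))
      (hf.mono fun x hx => lt_of_lt_of_le (by positivity) hx.1)
    exact hK.ae_differentiableWithinAt_of_mem
  filter_upwards [ae_all_iff.2 h1] with x hx hx0
  obtain ⟨m, hm⟩ := exists_nat_gt (max x (1 / x))
  have hxm : x < m := (le_max_left _ _).trans_lt hm
  have hxm' : 1 / x < m := (le_max_right _ _).trans_lt hm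
  have h2 : (1 : ℝ) / (m + 1) < x := by
    rw [div_lt_iff₀ (by positivity)]
    rw [div_lt_iff₀ hx0] at hxm'
    nlinarith
  exact (hx m ⟨h2.le, by linarith⟩).differentiableAt (Icc_mem_nhds h2 (by linarith))

variable {n p q r : ℕ}

/-- The matrix with the entries `y`. -/
def toMat (y : Fin n × Fin q → ℝ) : Matrix (Fin n) (Fin q) ℝ := Matrix.of fun i j => y (i, j)

lemma continuous_toMat : Continuous (toMat (n := n) (q := q)) := by
  unfold toMat
  exact continuous_pi fun i => continuous_pi fun j => continuous_apply (i, j)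

variable {P : Matrix (Fin n) (Fin n) ℝ}
  {W : Matrix (Fin n) (Fin q) ℝ → Matrix (Fin n) (Fin r) ℝ}
  {d : Matrix (Fin n) (Fin q) ℝ → Fin r → ℝ}
  {V : Matrix (Fin n) (Fin q) ℝ → Matrix (Fin q) (Fin r) ℝ}

lemma continuous_singularValue (h : ∀ Y, IsThinSVD (P * Y) (W Y) (d Y) (V Y)) (k : Fin r) :
    Continuous fun Y => d Y k := by
  refine continuous_iff_continuousAt.2 fun Y => ?_
  have h1 := tendsto_pi_nhds.1 (continuousAt_eigenvalue (fun Z => (h Z).isSpectral)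
    (continuous_gram P).continuousAt (t₀ := Y)) k
  have h2 := (Real.continuous_sqrt.tendsto _).comp h1
  refine (h2.congr fun Z => Real.sqrt_sq ((h Z).nonneg k)).trans_eq ?_
  rw [Real.sqrt_sq ((h Y).nonneg k)]

lemma singularValue_smul (h : ∀ Y, IsThinSVD (P * Y) (W Y) (d Y) (V Y)) (t : ℝ)
    (Y : Matrix (Fin n) (Fin q) ℝ) (k : Fin r) : d (t • Y) k = |t| * d Y k := by
  have h1 : IsSpectral (gram P (t • Y)) (fun k => t ^ 2 * d Y k ^ 2) (V Y) :=
    { orth := (h Y).right_orthonormal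
      anti := fun k l hkl => mul_le_mul_of_nonneg_left ((h Y).isSpectral.anti hkl) (sq_nonneg t)
      nonneg := fun k => by positivity
      eq_mul := by
        have : gram P (t • Y) = (t ^ 2) • gram P Y := by
          simp [gram, smul_smul, sq]
        rw [this, (h Y).isSpectral.eq_mul]
        have : diagonal (fun k => t ^ 2 * d Y k ^ 2) = (t ^ 2) • diagonal (fun k => d Y k ^ 2) := by
          rw [← diagonal_smul]; rfl
        rw [this]
        simp }
  have h2 := congrFun ((h (t • Y)).isSpectral.eigenvalue_unique h1) k
  rw [← mul_pow, ← sq_abs (t * _), abs_mul, abs_of_nonneg ((h Y).nonneg k)] at h2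
  exact (pow_left_inj₀ ((h _).nonneg k) (by have := (h Y).nonneg k; positivity) two_ne_zero).1 h2

/-- For almost every response the projected response has the maximal number of nonzero singular
values, all of them distinct. -/
lemma ae_isSimple {X : Matrix (Fin n) (Fin p) ℝ} (hrX : r ≤ X.rank) (hrq : r ≤ q)
    (h : ∀ Y, IsThinSVD (hatMatrix X * Y) (W Y) (d Y) (V Y)) :
    ∀ᵐ y : Fin n × Fin q → ℝ, IsSimple (d (toMat y)) := by
  obtain ⟨H, lam, V', hH, hlam⟩ := exists_isSpectral_isSimple X hrX hrq
  have hH0 := hH.momentDet_ne_zero_iff.2 hlam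
  have hB : IsClosed {y : Fin n × Fin q → ℝ | momentDet r (gram (hatMatrix X) (toMat y)) = 0} :=
    isClosed_eq ((continuous_momentDet r).comp ((continuous_gram _).comp continuous_toMat))
      continuous_const
  have h0 := volume_eq_zero_of_lines hB.measurableSet (fun a => H a.1 a.2) fun y => by
    have hf := finite_momentDet_eq_zero (hatMatrix X) (toMat y) H hH0
    filter_upwards [compl_mem_ae_iff.2 (hf.measure_zero _)] with t ht
    exact ht
  filter_upwards [compl_mem_ae_iff.2 h0] with y hy
  exact isSimple_of_sq (h _).nonneg ((h _).isSpectral.momentDet_ne_zero_iff.1 hy)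

/-- A weight is differentiable at the positive singular values of almost every response: a ray from the
origin passes through the exceptional values of the singular value in a null set of times. -/
lemma ae_differentiableAt_weight (h : ∀ Y, IsThinSVD (P * Y) (W Y) (d Y) (V Y)) {f : ℝ → ℝ}
    (hf : LocallyLipschitzOn (Set.Ioi 0) f) (k : Fin r) :
    ∀ᵐ y : Fin n × Fin q → ℝ, 0 < d (toMat y) k → DifferentiableAt ℝ f (d (toMat y) k) := by
  have hc : Continuous fun y : Fin n × Fin q → ℝ => d (toMat y) k :=
    (continuous_singularValue h k).comp continuous_toMat
  have hN : MeasurableSet {x : ℝ | 0 < x ∧ ¬ DifferentiableAt ℝ f x} :=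
    measurableSet_Ioi.inter (measurableSet_of_differentiableAt ℝ f).compl
  have hN0 : volume {x : ℝ | 0 < x ∧ ¬ DifferentiableAt ℝ f x} = 0 := by
    have := ae_iff.1 (ae_differentiableAt_of_locallyLipschitzOn hf)
    simpa using this
  -- the singular values are homogeneous along lines through the origin
  have h0 := volume_eq_zero_of_lines (hc.measurable hN) 0 fun y => by
    rcases ((h (toMat y)).nonneg k).eq_or_lt with hd | hd
    · refine Eventually.of_forall fun t ht => ?_
      have hd' : d (toMat (t • y)) k = 0 := by
        have := singularValue_smul h t (toMat y) k
        rw [← hd, mul_zero] at this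
        exact this
      simp [hd'] at ht
    · have hpre : volume ((· * d (toMat y) k) ⁻¹' {x : ℝ | 0 < x ∧ ¬ DifferentiableAt ℝ f x}) = 0 := by
        rw [Real.volume_preimage_mul_right hd.ne', hN0, mul_zero]
      have hneg : volume (Neg.neg ⁻¹' ((· * d (toMat y) k) ⁻¹'
          {x : ℝ | 0 < x ∧ ¬ DifferentiableAt ℝ f x})) = 0 := by
        rw [Measure.measure_preimage_neg, hpre]
      filter_upwards [compl_mem_ae_iff.2 hpre, compl_mem_ae_iff.2 hneg] with t h1 h2 ht
      have hd' : d (toMat (t • y)) k = |t| * d (toMat y) k := singularValue_smul h t (toMat y) k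
      simp only [smul_zero, add_zero, Set.mem_preimage, hd'] at ht
      rcases abs_choice t with ht' | ht'
      · rw [ht'] at ht
        exact h1 ht
      · rw [ht'] at ht
        exact h2 ht
  filter_upwards [compl_mem_ae_iff.2 h0] with y hy hpos
  by_contra hnd
  exact hy ⟨hpos, hnd⟩

end Null

/-! ### Lipschitz functions and Stein's identity -/

section LipAt

open Asymptotics

variable {E F : Type*} [NormedAddCommGroup E] [NormedAddCommGroup F]

/-- `f` is Lipschitz in a neighbourhood of `x`, stated as an asymptotic bound on the increments
between pairs of points near `x`. -/
def LipAt (f : E → F) (x : E) : Prop :=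
  (fun p : E × E => f p.1 - f p.2) =O[𝓝 (x, x)] fun p => p.1 - p.2

lemma lipAt_iff {f : E → F} {x : E} :
    LipAt f x ↔ ∃ K : ℝ≥0, ∃ t ∈ 𝓝 x, LipschitzOnWith K f t := by
  rw [LipAt, isBigO_iff']
  constructor
  · rintro ⟨c, hc, h⟩
    rw [nhds_prod_eq, eventually_prod_self_iff'] at h
    obtain ⟨t, ht, hb⟩ := h
    refine ⟨⟨c, hc.le⟩, t, ht, LipschitzOnWith.of_dist_le_mul fun y hy z hz => ?_⟩
    rw [dist_eq_norm, dist_eq_norm]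
    exact hb y hy z hz
  · rintro ⟨K, t, ht, h⟩
    refine ⟨K + 1, by positivity, ?_⟩
    filter_upwards [prod_mem_nhds ht ht] with p hp
    rw [← dist_eq_norm, ← dist_eq_norm]
    refine (h.dist_le_mul _ hp.1 _ hp.2).trans ?_
    exact mul_le_mul_of_nonneg_right (by linarith) dist_nonneg

lemma locallyLipschitz_of_lipAt {f : E → F} (h : ∀ x, LipAt f x) : LocallyLipschitz f :=
  fun x => lipAt_iff.1 (h x)

lemma _root_.LocallyLipschitzOn.lipAt {f : E → F} {s : Set E} (h : LocallyLipschitzOn s f)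
    (hs : IsOpen s) {x : E} (hx : x ∈ s) : LipAt f x := by
  obtain ⟨K, t, ht, hK⟩ := h hx
  rw [hs.nhdsWithin_eq hx] at ht
  exact lipAt_iff.2 ⟨K, t, ht, hK⟩

lemma LipAt.continuousAt {f : E → F} {x : E} (h : LipAt f x) : ContinuousAt f x := by
  obtain ⟨K, t, ht, hK⟩ := lipAt_iff.1 h
  exact hK.continuousOn.continuousAt ht

lemma lipAt_const (c : F) (x : E) : LipAt (fun _ => c) x := by
  simp only [LipAt, sub_self]
  exact isBigO_zero _ _

lemma LipAt.comp {G : Type*} [NormedAddCommGroup G] {f : E → F} {g : F → G} {x : E}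
    (hg : LipAt g (f x)) (hf : LipAt f x) : LipAt (fun y => g (f y)) x := by
  have ht : Tendsto (fun p : E × E => (f p.1, f p.2)) (𝓝 (x, x)) (𝓝 (f x, f x)) :=
    (hf.continuousAt.tendsto.comp (continuous_fst.tendsto (x, x))).prodMk_nhds
      (hf.continuousAt.tendsto.comp (continuous_snd.tendsto (x, x)))
  exact (hg.comp_tendsto ht).trans hf

lemma LipAt.congr {f g : E → F} {x : E} (hf : LipAt f x) (h : f =ᶠ[𝓝 x] g) : LipAt g x := by
  refine IsBigO.congr' hf ?_ EventuallyEq.rfl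
  have h1 := (continuous_fst.tendsto (x, x)).eventually h
  have h2 := (continuous_snd.tendsto (x, x)).eventually h
  filter_upwards [h1, h2] with p hp1 hp2
  rw [hp1, hp2]

lemma LipAt.add {f g : E → F} {x : E} (hf : LipAt f x) (hg : LipAt g x) :
    LipAt (fun y => f y + g y) x :=
  (IsBigO.add hf hg).congr_left fun p => add_sub_add_comm (f p.1) (g p.1) (f p.2) (g p.2) ▸ rfl

lemma LipAt.neg {f : E → F} {x : E} (hf : LipAt f x) : LipAt (fun y => - f y) x :=
  (IsBigO.neg_left hf).congr_left fun p => by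
    rw [neg_sub, neg_sub_neg]

lemma LipAt.sub {f g : E → F} {x : E} (hf : LipAt f x) (hg : LipAt g x) :
    LipAt (fun y => f y - g y) x := by
  simpa only [sub_eq_add_neg] using hf.add hg.neg

lemma LipAt.mul {f g : E → ℝ} {x : E} (hf : LipAt f x) (hg : LipAt g x) :
    LipAt (fun y => f y * g y) x := by
  have h1 : (fun p : E × E => g p.1) =O[𝓝 (x, x)] fun _ => (1 : ℝ) :=
    (hg.continuousAt.tendsto.comp (continuous_fst.tendsto (x, x))).isBigO_one ℝ
  have h2 : (fun p : E × E => f p.2) =O[𝓝 (x, x)] fun _ => (1 : ℝ) :=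
    (hf.continuousAt.tendsto.comp (continuous_snd.tendsto (x, x))).isBigO_one ℝ
  have h3 : (fun p : E × E => (f p.1 - f p.2) * g p.1) =O[𝓝 (x, x)] fun p => p.1 - p.2 := by
    simpa using IsBigO.mul (IsBigO.norm_right hf) h1
  have h4 : (fun p : E × E => f p.2 * (g p.1 - g p.2)) =O[𝓝 (x, x)] fun p => p.1 - p.2 := by
    simpa using IsBigO.mul h2 (IsBigO.norm_right hg)
  exact (h3.add h4).congr_left fun p => by ring

lemma LipAt.sum {ι : Type*} {s : Finset ι} {f : ι → E → F} {x : E}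
    (hf : ∀ i ∈ s, LipAt (f i) x) : LipAt (fun y => ∑ i ∈ s, f i y) x :=
  (IsBigO.sum (A := fun i p => f i p.1 - f i p.2) hf).congr_left fun p => by
    simp only [Finset.sum_apply, Finset.sum_sub_distrib]

lemma LipAt.prod {ι : Type*} {s : Finset ι} {f : ι → E → ℝ} {x : E}
    (hf : ∀ i ∈ s, LipAt (f i) x) : LipAt (fun y => ∏ i ∈ s, f i y) x := by
  classical
  induction s using Finset.induction_on with
  | empty => simpa using lipAt_const (1 : ℝ) x
  | insert i s hi ih =>
    simp only [Finset.prod_insert hi]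
    exact (hf i (Finset.mem_insert_self i s)).mul
      (ih fun j hj => hf j (Finset.mem_insert_of_mem hj))

lemma _root_.ContDiffAt.lipAt [NormedSpace ℝ E] [NormedSpace ℝ F] {f : E → F} {x : E}
    (h : ContDiffAt ℝ 1 f x) : LipAt f x :=
  (h.hasStrictFDerivAt one_ne_zero).isBigO_sub

lemma LipAt.div {f g : E → ℝ} {x : E} (hf : LipAt f x) (hg : LipAt g x) (h : g x ≠ 0) :
    LipAt (fun y => f y / g y) x := by
  simp only [div_eq_mul_inv]
  exact hf.mul (LipAt.comp (contDiffAt_inv ℝ h).lipAt hg)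

/-- A locally Lipschitz function with compact support is Lipschitz. -/
lemma exists_lipschitzWith [ProperSpace E] {f : E → ℝ} (hf : LocallyLipschitz f)
    (hc : HasCompactSupport f) : ∃ K, LipschitzWith K f := by
  have hC : IsCompact (Metric.cthickening 1 (tsupport f)) := IsCompact.cthickening hc
  obtain ⟨K, hK⟩ := (hf.locallyLipschitzOn (s := Metric.cthickening 1 (tsupport f))
    ).exists_lipschitzOnWith_of_compact hC
  obtain ⟨M, hM⟩ := hc.exists_bound_of_continuous hf.continuous
  have hM0 : 0 ≤ M := (norm_nonneg _).trans (hM 0)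
  -- pairs with one point outside the thickened support
  have key : ∀ x y, y ∉ Metric.cthickening 1 (tsupport f) → dist (f x) (f y) ≤ M * dist x y := by
    intro x y hy
    have hy0 : f y = 0 := image_eq_zero_of_notMem_tsupport fun h =>
      hy (Metric.self_subset_cthickening _ h)
    by_cases hx : x ∈ tsupport f
    · have hd : 1 ≤ dist x y := by
        by_contra hlt
        refine hy (Metric.mem_cthickening_of_dist_le y x 1 _ hx ?_)
        rw [dist_comm]
        exact (not_le.1 hlt).le
      rw [hy0, dist_zero_right]
      exact (hM x).trans (le_mul_of_one_le_right hM0 hd)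
    · rw [hy0, image_eq_zero_of_notMem_tsupport hx, dist_self]
      positivity
  refine ⟨max K ⟨M, hM0⟩, LipschitzWith.of_dist_le_mul fun x y => ?_⟩
  have hm1 : (K : ℝ) ≤ (max K ⟨M, hM0⟩ : ℝ≥0) := by exact_mod_cast le_max_left _ _
  have hm2 : M ≤ (max K ⟨M, hM0⟩ : ℝ≥0) := by
    have : (⟨M, hM0⟩ : ℝ≥0) ≤ max K ⟨M, hM0⟩ := le_max_right _ _
    exact_mod_cast this
  by_cases hx : x ∈ Metric.cthickening 1 (tsupport f)
  · by_cases hy : y ∈ Metric.cthickening 1 (tsupport f)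
    · exact (hK.dist_le_mul _ hx _ hy).trans (mul_le_mul_of_nonneg_right hm1 dist_nonneg)
    · exact (key x y hy).trans (mul_le_mul_of_nonneg_right hm2 dist_nonneg)
  · rw [dist_comm, dist_comm x]
    exact (key y x hx).trans (mul_le_mul_of_nonneg_right hm2 dist_nonneg)

end LipAt

section Stein

variable {ι : Type*} [Fintype ι]

/-- The density of independent Gaussian variables with means `m` and common variance `v`. -/
noncomputable def gaussDensity (m : ι → ℝ) (v : ℝ≥0) (y : ι → ℝ) : ℝ :=
  ∏ a, gaussianPDFReal (m a) v (y a)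

lemma gaussDensity_nonneg (m : ι → ℝ) (v : ℝ≥0) (y : ι → ℝ) : 0 ≤ gaussDensity m v y :=
  Finset.prod_nonneg fun _ _ => gaussianPDFReal_nonneg _ _ _

lemma contDiff_gaussDensity (m : ι → ℝ) (v : ℝ≥0) : ContDiff ℝ 1 (gaussDensity m v) := by
  unfold gaussDensity gaussianPDFReal
  fun_prop

lemma hasLineDerivAt_gaussDensity [DecidableEq ι] (m : ι → ℝ) {v : ℝ≥0} (y : ι → ℝ)
    (a : ι) :
    HasLineDerivAt ℝ (gaussDensity m v) (-(((y a - m a) / v) * gaussDensity m v y)) y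
      (Pi.single a 1) := by
  have hrepr : ∀ z, gaussDensity m v z =
      (√(2 * Real.pi * v))⁻¹ ^ Fintype.card ι * Real.exp (∑ b, -(z b - m b) ^ 2 / (2 * v)) := by
    intro z
    simp only [gaussDensity, gaussianPDFReal]
    rw [Finset.prod_mul_distrib, Finset.prod_const, Finset.card_univ, Real.exp_sum]
  have h1 : ∀ b, HasDerivAt (fun t : ℝ => -((y + t • (Pi.single a 1 : ι → ℝ)) b - m b) ^ 2 /
      (2 * v)) (if b = a then -((y a - m a) / v) else 0) 0 := by
    intro b
    by_cases hb : b = a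
    · subst hb
      simp only [Pi.add_apply, Pi.smul_apply, Pi.single_eq_same, smul_eq_mul, mul_one, if_true]
      have h2 : HasDerivAt (fun t : ℝ => y b + t - m b) 1 0 :=
        ((hasDerivAt_id (0 : ℝ)).const_add (y b)).sub_const (m b)
      have h3 := ((h2.pow 2).neg).div_const (2 * (v : ℝ))
      refine h3.congr_deriv ?_
      rw [add_zero, pow_one, mul_one, neg_div, Nat.cast_ofNat, mul_div_mul_left _ _ two_ne_zero]
    · simpa [hb] using hasDerivAt_const (0 : ℝ) (-(y b - m b) ^ 2 / (2 * v : ℝ))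
  have h2 := (HasDerivAt.fun_sum fun b (_ : b ∈ Finset.univ) => h1 b).exp.const_mul
    ((√(2 * Real.pi * v))⁻¹ ^ Fintype.card ι)
  simp only [zero_smul, add_zero, Finset.sum_ite_eq', Finset.mem_univ, if_true] at h2
  rw [HasLineDerivAt]
  simp only [hrepr]
  refine h2.congr_deriv ?_
  ring

lemma pi_gaussianReal_eq (m : ι → ℝ) {v : ℝ≥0} (hv : v ≠ 0) :
    Measure.pi (fun a => gaussianReal (m a) v) =
      volume.withDensity fun y => ENNReal.ofReal (gaussDensity m v y) := by
  classical
  refine Measure.pi_eq fun s hs => ?_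
  have hind : ∀ y, (Set.univ.pi s).indicator (gaussDensity m v) y =
      ∏ a, (s a).indicator (gaussianPDFReal (m a) v) (y a) := by
    intro y
    by_cases hy : y ∈ Set.univ.pi s
    · rw [Set.indicator_of_mem hy, gaussDensity]
      exact Finset.prod_congr rfl fun a _ => (Set.indicator_of_mem (hy a trivial) _).symm
    · rw [Set.indicator_of_notMem hy]
      obtain ⟨a, ha⟩ : ∃ a, y a ∉ s a := by simpa [Set.mem_pi] using hy
      exact (Finset.prod_eq_zero (Finset.mem_univ a) (Set.indicator_of_notMem ha _)).symm
  have hint : Integrable (fun y : ι → ℝ => ∏ a, (s a).indicator (gaussianPDFReal (m a) v) (y a)) :=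
    Integrable.fintype_prod fun a => (integrable_gaussianPDFReal (m a) v).indicator (hs a)
  rw [withDensity_apply _ (MeasurableSet.univ_pi hs),
    ← lintegral_indicator (MeasurableSet.univ_pi hs)]
  have h1 : ∀ y, (Set.univ.pi s).indicator (fun y => ENNReal.ofReal (gaussDensity m v y)) y =
      ENNReal.ofReal (∏ a, (s a).indicator (gaussianPDFReal (m a) v) (y a)) := by
    intro y
    rw [← hind]
    by_cases hy : y ∈ Set.univ.pi s
    · rw [Set.indicator_of_mem hy, Set.indicator_of_mem hy]
    · rw [Set.indicator_of_notMem hy, Set.indicator_of_notMem hy, ENNReal.ofReal_zero]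
  have h0 : ∀ a x, 0 ≤ (s a).indicator (gaussianPDFReal (m a) v) x := fun a x =>
    Set.indicator_nonneg (fun x _ => gaussianPDFReal_nonneg _ _ _) x
  rw [lintegral_congr h1, ← ofReal_integral_eq_lintegral_ofReal hint
    (Eventually.of_forall fun y => Finset.prod_nonneg fun a _ => h0 a (y a)),
    integral_fintype_prod_volume_eq_prod,
    ENNReal.ofReal_prod_of_nonneg fun a _ => integral_nonneg (h0 a)]
  refine Finset.prod_congr rfl fun a _ => ?_
  rw [gaussianReal_apply_eq_integral _ hv, integral_indicator (hs a)]

/-- The law of independent Gaussian variables with means `m` and common variance `v`. -/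
noncomputable abbrev gaussLaw (m : ι → ℝ) (v : ℝ≥0) : Measure (ι → ℝ) :=
  Measure.pi fun a => gaussianReal (m a) v

lemma gaussLaw_absolutelyContinuous (m : ι → ℝ) {v : ℝ≥0} (hv : v ≠ 0) :
    gaussLaw m v ≪ volume := by
  rw [gaussLaw, pi_gaussianReal_eq m hv]
  exact withDensity_absolutelyContinuous _ _

/-- The integral of a line derivative of a compactly supported Lipschitz function vanishes. -/
lemma integral_lineDeriv_eq_zero {g : (ι → ℝ) → ℝ} {K : ℝ≥0} (hg : LipschitzWith K g)
    (hc : HasCompactSupport g) (e : ι → ℝ) : ∫ y, lineDeriv ℝ g y e = 0 := by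
  have h := LipschitzWith.integral_lineDeriv_mul_eq (μ := (volume : Measure (ι → ℝ)))
    (LipschitzWith.const (1 : ℝ) (α := ι → ℝ)) hg hc (-e)
  have hcst : ∀ y, lineDeriv ℝ (fun _ : ι → ℝ => (1 : ℝ)) y (-e) = 0 := fun y => by
    simp [lineDeriv]
  simp only [neg_neg, mul_one, hcst, zero_mul, integral_zero] at h
  exact h.symm

lemma integrable_lineDeriv {f : (ι → ℝ) → ℝ} (hf : LocallyLipschitz f)
    (hc : HasCompactSupport f) (e : ι → ℝ) (μ : Measure (ι → ℝ)) [IsFiniteMeasure μ] :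
    Integrable (fun y => lineDeriv ℝ f y e) μ := by
  obtain ⟨K, hK⟩ := exists_lipschitzWith hf hc
  exact Integrable.of_bound (aestronglyMeasurable_lineDeriv hK.continuous μ) (K * ‖e‖)
    (Eventually.of_forall fun y => norm_lineDeriv_le_of_lipschitz ℝ hK)

lemma integrable_coord_mul {f : (ι → ℝ) → ℝ} (hf : Continuous f) (hc : HasCompactSupport f)
    (a : ι) (c : ℝ) (μ : Measure (ι → ℝ)) [IsFiniteMeasure μ] :
    Integrable (fun y => (y a - c) * f y) μ := by
  have h1 : Continuous fun y : ι → ℝ => (y a - c) * f y := by fun_prop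
  exact h1.integrable_of_hasCompactSupport hc.mul_left

/-- Stein's identity for locally Lipschitz functions with compact support. -/
lemma stein_identity [DecidableEq ι] (m : ι → ℝ) {v : ℝ≥0} (hv : v ≠ 0) {f : (ι → ℝ) → ℝ}
    (hf : LocallyLipschitz f) (hc : HasCompactSupport f) (a : ι) :
    ∫ y, lineDeriv ℝ f y (Pi.single a 1) ∂gaussLaw m v =
      (v : ℝ)⁻¹ * ∫ y, (y a - m a) * f y ∂gaussLaw m v := by
  set ρ := gaussDensity m v with hρ
  have hρc : Continuous ρ := (contDiff_gaussDensity m v).continuous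
  have hρm : Measurable fun y => ENNReal.ofReal (ρ y) := hρc.measurable.ennreal_ofReal
  have hint : ∀ g : (ι → ℝ) → ℝ, ∫ y, g y ∂gaussLaw m v = ∫ y, ρ y * g y := by
    intro g
    rw [gaussLaw, pi_gaussianReal_eq m hv, integral_withDensity_eq_integral_toReal_smul hρm
      (Eventually.of_forall fun _ => ENNReal.ofReal_lt_top)]
    refine integral_congr_ae (Eventually.of_forall fun y => ?_)
    simp only [ENNReal.toReal_ofReal (gaussDensity_nonneg m v y), smul_eq_mul, hρ]
  have hinte : ∀ g : (ι → ℝ) → ℝ, Integrable g (gaussLaw m v) →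
      Integrable fun y => ρ y * g y := by
    intro g hg
    rw [gaussLaw, pi_gaussianReal_eq m hv, integrable_withDensity_iff_integrable_smul' hρm
      (Eventually.of_forall fun _ => ENNReal.ofReal_lt_top)] at hg
    refine hg.congr (Eventually.of_forall fun y => ?_)
    simp only [ENNReal.toReal_ofReal (gaussDensity_nonneg m v y), smul_eq_mul, hρ]
  obtain ⟨K, hK⟩ := exists_lipschitzWith hf hc
  have hg : LocallyLipschitz fun y => ρ y * f y := locallyLipschitz_of_lipAt fun y =>
    LipAt.mul (contDiff_gaussDensity m v).contDiffAt.lipAt (lipAt_iff.2 (hf y))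
  have hgc : HasCompactSupport fun y => ρ y * f y := hc.mul_left
  obtain ⟨K', hK'⟩ := exists_lipschitzWith hg hgc
  have h0 := integral_lineDeriv_eq_zero hK' hgc (Pi.single a 1)
  have hae : ∀ᵐ y, lineDeriv ℝ (fun y => ρ y * f y) y (Pi.single a 1) =
      ρ y * lineDeriv ℝ f y (Pi.single a 1) - (v : ℝ)⁻¹ * (ρ y * ((y a - m a) * f y)) := by
    filter_upwards [hK.ae_lineDifferentiableAt (μ := volume) (Pi.single a 1)] with y hy
    have h1 := hasLineDerivAt_gaussDensity m (v := v) y a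
    have h2 := HasDerivAt.fun_mul h1 hy.hasLineDerivAt
    have h3 : HasLineDerivAt ℝ (fun y => ρ y * f y) _ y (Pi.single a 1) := h2
    rw [h3.lineDeriv]
    simp only [zero_smul, add_zero, ← hρ]
    field_simp
    ring
  rw [integral_congr_ae hae, integral_sub, integral_const_mul, sub_eq_zero] at h0
  · rw [hint, hint, h0]
  · exact hinte _ (integrable_lineDeriv hf hc _ _)
  · exact (hinte _ (integrable_coord_mul hf.continuous hc a (m a) _)).const_mul _

end Stein

/-! ### Local Lipschitz bounds, the discriminant and smooth cutoffs -/

section Lipschitz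

open Asymptotics

variable {E : Type*} [NormedAddCommGroup E] {q r : ℕ} {S : E → Matrix (Fin q) (Fin q) ℝ}
  {lam : E → Fin r → ℝ} {V : E → Matrix (Fin q) (Fin r) ℝ} {x : E}

lemma isBigO_entrySum (hS : ∀ a b, LipAt (fun y => S y a b) x) :
    (fun p : E × E => entrySum (S p.1 - S p.2)) =O[𝓝 (x, x)] fun p => p.1 - p.2 := by
  have h := IsBigO.sum (s := Finset.univ) (A := fun a (p : E × E) => ∑ b, |S p.1 a b - S p.2 a b|)
    (l := 𝓝 (x, x)) (g := fun p => p.1 - p.2) fun a _ => by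
      have h' := IsBigO.sum (s := Finset.univ) (A := fun b (p : E × E) => |S p.1 a b - S p.2 a b|)
        (l := 𝓝 (x, x)) (g := fun p => p.1 - p.2) fun b _ => (hS a b).abs_left
      exact h'.congr_left fun p => by simp
  exact h.congr_left fun p => by simp [entrySum]

lemma lipAt_eigenvalue (h : ∀ t, IsSpectral (S t) (lam t) (V t))
    (hS : ∀ a b, LipAt (fun y => S y a b) x) (k : Fin r) : LipAt (fun y => lam y k) x := by
  refine IsBigO.trans (isBigO_of_le _ fun p => ?_) (isBigO_entrySum hS)
  rw [Real.norm_of_nonneg (entrySum_nonneg _)]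
  exact abs_eigenvalue_sub_le (h p.1) (h p.2) k

/-- Spectral functions with locally Lipschitz values are locally Lipschitz where the eigenvalues are
simple. -/
lemma lipAt_conj_diagonal (h : ∀ t, IsSpectral (S t) (lam t) (V t))
    (hS : ∀ a b, LipAt (fun y => S y a b) x) (h0 : IsSimple (lam x)) {w : E → Fin r → ℝ}
    (hw : ∀ k, LipAt (fun y => w y k) x) (i j : Fin q) :
    LipAt (fun y => (V y * diagonal (w y) * (V y)ᵀ) i j) x := by
  have hlam : ContinuousAt lam x :=
    tendsto_pi_nhds.2 fun k => (lipAt_eigenvalue h hS k).continuousAt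
  have hwc : ContinuousAt w x := tendsto_pi_nhds.2 fun k => (hw k).continuousAt
  have hfst : ∀ {f : E → ℝ}, ContinuousAt f x →
      Tendsto (fun p : E × E => f p.1) (𝓝 (x, x)) (𝓝 (f x)) := fun hf =>
    hf.tendsto.comp (continuous_fst.tendsto (x, x))
  have hsnd : ∀ {f : E → ℝ}, ContinuousAt f x →
      Tendsto (fun p : E × E => f p.2) (𝓝 (x, x)) (𝓝 (f x)) := fun hf =>
    hf.tendsto.comp (continuous_snd.tendsto (x, x))
  have hcoef : (fun p : E × E => ∑ l, ∑ m, if l = m then 0 else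
      |(ext0 (w p.2) m - ext0 (w p.1) l) / (ext0 (lam p.2) m - ext0 (lam p.1) l)|)
      =O[𝓝 (x, x)] fun _ => (1 : ℝ) := by
    refine Tendsto.isBigO_one ℝ (c := ∑ l, ∑ m, if l = m then 0 else
      |(ext0 (w x) m - ext0 (w x) l) / (ext0 (lam x) m - ext0 (lam x) l)|) ?_
    refine tendsto_finsetSum _ fun l _ => tendsto_finsetSum _ fun m _ => ?_
    by_cases hlm : l = m
    · simp [hlm]
    · simp only [if_neg hlm]
      exact Tendsto.abs (Tendsto.div
        ((hsnd (continuousAt_ext0 hwc m)).sub (hfst (continuousAt_ext0 hwc l)))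
        ((hsnd (continuousAt_ext0 hlam m)).sub (hfst (continuousAt_ext0 hlam l)))
        (sub_ne_zero.2 fun h => hlm (ext0_injective h0 h).symm))
  have hw' : (fun p : E × E => (q : ℝ) * ∑ k, |w p.2 k - w p.1 k|) =O[𝓝 (x, x)]
      fun p => p.1 - p.2 := by
    refine IsBigO.const_mul_left ?_ _
    have h' := IsBigO.sum (s := Finset.univ) (A := fun k (p : E × E) => |w p.1 k - w p.2 k|)
      (l := 𝓝 (x, x)) (g := fun p => p.1 - p.2) fun k _ => (hw k).abs_left
    exact h'.congr_left fun p => by simp [abs_sub_comm]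
  have hS' : (fun p : E × E => entrySum (S p.2 - S p.1)) =O[𝓝 (x, x)] fun p => p.1 - p.2 :=
    (isBigO_entrySum hS).congr_left fun p => by simp [entrySum, abs_sub_comm]
  have hb := hw'.add ((hcoef.mul (IsBigO.norm_right hS')).congr_right
    (g₂ := fun p : E × E => ‖p.1 - p.2‖) fun p => one_mul _).of_norm_right
  refine IsBigO.trans (IsBigO.of_bound 1 ?_) hb
  filter_upwards [eventually_ext0_ne hlam h0] with p hp
  have := abs_conj_diagonal_sub_le (h p.1) (h p.2) hp (w p.1) (w p.2) i j
  rw [one_mul, norm_sub_rev]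
  exact this.trans (le_abs_self _)

end Lipschitz

section Discriminant

variable {r : ℕ}

/-- The product of the values and of their pairwise differences. -/
def discr (lam : Fin r → ℝ) : ℝ := (∏ k, lam k) * ∏ k, ∏ l ∈ Finset.Ioi k, (lam k - lam l)

lemma discr_nonneg {lam : Fin r → ℝ} (h : Antitone lam) (h0 : ∀ k, 0 ≤ lam k) : 0 ≤ discr lam :=
  mul_nonneg (Finset.prod_nonneg fun k _ => h0 k) (Finset.prod_nonneg fun _ _ =>
    Finset.prod_nonneg fun _ hl => sub_nonneg.2 (h (Finset.mem_Ioi.1 hl).le))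

lemma IsSimple.discr_pos {lam : Fin r → ℝ} (h : IsSimple lam) : 0 < discr lam :=
  mul_pos (Finset.prod_pos fun k _ => h.2 k) (Finset.prod_pos fun _ _ =>
    Finset.prod_pos fun _ hl => sub_pos.2 (h.1 (Finset.mem_Ioi.1 hl)))

lemma isSimple_of_discr_ne_zero {lam : Fin r → ℝ} (h : Antitone lam) (h0 : ∀ k, 0 ≤ lam k)
    (hd : discr lam ≠ 0) : IsSimple lam := by
  obtain ⟨h1, h2⟩ := mul_ne_zero_iff.1 hd
  refine ⟨fun k l hkl => (h hkl.le).lt_of_ne fun heq => ?_,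
    fun k => (h0 k).lt_of_ne (Finset.prod_ne_zero_iff.1 h1 k (Finset.mem_univ _)).symm⟩
  exact Finset.prod_ne_zero_iff.1 (Finset.prod_ne_zero_iff.1 h2 k (Finset.mem_univ _)) l
    (Finset.mem_Ioi.2 hkl) (sub_eq_zero.2 heq.symm)

lemma hasDerivAt_discr {lam : ℝ → Fin r → ℝ} {dlam : Fin r → ℝ} {t : ℝ}
    (h : ∀ k, HasDerivAt (fun u => lam u k) (dlam k) t) (h0 : IsSimple (lam t)) :
    HasDerivAt (fun u => discr (lam u)) (discr (lam t) * (∑ k, dlam k / lam t k +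
      ∑ k, ∑ l ∈ Finset.Ioi k, (dlam k - dlam l) / (lam t k - lam t l))) t := by
  have hd1 : ∀ k ∈ Finset.univ, DifferentiableAt ℝ (fun u => lam u k) t := fun k _ =>
    (h k).differentiableAt
  have hd2 : ∀ k, ∀ l ∈ Finset.Ioi k, DifferentiableAt ℝ (fun u => lam u k - lam u l) t :=
    fun k l _ => ((h k).sub (h l)).differentiableAt
  have hd3 : ∀ k ∈ Finset.univ,
      DifferentiableAt ℝ (fun u => ∏ l ∈ Finset.Ioi k, (lam u k - lam u l)) t := fun k _ =>
    DifferentiableAt.fun_finsetProd (hd2 k)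
  have hne1 : ∀ k ∈ Finset.univ, lam t k ≠ 0 := fun k _ => (h0.2 k).ne'
  have hne2 : ∀ k, ∀ l ∈ Finset.Ioi k, lam t k - lam t l ≠ 0 := fun k l hl =>
    (sub_pos.2 (h0.1 (Finset.mem_Ioi.1 hl))).ne'
  have hdiff : DifferentiableAt ℝ (fun u => discr (lam u)) t :=
    (DifferentiableAt.fun_finsetProd hd1).mul (DifferentiableAt.fun_finsetProd hd3)
  have hlog : logDeriv (fun u => discr (lam u)) t = ∑ k, dlam k / lam t k +
      ∑ k, ∑ l ∈ Finset.Ioi k, (dlam k - dlam l) / (lam t k - lam t l) := by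
    unfold discr
    rw [logDeriv_mul t (Finset.prod_ne_zero_iff.2 hne1)
      (Finset.prod_ne_zero_iff.2 fun k _ => Finset.prod_ne_zero_iff.2 (hne2 k))
      (DifferentiableAt.fun_finsetProd hd1) (DifferentiableAt.fun_finsetProd hd3),
      logDeriv_prod hne1 hd1,
      logDeriv_prod (fun k _ => Finset.prod_ne_zero_iff.2 (hne2 k)) hd3]
    congr 1
    · exact Finset.sum_congr rfl fun k _ => by rw [logDeriv_apply, (h k).deriv]
    · refine Finset.sum_congr rfl fun k _ => ?_
      rw [logDeriv_prod (hne2 k) (hd2 k)]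
      exact Finset.sum_congr rfl fun l _ => by rw [logDeriv_apply, ((h k).fun_sub (h l)).deriv]
  rw [← hlog, logDeriv_apply, mul_div_cancel₀ _ h0.discr_pos.ne']
  exact hdiff.hasDerivAt

/-- The logarithmic derivative of the discriminant in the direction of the estimator is, up to a
multiple of the sum of the weights, the divergence without the derivatives of the weights. -/
lemma sum_logDeriv_discr (rx q : ℕ) {d a : Fin r → ℝ} (h0 : IsSimple d) :
    ∑ k, 2 * (d k ^ 2 * a k) / d k ^ 2 + ∑ k, ∑ l ∈ Finset.Ioi k,
        (2 * (d k ^ 2 * a k) - 2 * (d l ^ 2 * a l)) / (d k ^ 2 - d l ^ 2) =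
      baseDf rx q d a + ((r : ℝ) + 1 - (max rx q : ℕ)) * ∑ k, a k := by
  have h1 : ∑ k, 2 * (d k ^ 2 * a k) / d k ^ 2 = 2 * ∑ k, a k := by
    rw [Finset.mul_sum]
    refine Finset.sum_congr rfl fun k _ => ?_
    have := (h0.2 k).ne'
    field_simp
  have hne : ∀ k l, k ≠ l → d k ^ 2 - d l ^ 2 ≠ 0 := fun k l hkl =>
    sub_ne_zero.2 fun h => hkl ((isSimple_sq h0).1.injective h)
  have h2 : ∑ k, ∑ l ∈ Finset.Ioi k,
      (2 * (d k ^ 2 * a k) - 2 * (d l ^ 2 * a l)) / (d k ^ 2 - d l ^ 2) =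
      ∑ k, ∑ l ∈ Finset.Ioi k, ((d l ^ 2 * (a l - a k) / (d l ^ 2 - d k ^ 2) + a k) +
        (d k ^ 2 * (a k - a l) / (d k ^ 2 - d l ^ 2) + a l)) := by
    refine Finset.sum_congr rfl fun k _ => Finset.sum_congr rfl fun l hl => ?_
    have hkl := (Finset.mem_Ioi.1 hl).ne
    have e1 := hne k l hkl
    have e2 := hne l k hkl.symm
    have e3 : d l ^ 2 * (a l - a k) / (d l ^ 2 - d k ^ 2) =
        d l ^ 2 * (a k - a l) / (d k ^ 2 - d l ^ 2) := by
      rw [div_eq_div_iff e2 e1]; ring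
    rw [e3]
    field_simp
    ring
  rw [h1, h2, Finset.sum_sum_Ioi_add_eq_sum_sum_off_diag
    (fun l k => d l ^ 2 * (a l - a k) / (d l ^ 2 - d k ^ 2) + a k), baseDf]
  have h3 : ∀ k, ∑ l ∈ {k}ᶜ, (d l ^ 2 * (a l - a k) / (d l ^ 2 - d k ^ 2) + a k) =
      ∑ l, d l ^ 2 * (a l - a k) / (d l ^ 2 - d k ^ 2) + ((r : ℝ) - 1) * a k := by
    intro k
    have h4 := Finset.sum_compl_add_sum {k}
      (fun l => d l ^ 2 * (a l - a k) / (d l ^ 2 - d k ^ 2) + a k)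
    rw [Finset.sum_singleton, Finset.sum_add_distrib (s := Finset.univ)] at h4
    simp only [sub_self, mul_zero, zero_div, zero_add, Finset.sum_const, Finset.card_univ,
      Fintype.card_fin, nsmul_eq_mul] at h4
    linarith
  simp only [h3, Finset.sum_add_distrib, ← Finset.mul_sum]
  rw [Finset.sum_comm]
  ring

end Discriminant

section Cutoff

lemma deriv_smoothTransition_nonneg (x : ℝ) : 0 ≤ deriv Real.smoothTransition x :=
  Real.smoothTransition.monotone.deriv_nonneg

lemma deriv_smoothTransition_of_neg {x : ℝ} (hx : x < 0) : deriv Real.smoothTransition x = 0 := by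
  have : Real.smoothTransition =ᶠ[𝓝 x] fun _ => 0 := by
    filter_upwards [gt_mem_nhds hx] with y hy using Real.smoothTransition.zero_of_nonpos hy.le
  rw [this.deriv_eq, deriv_const]

lemma deriv_smoothTransition_of_one_lt {x : ℝ} (hx : 1 < x) :
    deriv Real.smoothTransition x = 0 := by
  have : Real.smoothTransition =ᶠ[𝓝 x] fun _ => 1 := by
    filter_upwards [lt_mem_nhds hx] with y hy using Real.smoothTransition.one_of_one_le hy.le
  rw [this.deriv_eq, deriv_const]

lemma exists_deriv_smoothTransition_le : ∃ C : ℝ, 0 ≤ C ∧ ∀ x, deriv Real.smoothTransition x ≤ C := by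
  have hc : Continuous (deriv Real.smoothTransition) :=
    (Real.smoothTransition.contDiff (n := 1)).continuous_deriv le_rfl
  obtain ⟨C, hC⟩ := (isCompact_Icc (a := (0 : ℝ)) (b := 1)).exists_bound_of_continuousOn
    hc.continuousOn
  have hC0 : 0 ≤ C := (norm_nonneg _).trans (hC 0 (by simp))
  refine ⟨C, hC0, fun x => ?_⟩
  rcases lt_or_ge x 0 with h0 | h0
  · rw [deriv_smoothTransition_of_neg h0]; exact hC0
  · rcases lt_or_ge 1 x with h1 | h1
    · rw [deriv_smoothTransition_of_one_lt h1]; exact hC0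
    · exact (le_abs_self _).trans (hC x ⟨h0, h1⟩)

lemma hasDerivAt_smoothTransition (x : ℝ) :
    HasDerivAt Real.smoothTransition (deriv Real.smoothTransition x) x :=
  ((Real.smoothTransition.contDiff (n := 1)).differentiable one_ne_zero x).hasDerivAt

end Cutoff

/-! ### The estimator with cutoffs -/

section CutoffFit

variable {n q r : ℕ} {P : Matrix (Fin n) (Fin n) ℝ}
  {W : Matrix (Fin n) (Fin q) ℝ → Matrix (Fin n) (Fin r) ℝ}
  {d : Matrix (Fin n) (Fin q) ℝ → Fin r → ℝ}
  {V : Matrix (Fin n) (Fin q) ℝ → Matrix (Fin q) (Fin r) ℝ} {s : Fin r → ℝ → ℝ}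

/-- The squared Frobenius norm of the matrix with entries `y`. -/
def normSq (y : Fin n × Fin q → ℝ) : ℝ := ∑ a, y a ^ 2

/-- The discriminant of the squared singular values. -/
noncomputable def svDiscr (d : Matrix (Fin n) (Fin q) ℝ → Fin r → ℝ) (y : Fin n × Fin q → ℝ) : ℝ :=
  discr fun k => d (toMat y) k ^ 2

/-- A cutoff that vanishes near the responses with tied or zero singular values, and tends to `1` at
all other responses as `m → ∞`. -/
noncomputable def tieCutoff (d : Matrix (Fin n) (Fin q) ℝ → Fin r → ℝ) (m : ℝ)
    (y : Fin n × Fin q → ℝ) : ℝ := Real.smoothTransition (m * svDiscr d y - 1)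

/-- A cutoff that vanishes outside a ball, and tends to `1` as `m → ∞`. -/
noncomputable def ballCutoff (m : ℝ) (y : Fin n × Fin q → ℝ) : ℝ :=
  Real.smoothTransition (2 - normSq y / m)

/-- An entry of the estimator, multiplied by both cutoffs. -/
noncomputable def cutFit (P : Matrix (Fin n) (Fin n) ℝ)
    (d : Matrix (Fin n) (Fin q) ℝ → Fin r → ℝ)
    (V : Matrix (Fin n) (Fin q) ℝ → Matrix (Fin q) (Fin r) ℝ) (s : Fin r → ℝ → ℝ) (m : ℝ)
    (i : Fin n) (j : Fin q) (y : Fin n × Fin q → ℝ) : ℝ :=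
  ballCutoff m y * tieCutoff d m y * fit P d V s (toMat y) i j

lemma continuous_normSq : Continuous (normSq (n := n) (q := q)) := by
  unfold normSq
  fun_prop

lemma normSq_eq (y : Fin n × Fin q → ℝ) : normSq y = ∑ i, ∑ j, toMat y i j ^ 2 := by
  rw [normSq, Fintype.sum_prod_type]
  rfl

lemma svDiscr_nonneg (h : ∀ Y, IsThinSVD (P * Y) (W Y) (d Y) (V Y)) (y : Fin n × Fin q → ℝ) :
    0 ≤ svDiscr d y :=
  discr_nonneg (h _).isSpectral.anti (h _).isSpectral.nonneg

lemma continuous_svDiscr (h : ∀ Y, IsThinSVD (P * Y) (W Y) (d Y) (V Y)) :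
    Continuous (svDiscr d) := by
  have hc : ∀ k, Continuous fun y : Fin n × Fin q → ℝ => d (toMat y) k := fun k =>
    (continuous_singularValue h k).comp continuous_toMat
  have hd : Continuous (discr (r := r)) := by
    unfold discr
    fun_prop
  exact hd.comp (continuous_pi fun k => (hc k).pow 2)

lemma lipAt_gram (y : Fin n × Fin q → ℝ) (a b : Fin q) :
    LipAt (fun z : Fin n × Fin q → ℝ => gram P (toMat z) a b) y := by
  refine ContDiffAt.lipAt ?_
  simp only [gram, toMat, Matrix.mul_apply, Matrix.transpose_apply, Matrix.of_apply]
  fun_prop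

/-- The squared singular values, unlike the singular values, are locally Lipschitz everywhere, as
eigenvalues of a polynomial function. -/
lemma lipAt_sq_singularValue (h : ∀ Y, IsThinSVD (P * Y) (W Y) (d Y) (V Y))
    (y : Fin n × Fin q → ℝ) (k : Fin r) :
    LipAt (fun z : Fin n × Fin q → ℝ => d (toMat z) k ^ 2) y :=
  lipAt_eigenvalue (fun z => (h (toMat z)).isSpectral) (lipAt_gram y) k

lemma lipAt_singularValue (h : ∀ Y, IsThinSVD (P * Y) (W Y) (d Y) (V Y))
    (y : Fin n × Fin q → ℝ) {k : Fin r} (hk : 0 < d (toMat y) k) :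
    LipAt (fun z : Fin n × Fin q → ℝ => d (toMat z) k) y := by
  have h1 : LipAt Real.sqrt (d (toMat y) k ^ 2) :=
    (Real.contDiffAt_sqrt (pow_pos hk 2).ne').lipAt
  refine (LipAt.comp (f := fun z : Fin n × Fin q → ℝ => d (toMat z) k ^ 2) h1
    (lipAt_sq_singularValue h y k)).congr (Eventually.of_forall fun z => ?_)
  exact Real.sqrt_sq ((h _).nonneg k)

lemma lipAt_weight (h : ∀ Y, IsThinSVD (P * Y) (W Y) (d Y) (V Y))
    (hs : ∀ k, LocallyLipschitzOn (Set.Ioi 0) (s k)) (y : Fin n × Fin q → ℝ) {k : Fin r}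
    (hk : 0 < d (toMat y) k) :
    LipAt (fun z : Fin n × Fin q → ℝ => s k (d (toMat z) k)) y :=
  LipAt.comp (f := fun z : Fin n × Fin q → ℝ => d (toMat z) k)
    ((hs k).lipAt isOpen_Ioi hk) (lipAt_singularValue h y hk)

lemma lipAt_fit (h : ∀ Y, IsThinSVD (P * Y) (W Y) (d Y) (V Y))
    (hs : ∀ k, LocallyLipschitzOn (Set.Ioi 0) (s k)) {y : Fin n × Fin q → ℝ}
    (h0 : IsSimple (d (toMat y))) (i : Fin n) (j : Fin q) :
    LipAt (fun z : Fin n × Fin q → ℝ => fit P d V s (toMat z) i j) y := by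
  have hmul : ∀ z : Fin n × Fin q → ℝ, fit P d V s (toMat z) i j = ∑ b, (P * toMat z) i b *
      (V (toMat z) * diagonal (fun k => s k (d (toMat z) k)) * (V (toMat z))ᵀ) b j := fun z =>
    Matrix.mul_apply
  simp only [hmul]
  refine LipAt.sum fun b _ => LipAt.mul (ContDiffAt.lipAt ?_) ?_
  · simp only [toMat, Matrix.mul_apply, Matrix.of_apply]
    fun_prop
  · exact lipAt_conj_diagonal (fun z => (h (toMat z)).isSpectral) (lipAt_gram y) (isSimple_sq h0)
      (w := fun z k => s k (d (toMat z) k)) (fun k => lipAt_weight h hs y (h0.2 k)) b j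

lemma lipAt_svDiscr (h : ∀ Y, IsThinSVD (P * Y) (W Y) (d Y) (V Y)) (y : Fin n × Fin q → ℝ) :
    LipAt (svDiscr d) y :=
  (LipAt.prod fun k _ => lipAt_sq_singularValue h y k).mul
    (LipAt.prod fun k _ => LipAt.prod fun l _ =>
      (lipAt_sq_singularValue h y k).sub (lipAt_sq_singularValue h y l))

/-- Near a response with ties the function vanishes; elsewhere the estimator itself is Lipschitz. -/
lemma locallyLipschitz_cutFit (h : ∀ Y, IsThinSVD (P * Y) (W Y) (d Y) (V Y))
    (hs : ∀ k, LocallyLipschitzOn (Set.Ioi 0) (s k)) (m : ℝ) (i : Fin n) (j : Fin q) :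
    LocallyLipschitz (cutFit P d V s m i j) := by
  refine locallyLipschitz_of_lipAt fun y => ?_
  by_cases hy : svDiscr d y = 0
  · have hc : Continuous fun z => m * svDiscr d z - 1 :=
      ((continuous_svDiscr h).const_mul m).sub continuous_const
    have hneg : ∀ᶠ z in 𝓝 y, m * svDiscr d z - 1 < 0 :=
      hc.continuousAt.eventually_lt_const (by show m * svDiscr d y - 1 < 0; rw [hy]; norm_num)
    refine (lipAt_const (0 : ℝ) y).congr ?_
    filter_upwards [hneg] with z hz
    rw [cutFit, tieCutoff, Real.smoothTransition.zero_of_nonpos hz.le, mul_zero, zero_mul]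
  · have h0 : IsSimple (d (toMat y)) := isSimple_of_sq (h _).nonneg
      (isSimple_of_discr_ne_zero (h _).isSpectral.anti (h _).isSpectral.nonneg hy)
    have hΘ : ∀ x, LipAt Real.smoothTransition x := fun x =>
      (Real.smoothTransition.contDiffAt (n := 1)).lipAt
    refine LipAt.mul (LipAt.mul ?_ ?_) (lipAt_fit h hs h0 i j)
    · refine LipAt.comp (f := fun z : Fin n × Fin q → ℝ => 2 - normSq z / m) (hΘ _)
        (ContDiffAt.lipAt ?_)
      unfold normSq
      fun_prop
    · exact LipAt.comp (f := fun z => m * svDiscr d z - 1) (hΘ _)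
        (((lipAt_const m y).mul (lipAt_svDiscr h y)).sub (lipAt_const 1 y))

lemma hasCompactSupport_cutFit {m : ℝ} (hm : 0 < m) (i : Fin n) (j : Fin q) :
    HasCompactSupport (cutFit P d V s m i j) := by
  refine HasCompactSupport.of_support_subset_isCompact
    (isCompact_closedBall (0 : Fin n × Fin q → ℝ) (2 * m + 1)) fun y hy => ?_
  have h1 : normSq y ≤ 2 * m := by
    by_contra hlt
    refine hy ?_
    rw [cutFit, ballCutoff, Real.smoothTransition.zero_of_nonpos, zero_mul, zero_mul]
    rw [sub_nonpos, le_div_iff₀ hm]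
    exact (not_le.1 hlt).le
  rw [mem_closedBall_zero_iff, pi_norm_le_iff_of_nonneg (by positivity)]
  intro a
  have h2 : y a ^ 2 ≤ normSq y := Finset.single_le_sum (f := fun a => y a ^ 2)
    (fun _ _ => sq_nonneg _) (Finset.mem_univ a)
  rw [Real.norm_eq_abs]
  nlinarith [sq_abs (y a), sq_nonneg (|y a| - 1)]

/-- A directional derivative of a function of a matrix, read in the coordinates `y`. -/
lemma _root_.HasLineDerivAt.comp_toMat {f : Matrix (Fin n) (Fin q) ℝ → ℝ} {f' : ℝ}
    {y : Fin n × Fin q → ℝ} {i : Fin n} {j : Fin q}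
    (hf : HasLineDerivAt ℝ f f' (toMat y) (Matrix.single i j 1)) :
    HasLineDerivAt ℝ (fun z => f (toMat z)) f' y (Pi.single (i, j) 1) := by
  have h1 : ∀ t : ℝ, toMat (y + t • Pi.single (i, j) 1) = toMat y + t • Matrix.single i j 1 := by
    intro t
    ext a b
    simp only [toMat, Matrix.of_apply, Pi.add_apply, Pi.smul_apply, Matrix.add_apply,
      Matrix.smul_apply, Matrix.single_apply, Pi.single_apply, Prod.mk.injEq]
    simp only [eq_comm]
  rw [HasLineDerivAt] at hf ⊢
  simpa only [h1] using hf

lemma hasLineDerivAt_normSq (y : Fin n × Fin q → ℝ) (a : Fin n × Fin q) :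
    HasLineDerivAt ℝ normSq (2 * y a) y (Pi.single a 1) := by
  have h1 : ∀ b, HasDerivAt (fun t : ℝ => (y + t • (Pi.single a 1 : Fin n × Fin q → ℝ)) b ^ 2)
      (if b = a then 2 * y a else 0) 0 := by
    intro b
    by_cases hb : b = a
    · subst hb
      simp only [Pi.add_apply, Pi.smul_apply, Pi.single_eq_same, smul_eq_mul, mul_one, if_true]
      have h2 := (((hasDerivAt_id (0 : ℝ)).const_add (y b)).pow 2)
      refine h2.congr_deriv ?_
      simp
    · simpa [hb] using hasDerivAt_const (0 : ℝ) (y b ^ 2)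
  have h2 := HasDerivAt.fun_sum fun b (_ : b ∈ Finset.univ) => h1 b
  simp only [Finset.sum_ite_eq', Finset.mem_univ, if_true] at h2
  exact h2

/-- The divergence of the estimator multiplied by both cutoffs. The gradient of the cutoff at the ties
contributes again the divergence without the derivatives of the weights, up to a multiple of the sum
of the weights. -/
lemma sum_lineDeriv_cutFit (hPT : Pᵀ = P) (hPP : P * P = P) {rx : ℕ} (hrx : P.trace = rx)
    (hr : r = min rx q) (h : ∀ Y, IsThinSVD (P * Y) (W Y) (d Y) (V Y))
    {y : Fin n × Fin q → ℝ} (h0 : IsSimple (d (toMat y)))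
    (hs : ∀ k, DifferentiableAt ℝ (s k) (d (toMat y) k)) (m : ℝ) :
    ∑ i, ∑ j, lineDeriv ℝ (cutFit P d V s m i j) y (Pi.single (i, j) 1) =
      ballCutoff m y * tieCutoff d m y *
        (baseDf rx q (d (toMat y)) (fun k => s k (d (toMat y) k)) +
          ∑ k, d (toMat y) k * deriv (s k) (d (toMat y) k)) +
      ballCutoff m y *
        (deriv Real.smoothTransition (m * svDiscr d y - 1) * (m * svDiscr d y)) *
        (baseDf rx q (d (toMat y)) (fun k => s k (d (toMat y) k)) +
          ((r : ℝ) + 1 - (max rx q : ℕ)) * ∑ k, s k (d (toMat y) k)) -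
      tieCutoff d m y * (deriv Real.smoothTransition (2 - normSq y / m) * (2 / m *
        ∑ k, d (toMat y) k ^ 2 * s k (d (toMat y) k))) := by
  set Y := toMat y with hY
  set G : Fin n → Fin q → Fin r → ℝ := fun i j k => 2 * (P * Y * proj (V Y) (some k)) i j with hG
  set L : Fin n → Fin q → ℝ := fun i j => ∑ k, G i j k / d Y k ^ 2 +
    ∑ k, ∑ l ∈ Finset.Ioi k, (G i j k - G i j l) / (d Y k ^ 2 - d Y l ^ 2) with hL
  have hz : ∀ a : Fin n × Fin q, y + (0 : ℝ) • Pi.single a (1 : ℝ) = y := fun a => by simp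
  have hdisc : ∀ i j, HasLineDerivAt ℝ (svDiscr d) (svDiscr d y * L i j) y
      (Pi.single (i, j) 1) := by
    intro i j
    have h1 : ∀ k, HasDerivAt (fun t : ℝ => d (toMat (y + t • Pi.single (i, j) (1 : ℝ))) k ^ 2)
        (G i j k) 0 := fun k =>
      (hasLineDerivAt_eigenvalue_single hPT hPP (fun Z => (h Z).isSpectral) (isSimple_sq h0)
        i j k).comp_toMat
    have h2 := hasDerivAt_discr (lam := fun t k => d (toMat (y + t • Pi.single (i, j) (1 : ℝ))) k ^ 2)
      h1 (by rw [hz]; exact isSimple_sq h0)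
    rw [hz] at h2
    exact h2
  have hderiv : ∀ i j, lineDeriv ℝ (cutFit P d V s m i j) y (Pi.single (i, j) 1) =
      (deriv Real.smoothTransition (2 - normSq y / m) * (-(2 * toMat y i j / m)) *
          tieCutoff d m y + ballCutoff m y *
          (deriv Real.smoothTransition (m * svDiscr d y - 1) * (m * (svDiscr d y * L i j)))) *
        fit P d V s Y i j + ballCutoff m y * tieCutoff d m y *
        lineDeriv ℝ (fun Z => fit P d V s Z i j) Y (Matrix.single i j 1) := by
    intro i j
    have h1 := ((hasLineDerivAt_normSq y (i, j)).div_const m).const_sub 2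
    have h2 : HasLineDerivAt ℝ (ballCutoff m) _ y (Pi.single (i, j) 1) :=
      HasDerivAt.comp (0 : ℝ) (hasDerivAt_smoothTransition _) h1
    have h3 := (HasDerivAt.const_mul m (hdisc i j)).sub_const 1
    have h4 : HasLineDerivAt ℝ (tieCutoff d m) _ y (Pi.single (i, j) 1) :=
      HasDerivAt.comp (0 : ℝ) (hasDerivAt_smoothTransition _) h3
    have h5 := (hasLineDerivAt_fit_single hPT hPP h h0 hs i i j j).comp_toMat
    rw [(hasLineDerivAt_fit_single hPT hPP h h0 hs i i j j).lineDeriv]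
    have h6 : HasLineDerivAt ℝ (cutFit P d V s m i j) _ y (Pi.single (i, j) 1) :=
      HasDerivAt.fun_mul (HasDerivAt.fun_mul h2 h4) h5
    rw [h6.lineDeriv]
    simp only [hz]
    rfl
  -- along the estimator, the logarithmic derivative of the discriminant reproduces the divergence
  have hLsum : ∑ i, ∑ j, L i j * fit P d V s Y i j =
      baseDf rx q (d Y) (fun k => s k (d Y k)) +
          ((r : ℝ) + 1 - (max rx q : ℕ)) * ∑ k, s k (d Y k) := by
    rw [← sum_logDeriv_discr rx q h0]
    have hk : ∀ k, ∑ i, ∑ j, G i j k * fit P d V s Y i j = 2 * (d Y k ^ 2 * s k (d Y k)) :=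
      fun k => sum_gradient_mul_fit h Y k
    have e1 : ∀ i j, L i j * fit P d V s Y i j =
        ∑ k, (d Y k ^ 2)⁻¹ * (G i j k * fit P d V s Y i j) +
        ∑ k, ∑ l ∈ Finset.Ioi k, (d Y k ^ 2 - d Y l ^ 2)⁻¹ *
          (G i j k * fit P d V s Y i j - G i j l * fit P d V s Y i j) := by
      intro i j
      simp only [hL, add_mul, Finset.sum_mul]
      congr 1
      · exact Finset.sum_congr rfl fun k _ => by ring
      · exact Finset.sum_congr rfl fun k _ => Finset.sum_congr rfl fun l _ => by ring
    simp only [e1, Finset.sum_add_distrib]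
    congr 1
    · rw [Finset.sum_congr rfl fun i _ => Finset.sum_comm, Finset.sum_comm]
      refine Finset.sum_congr rfl fun k _ => ?_
      simp only [← Finset.mul_sum]
      rw [hk, div_eq_inv_mul]
    · rw [Finset.sum_congr rfl fun i _ => Finset.sum_comm, Finset.sum_comm]
      refine Finset.sum_congr rfl fun k _ => ?_
      rw [Finset.sum_congr rfl fun i _ => Finset.sum_comm, Finset.sum_comm]
      refine Finset.sum_congr rfl fun l _ => ?_
      simp only [← Finset.mul_sum, Finset.sum_sub_distrib]
      rw [hk, hk, div_eq_inv_mul]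
  have hYsum := sum_mul_fit (s := s) hPT hPP h Y
  have hFsum := sum_lineDeriv_fit (s := s) hPT hPP hrx hr h h0 hs
  rw [← hFsum, ← hLsum, ← hYsum]
  simp only [hderiv, Finset.mul_sum, ← Finset.sum_add_distrib, ← Finset.sum_sub_distrib]
  refine Finset.sum_congr rfl fun i _ => Finset.sum_congr rfl fun j _ => ?_
  ring

end CutoffFit

/-! ### Removal of the cutoffs -/

section Limit

variable {Ω : Type*} [MeasurableSpace Ω] {μ : Measure Ω}

lemma integrable_and_abs_integral_mul_le {φ f : Ω → ℝ} {c : ℝ} (hφ : AEStronglyMeasurable φ μ)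
    (hb : ∀ ω, |φ ω| ≤ c) (hf : Integrable f μ) :
    Integrable (fun ω => φ ω * f ω) μ ∧ |∫ ω, φ ω * f ω ∂μ| ≤ c * ∫ ω, |f ω| ∂μ := by
  refine ⟨hf.bdd_mul hφ (Eventually.of_forall hb), ?_⟩
  rw [← integral_const_mul, ← Real.norm_eq_abs]
  refine norm_integral_le_of_norm_le (hf.abs.const_mul c) (Eventually.of_forall fun ω => ?_)
  rw [Real.norm_eq_abs, abs_mul]
  exact mul_le_mul_of_nonneg_right (hb ω) (abs_nonneg _)

/-- Removal of the cutoffs `χ` and `ζ` from an integration by parts formula. The gradients of the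
cutoffs contribute `κ (b + A)` and `η`; since `b` is nonnegative, the first of these has the right
sign for Fatou's lemma, which yields the integrability of `b`, and dominated convergence applies
afterwards. -/
lemma integral_eq_of_cutoff [IsProbabilityMeasure μ] {b R A T : Ω → ℝ} {χ ζ κ η : ℕ → Ω → ℝ}
    {D : ℕ → Ω → ℝ} {c C : ℝ} (hb0 : ∀ᵐ ω ∂μ, 0 ≤ b ω) (hbm : AEStronglyMeasurable b μ)
    (hR : Integrable R μ) (hA : Integrable A μ) (hT : Integrable T μ)
    (hχm : ∀ m, AEStronglyMeasurable (χ m) μ) (hζm : ∀ m, AEStronglyMeasurable (ζ m) μ)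
    (hκm : ∀ m, AEStronglyMeasurable (κ m) μ) (hηm : ∀ m, AEStronglyMeasurable (η m) μ)
    (hχ : ∀ m ω, χ m ω ∈ Set.Icc (0 : ℝ) 1) (hζ : ∀ m ω, ζ m ω ∈ Set.Icc (0 : ℝ) 1)
    (hκ : ∀ m ω, κ m ω ∈ Set.Icc (0 : ℝ) C) (hη : ∀ m, ∀ᵐ ω ∂μ, |η m ω| ≤ C)
    (hχl : ∀ᵐ ω ∂μ, Tendsto (fun m => χ m ω) atTop (𝓝 1))
    (hζl : ∀ᵐ ω ∂μ, Tendsto (fun m => ζ m ω) atTop (𝓝 1))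
    (hκl : ∀ᵐ ω ∂μ, Tendsto (fun m => κ m ω) atTop (𝓝 0))
    (hηl : ∀ᵐ ω ∂μ, Tendsto (fun m => η m ω) atTop (𝓝 0))
    (hD : ∀ m, ∀ᵐ ω ∂μ, D m ω = ζ m ω * χ m ω * (b ω + R ω) + ζ m ω * κ m ω * (b ω + A ω) -
      χ m ω * η m ω) (hDi : ∀ m, Integrable (D m) μ)
    (hDT : ∀ m, ∫ ω, D m ω ∂μ = c * ∫ ω, ζ m ω * χ m ω * T ω ∂μ) :
    Integrable b μ ∧ ∫ ω, (b ω + R ω) ∂μ = c * ∫ ω, T ω ∂μ := by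
  obtain ⟨ω₀⟩ : Nonempty Ω := nonempty_of_isProbabilityMeasure μ
  have hC : 0 ≤ C := (hκ 0 ω₀).1.trans (hκ 0 ω₀).2
  have habs : ∀ {x c : ℝ}, x ∈ Set.Icc (0 : ℝ) c → |x| ≤ c := fun hx => by
    rw [abs_of_nonneg hx.1]; exact hx.2
  have hζχ : ∀ m ω, |ζ m ω * χ m ω| ≤ 1 := fun m ω => by
    rw [abs_mul]
    exact mul_le_one₀ (habs (hζ m ω)) (abs_nonneg _) (habs (hχ m ω))
  have hζκ : ∀ m ω, |ζ m ω * κ m ω| ≤ C := fun m ω => by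
    rw [abs_mul]
    exact (mul_le_of_le_one_left (abs_nonneg _) (habs (hζ m ω))).trans (habs (hκ m ω))
  have hηi : ∀ m, Integrable (η m) μ := fun m => Integrable.of_bound (hηm m) C (hη m)
  have hTm : ∀ m, Integrable (fun ω => ζ m ω * χ m ω * T ω) μ ∧
      |∫ ω, ζ m ω * χ m ω * T ω ∂μ| ≤ 1 * ∫ ω, |T ω| ∂μ := fun m =>
    integrable_and_abs_integral_mul_le ((hζm m).mul (hχm m)) (hζχ m) hT
  have hRm : ∀ m, Integrable (fun ω => ζ m ω * χ m ω * R ω) μ ∧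
      |∫ ω, ζ m ω * χ m ω * R ω ∂μ| ≤ 1 * ∫ ω, |R ω| ∂μ := fun m =>
    integrable_and_abs_integral_mul_le ((hζm m).mul (hχm m)) (hζχ m) hR
  have hAm : ∀ m, Integrable (fun ω => ζ m ω * κ m ω * A ω) μ ∧
      |∫ ω, ζ m ω * κ m ω * A ω ∂μ| ≤ C * ∫ ω, |A ω| ∂μ := fun m =>
    integrable_and_abs_integral_mul_le ((hζm m).mul (hκm m)) (hζκ m) hA
  have hηχ := fun m => integrable_and_abs_integral_mul_le (hχm m) (fun ω => habs (hχ m ω)) (hηi m)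
  -- the integrals of the nonnegative parts are bounded
  set B : ℝ := |c| * ∫ ω, |T ω| ∂μ + ∫ ω, |R ω| ∂μ + C * ∫ ω, |A ω| ∂μ + C with hB
  have hE : ∀ m, Integrable (fun ω => ζ m ω * (χ m ω + κ m ω) * b ω) μ ∧
      ∫ ω, ζ m ω * (χ m ω + κ m ω) * b ω ∂μ ≤ B := by
    intro m
    have hae : (fun ω => D m ω - ζ m ω * χ m ω * R ω - ζ m ω * κ m ω * A ω + χ m ω * η m ω)
        =ᵐ[μ] fun ω => ζ m ω * (χ m ω + κ m ω) * b ω := by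
      filter_upwards [hD m] with ω hω
      rw [hω]
      ring
    have i1 : Integrable (fun ω => D m ω - ζ m ω * χ m ω * R ω) μ := (hDi m).sub (hRm m).1
    have i2 : Integrable (fun ω => D m ω - ζ m ω * χ m ω * R ω - ζ m ω * κ m ω * A ω) μ :=
      i1.sub (hAm m).1
    refine ⟨(i2.add (hηχ m).1).congr hae, ?_⟩
    rw [← integral_congr_ae hae, integral_add i2 (hηχ m).1, integral_sub i1 (hAm m).1,
      integral_sub (hDi m) (hRm m).1, hDT]
    have h1 : c * ∫ ω, ζ m ω * χ m ω * T ω ∂μ ≤ |c| * ∫ ω, |T ω| ∂μ := by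
      refine (le_abs_self _).trans ?_
      rw [abs_mul]
      have := (hTm m).2
      rw [one_mul] at this
      exact mul_le_mul_of_nonneg_left this (abs_nonneg _)
    have h2 := neg_abs_le (∫ ω, ζ m ω * χ m ω * R ω ∂μ)
    have h3 := neg_abs_le (∫ ω, ζ m ω * κ m ω * A ω ∂μ)
    have h4 := le_abs_self (∫ ω, χ m ω * η m ω ∂μ)
    have h5 : ∫ ω, |η m ω| ∂μ ≤ C := by
      have := integral_mono_ae (hηi m).abs (integrable_const C) (hη m)
      simpa using this
    have h6 := (hRm m).2
    have h7 := (hAm m).2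
    have h8 := (hηχ m).2
    linarith
  have hbi : Integrable b μ := by
    refine ⟨hbm, ?_⟩
    rw [hasFiniteIntegral_iff_ofReal hb0]
    have hlim : ∀ᵐ ω ∂μ, Tendsto (fun m => ENNReal.ofReal (ζ m ω * (χ m ω + κ m ω) * b ω)) atTop
        (𝓝 (ENNReal.ofReal (b ω))) := by
      filter_upwards [hχl, hζl, hκl] with ω h1 h2 h3
      have := (h2.mul (h1.add h3)).mul_const (b ω)
      rw [add_zero, one_mul, one_mul] at this
      exact (ENNReal.continuous_ofReal.tendsto _).comp this
    calc ∫⁻ ω, ENNReal.ofReal (b ω) ∂μ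
        = ∫⁻ ω, liminf (fun m => ENNReal.ofReal (ζ m ω * (χ m ω + κ m ω) * b ω)) atTop ∂μ :=
          lintegral_congr_ae (hlim.mono fun ω hω => hω.liminf_eq.symm)
      _ ≤ liminf (fun m => ∫⁻ ω, ENNReal.ofReal (ζ m ω * (χ m ω + κ m ω) * b ω) ∂μ) atTop :=
          lintegral_liminf_le' fun m => (hE m).1.aestronglyMeasurable.aemeasurable.ennreal_ofReal
      _ ≤ ENNReal.ofReal B := by
          refine liminf_le_of_frequently_le' (Frequently.of_forall fun m => ?_)
          rw [← ofReal_integral_eq_lintegral_ofReal (hE m).1]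
          · exact ENNReal.ofReal_le_ofReal (hE m).2
          · filter_upwards [hb0] with ω hω
            exact mul_nonneg (mul_nonneg (hζ m ω).1 (add_nonneg (hχ m ω).1 (hκ m ω).1)) hω
      _ < ∞ := ENNReal.ofReal_lt_top
  refine ⟨hbi, ?_⟩
  have hl1 : Tendsto (fun m => ∫ ω, D m ω ∂μ) atTop (𝓝 (∫ ω, (b ω + R ω) ∂μ)) := by
    refine tendsto_integral_of_dominated_convergence
      (fun ω => |b ω + R ω| + C * |b ω + A ω| + C) (fun m => (hDi m).aestronglyMeasurable)
      (((hbi.add hR).abs.add ((hbi.add hA).abs.const_mul C)).add (integrable_const C)) ?_ ?_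
    · intro m
      filter_upwards [hD m, hη m] with ω h1 h2
      rw [h1, Real.norm_eq_abs]
      refine (abs_sub _ _).trans (add_le_add ((abs_add_le _ _).trans (add_le_add ?_ ?_)) ?_)
      · rw [abs_mul]
        exact mul_le_of_le_one_left (abs_nonneg _) (hζχ m ω)
      · rw [abs_mul]
        exact mul_le_mul_of_nonneg_right (hζκ m ω) (abs_nonneg _)
      · rw [abs_mul]
        exact (mul_le_of_le_one_left (abs_nonneg _) (habs (hχ m ω))).trans h2
    · have hall : ∀ᵐ ω ∂μ, ∀ m, D m ω = ζ m ω * χ m ω * (b ω + R ω) +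
          ζ m ω * κ m ω * (b ω + A ω) - χ m ω * η m ω := ae_all_iff.2 hD
      filter_upwards [hall, hχl, hζl, hκl, hηl] with ω h0 h1 h2 h3 h4
      have := (((h2.mul h1).mul_const (b ω + R ω)).add ((h2.mul h3).mul_const (b ω + A ω))).sub
        (h1.mul h4)
      simp only [one_mul, mul_zero, zero_mul, add_zero, sub_zero] at this
      exact this.congr fun m => (h0 m).symm
  have hl2 : Tendsto (fun m => c * ∫ ω, ζ m ω * χ m ω * T ω ∂μ) atTop
      (𝓝 (c * ∫ ω, T ω ∂μ)) := by
    refine Tendsto.const_mul c (tendsto_integral_of_dominated_convergence (fun ω => |T ω|)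
      (fun m => (hTm m).1.aestronglyMeasurable) hT.abs ?_ ?_)
    · intro m
      refine Eventually.of_forall fun ω => ?_
      rw [Real.norm_eq_abs, abs_mul]
      exact mul_le_of_le_one_left (abs_nonneg _) (hζχ m ω)
    · filter_upwards [hχl, hζl] with ω h1 h2
      simpa using (h2.mul h1).mul_const (T ω)
  exact tendsto_nhds_unique (hl1.congr hDT) hl2

end Limit

section Expectation

variable {n q r : ℕ} {P : Matrix (Fin n) (Fin n) ℝ}
  {W : Matrix (Fin n) (Fin q) ℝ → Matrix (Fin n) (Fin r) ℝ}
  {d : Matrix (Fin n) (Fin q) ℝ → Fin r → ℝ}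
  {V : Matrix (Fin n) (Fin q) ℝ → Matrix (Fin q) (Fin r) ℝ} {s : Fin r → ℝ → ℝ}
  {μ : Measure (Fin n × Fin q → ℝ)}

/-- A function that is continuous at all responses with simple singular values is measurable up to
a null set. -/
lemma aestronglyMeasurable_of_isSimple (h : ∀ Y, IsThinSVD (P * Y) (W Y) (d Y) (V Y))
    (hsimple : ∀ᵐ y ∂μ, IsSimple (d (toMat y))) {f : (Fin n × Fin q → ℝ) → ℝ}
    (hf : ∀ y, IsSimple (d (toMat y)) → ContinuousAt f y) : AEStronglyMeasurable f μ := by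
  have hU : IsOpen {y : Fin n × Fin q → ℝ | IsSimple (d (toMat y))} :=
    isOpen_iff_mem_nhds.2 fun y hy => eventually_isSimple (lam := fun y => d (toMat y))
      (tendsto_pi_nhds.2 fun k =>
        ((continuous_singularValue h k).comp continuous_toMat).continuousAt) hy
  have h1 := ContinuousOn.aestronglyMeasurable (μ := μ)
    (fun y hy => (hf y hy).continuousWithinAt) hU.measurableSet
  rwa [Measure.restrict_eq_self_of_ae_mem hsimple] at h1

lemma continuousAt_baseDf (h : ∀ Y, IsThinSVD (P * Y) (W Y) (d Y) (V Y))
    (hs : ∀ k, LocallyLipschitzOn (Set.Ioi 0) (s k)) (rx : ℕ) {y : Fin n × Fin q → ℝ}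
    (h0 : IsSimple (d (toMat y))) :
    ContinuousAt (fun y => baseDf rx q (d (toMat y)) (fun k => s k (d (toMat y) k))) y := by
  have ha : ∀ k, ContinuousAt (fun y : Fin n × Fin q → ℝ => s k (d (toMat y) k)) y := fun k =>
    (lipAt_weight h hs y (h0.2 k)).continuousAt
  have hd : ∀ k, ContinuousAt (fun y : Fin n × Fin q → ℝ => d (toMat y) k ^ 2) y := fun k =>
    (lipAt_sq_singularValue h y k).continuousAt
  refine ContinuousAt.add (continuousAt_const.mul (tendsto_finsetSum _ fun k _ => ha k))
    (tendsto_finsetSum _ fun k _ => tendsto_finsetSum _ fun l _ => ?_)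
  by_cases hkl : k = l
  · simp [hkl]
  · exact (((hd k).mul ((ha k).sub (ha l))).div ((hd k).sub (hd l))
      (sub_ne_zero.2 fun he => hkl ((isSimple_sq h0).1.injective he))).tendsto

lemma memLp_coord (m₀ : Fin n × Fin q → ℝ) (v : ℝ≥0) (a : Fin n × Fin q) :
    MemLp (fun y => y a) 2 (gaussLaw m₀ v) := by
  have h1 := memLp_id_gaussianReal' (μ := m₀ a) (v := v) 2 (by norm_num)
  exact h1.comp_measurePreserving (measurePreserving_eval (fun a => gaussianReal (m₀ a) v) a)

/-- The estimator is square integrable because shrinking contracts the Frobenius norm. -/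
lemma memLp_fit (hPT : Pᵀ = P) (hPP : P * P = P)
    (h : ∀ Y, IsThinSVD (P * Y) (W Y) (d Y) (V Y)) (hs : ∀ k, LocallyLipschitzOn (Set.Ioi 0) (s k))
    (hs01 : ∀ k x, 0 < x → s k x ∈ Set.Icc (0 : ℝ) 1) {m₀ : Fin n × Fin q → ℝ} {v : ℝ≥0}
    (hsimple : ∀ᵐ y ∂gaussLaw m₀ v, IsSimple (d (toMat y))) (i : Fin n) (j : Fin q) :
    MemLp (fun y => fit P d V s (toMat y) i j) 2 (gaussLaw m₀ v) := by
  have hm : AEStronglyMeasurable (fun y => fit P d V s (toMat y) i j) (gaussLaw m₀ v) :=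
    aestronglyMeasurable_of_isSimple h hsimple fun y hy => (lipAt_fit h hs hy i j).continuousAt
  rw [memLp_two_iff_integrable_sq hm]
  have hN : Integrable (fun y => ∑ a, y a ^ 2) (gaussLaw m₀ v) :=
    integrable_finsetSum _ fun a _ => (memLp_coord m₀ v a).integrable_sq
  refine hN.mono' (hm.pow 2) (Eventually.of_forall fun y => ?_)
  rw [Real.norm_of_nonneg (sq_nonneg _)]
  refine le_trans ?_ ((sum_sq_fit_le hPT hPP h hs01 (toMat y)).trans_eq (normSq_eq y).symm)
  refine le_trans ?_ (Finset.single_le_sum (f := fun i => ∑ j, fit P d V s (toMat y) i j ^ 2)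
    (fun i _ => Finset.sum_nonneg fun j _ => sq_nonneg _) (Finset.mem_univ i))
  exact Finset.single_le_sum (f := fun j => fit P d V s (toMat y) i j ^ 2)
    (fun j _ => sq_nonneg _) (Finset.mem_univ j)

/-- Stein's identity for the shrinkage estimator: the limit of the identities for the estimator with
cutoffs. The integrability of the divergence without the derivatives of the weights is part of the
conclusion. -/
lemma integral_df_fit (hPT : Pᵀ = P) (hPP : P * P = P) {rx : ℕ} (hrx : P.trace = rx)
    (hr : r = min rx q) (h : ∀ Y, IsThinSVD (P * Y) (W Y) (d Y) (V Y))
    (hs : ∀ k, LocallyLipschitzOn (Set.Ioi 0) (s k))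
    (hs01 : ∀ k x, 0 < x → s k x ∈ Set.Icc (0 : ℝ) 1)
    (hord : ∀ x : Fin r → ℝ, Antitone x → (∀ k, 0 < x k) → Antitone fun k => s k (x k))
    {m₀ : Fin n × Fin q → ℝ} {v : ℝ≥0} (hv : v ≠ 0)
    (hsimple : ∀ᵐ y ∂gaussLaw m₀ v, IsSimple (d (toMat y)))
    (hdiff : ∀ᵐ y ∂gaussLaw m₀ v, ∀ k, DifferentiableAt ℝ (s k) (d (toMat y) k))
    (hR : ∀ k, Integrable (fun y => d (toMat y) k * deriv (s k) (d (toMat y) k))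
      (gaussLaw m₀ v)) :
    Integrable (fun y => baseDf rx q (d (toMat y)) (fun k => s k (d (toMat y) k)))
        (gaussLaw m₀ v) ∧
      ∫ y, (baseDf rx q (d (toMat y)) (fun k => s k (d (toMat y) k)) +
          ∑ k, d (toMat y) k * deriv (s k) (d (toMat y) k)) ∂gaussLaw m₀ v =
        (v : ℝ)⁻¹ * ∫ y, ∑ i, ∑ j, (y (i, j) - m₀ (i, j)) * fit P d V s (toMat y) i j
          ∂gaussLaw m₀ v := by
  obtain ⟨C, hC0, hC⟩ := exists_deriv_smoothTransition_le
  have hm0 : ∀ m : ℕ, (0 : ℝ) < (m : ℝ) + 1 := fun m => by positivity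
  have hΘ : Continuous (deriv Real.smoothTransition) :=
    (Real.smoothTransition.contDiff (n := 1)).continuous_deriv le_rfl
  have hdisc := continuous_svDiscr h
  have hweight : ∀ k, AEStronglyMeasurable (fun y => s k (d (toMat y) k)) (gaussLaw m₀ v) :=
    fun k => aestronglyMeasurable_of_isSimple h hsimple fun y hy =>
      (lipAt_weight h hs y (hy.2 k)).continuousAt
  have hds01 : ∀ y k, d (toMat y) k ^ 2 * s k (d (toMat y) k) ∈
      Set.Icc (0 : ℝ) (d (toMat y) k ^ 2) := by
    intro y k
    rcases ((h (toMat y)).nonneg k).eq_or_lt with h0 | h0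
    · simp [← h0]
    · have := hs01 k _ h0
      exact ⟨mul_nonneg (sq_nonneg _) this.1, mul_le_of_le_one_right (sq_nonneg _) this.2⟩
  have hnorm : ∀ y : Fin n × Fin q → ℝ, ∑ k, d (toMat y) k ^ 2 * s k (d (toMat y) k) ∈
      Set.Icc (0 : ℝ) (normSq y) := fun y =>
    ⟨Finset.sum_nonneg fun k _ => (hds01 y k).1, (Finset.sum_le_sum fun k _ => (hds01 y k).2).trans
      ((sum_sq_singularValue_le hPT hPP h _).trans_eq (normSq_eq y).symm)⟩
  have hfit := memLp_fit hPT hPP h hs hs01 hsimple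
  refine integral_eq_of_cutoff (C := 4 * C)
    (A := fun y => ((r : ℝ) + 1 - (max rx q : ℕ)) * ∑ k, s k (d (toMat y) k))
    (χ := fun m => tieCutoff d (m + 1)) (ζ := fun m => ballCutoff (m + 1))
    (κ := fun m y => deriv Real.smoothTransition ((m + 1) * svDiscr d y - 1) *
      ((m + 1) * svDiscr d y))
    (η := fun m y => deriv Real.smoothTransition (2 - normSq y / (m + 1)) * (2 / (m + 1) *
        ∑ k, d (toMat y) k ^ 2 * s k (d (toMat y) k)))
    (D := fun m y => ∑ i, ∑ j, lineDeriv ℝ (cutFit P d V s (m + 1) i j) y (Pi.single (i, j) 1))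
    ?_ ?_ ?_ ?_ ?_ ?_ ?_ ?_ ?_ ?_ ?_ ?_ ?_ ?_ ?_ ?_ ?_ ?_ ?_ ?_
  · filter_upwards [hsimple] with y hy
    exact baseDf_nonneg rx q hy (hord _ hy.1.antitone hy.2) fun k => (hs01 k _ (hy.2 k)).1
  · exact aestronglyMeasurable_of_isSimple h hsimple fun y hy => continuousAt_baseDf h hs rx hy
  · exact integrable_finsetSum _ fun k _ => hR k
  · refine (integrable_finsetSum _ fun k _ => ?_).const_mul _
    refine Integrable.of_bound (hweight k) 1 ?_
    filter_upwards [hsimple] with y hy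
    have := hs01 k _ (hy.2 k)
    rw [Real.norm_of_nonneg this.1]
    exact this.2
  · refine integrable_finsetSum _ fun i _ => integrable_finsetSum _ fun j _ => ?_
    exact ((memLp_coord m₀ v (i, j)).sub (memLp_const _)).integrable_mul (hfit i j)
  · intro m
    exact (Real.smoothTransition.continuous.comp ((hdisc.const_mul _).sub
      continuous_const)).aestronglyMeasurable
  · intro m
    exact (Real.smoothTransition.continuous.comp (continuous_const.sub
      (continuous_normSq.div_const _))).aestronglyMeasurable
  · intro m
    exact ((hΘ.comp ((hdisc.const_mul _).sub continuous_const)).mul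
      (hdisc.const_mul _)).aestronglyMeasurable
  · intro m
    refine (hΘ.comp (continuous_const.sub
      (continuous_normSq.div_const _))).aestronglyMeasurable.mul (AEStronglyMeasurable.const_mul
        (Finset.aestronglyMeasurable_fun_sum _ fun k _ => ?_) _)
    exact (((continuous_singularValue h k).comp continuous_toMat).pow 2).aestronglyMeasurable.mul
      (hweight k)
  · exact fun m y => ⟨Real.smoothTransition.nonneg _, Real.smoothTransition.le_one _⟩
  · exact fun m y => ⟨Real.smoothTransition.nonneg _, Real.smoothTransition.le_one _⟩
  · intro m y
    have hx : 0 ≤ ((m : ℝ) + 1) * svDiscr d y := mul_nonneg (hm0 m).le (svDiscr_nonneg h y)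
    refine ⟨mul_nonneg (deriv_smoothTransition_nonneg _) hx, ?_⟩
    rcases lt_or_ge 1 (((m : ℝ) + 1) * svDiscr d y - 1) with h1 | h1
    · rw [deriv_smoothTransition_of_one_lt h1, zero_mul]; positivity
    -- where the derivative does not vanish, its argument is at most `1`
    · have := mul_le_mul (hC (((m : ℝ) + 1) * svDiscr d y - 1))
        (show ((m : ℝ) + 1) * svDiscr d y ≤ 2 by linarith) hx hC0
      linarith
  · intro m
    refine Eventually.of_forall fun y => ?_
    rcases lt_or_ge (2 - normSq y / ((m : ℝ) + 1)) 0 with h1 | h1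
    · rw [deriv_smoothTransition_of_neg h1, zero_mul, abs_zero]; positivity
    -- where the derivative does not vanish, `‖y‖² ≤ 2 (m + 1)`
    · have h2 : normSq y / ((m : ℝ) + 1) ≤ 2 := by linarith
      have h3 := hnorm y
      have h4 : 0 ≤ 2 / ((m : ℝ) + 1) * ∑ k, d (toMat y) k ^ 2 * s k (d (toMat y) k) :=
        mul_nonneg (by positivity) h3.1
      have h5 : 2 / ((m : ℝ) + 1) * ∑ k, d (toMat y) k ^ 2 * s k (d (toMat y) k) ≤ 4 := by
        have h6 := mul_le_mul_of_nonneg_left h3.2 (show 0 ≤ 2 / ((m : ℝ) + 1) by positivity)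
        have h7 : 2 / ((m : ℝ) + 1) * normSq y = 2 * (normSq y / ((m : ℝ) + 1)) := by ring
        linarith
      rw [abs_of_nonneg (mul_nonneg (deriv_smoothTransition_nonneg _) h4), mul_comm 4]
      exact mul_le_mul (hC _) h5 h4 hC0
  · filter_upwards [hsimple] with y hy
    refine tendsto_const_nhds.congr' ?_
    have ht : Tendsto (fun m : ℕ => ((m : ℝ) + 1) * svDiscr d y) atTop atTop :=
      (tendsto_atTop_add_const_right _ _ tendsto_natCast_atTop_atTop).atTop_mul_const
        (isSimple_sq hy).discr_pos
    filter_upwards [ht.eventually_ge_atTop 2] with m hm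
    exact (Real.smoothTransition.one_of_one_le (by linarith)).symm
  · refine Eventually.of_forall fun y => tendsto_const_nhds.congr' ?_
    have ht : Tendsto (fun m : ℕ => (m : ℝ) + 1) atTop atTop :=
      tendsto_atTop_add_const_right _ _ tendsto_natCast_atTop_atTop
    filter_upwards [ht.eventually_ge_atTop (normSq y)] with m hm
    refine (Real.smoothTransition.one_of_one_le ?_).symm
    have := (div_le_one (hm0 m)).2 hm
    linarith
  · filter_upwards [hsimple] with y hy
    refine tendsto_const_nhds.congr' ?_
    have ht : Tendsto (fun m : ℕ => ((m : ℝ) + 1) * svDiscr d y) atTop atTop :=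
      (tendsto_atTop_add_const_right _ _ tendsto_natCast_atTop_atTop).atTop_mul_const
        (isSimple_sq hy).discr_pos
    filter_upwards [ht.eventually_gt_atTop 2] with m hm
    rw [deriv_smoothTransition_of_one_lt (by linarith), zero_mul]
  · refine Eventually.of_forall fun y => tendsto_const_nhds.congr' ?_
    have ht : Tendsto (fun m : ℕ => (m : ℝ) + 1) atTop atTop :=
      tendsto_atTop_add_const_right _ _ tendsto_natCast_atTop_atTop
    filter_upwards [ht.eventually_gt_atTop (normSq y)] with m hm
    have := (div_lt_one (hm0 m)).2 hm
    rw [deriv_smoothTransition_of_one_lt (by linarith), zero_mul]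
  · intro m
    filter_upwards [hsimple, hdiff] with y hy hy'
    exact sum_lineDeriv_cutFit hPT hPP hrx hr h hy hy' (m + 1)
  · intro m
    exact integrable_finsetSum _ fun i _ => integrable_finsetSum _ fun j _ =>
      integrable_lineDeriv (locallyLipschitz_cutFit h hs _ i j)
        (hasCompactSupport_cutFit (hm0 m) i j) _ _
  · intro m
    have hl := fun i j => locallyLipschitz_cutFit (P := P) h hs ((m : ℝ) + 1) i j
    have hc := fun i j => hasCompactSupport_cutFit (P := P) (d := d) (V := V) (s := s) (hm0 m) i j
    have hi : ∀ i j, Integrable (fun y => (y (i, j) - m₀ (i, j)) *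
        cutFit P d V s ((m : ℝ) + 1) i j y) (gaussLaw m₀ v) := fun i j =>
      integrable_coord_mul (hl i j).continuous (hc i j) _ _ _
    have hT : ∀ y, ballCutoff ((m : ℝ) + 1) y * tieCutoff d ((m : ℝ) + 1) y *
        ∑ i, ∑ j, (y (i, j) - m₀ (i, j)) * fit P d V s (toMat y) i j =
        ∑ i, ∑ j, (y (i, j) - m₀ (i, j)) * cutFit P d V s ((m : ℝ) + 1) i j y := by
      intro y
      simp only [Finset.mul_sum, cutFit]
      exact Finset.sum_congr rfl fun i _ => Finset.sum_congr rfl fun j _ => by ring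
    simp only [hT]
    rw [integral_finsetSum _ fun i _ => integrable_finsetSum _ fun j _ =>
      integrable_lineDeriv (hl i j) (hc i j) _ _,
      integral_finsetSum _ fun i _ => integrable_finsetSum _ fun j _ => hi i j, Finset.mul_sum]
    refine Finset.sum_congr rfl fun i _ => ?_
    rw [integral_finsetSum _ fun j _ => integrable_lineDeriv (hl i j) (hc i j) _ _,
      integral_finsetSum _ fun j _ => hi i j, Finset.mul_sum]
    exact Finset.sum_congr rfl fun j _ => stein_identity m₀ hv (hl i j) (hc i j) (i, j)

end Expectation

/-! ### The closed form under a normal law -/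

section Estimator

variable {n q r : ℕ} {P : Matrix (Fin n) (Fin n) ℝ}
  {W : Matrix (Fin n) (Fin q) ℝ → Matrix (Fin n) (Fin r) ℝ}
  {d : Matrix (Fin n) (Fin q) ℝ → Fin r → ℝ}
  {V : Matrix (Fin n) (Fin q) ℝ → Matrix (Fin q) (Fin r) ℝ} {s : Fin r → ℝ → ℝ}

lemma dfClosed_eq_of_isSimple (rx q : ℕ) {x : Fin r → ℝ} (hx : IsSimple x)
    (hs01 : ∀ k x, 0 < x → s k x ∈ Set.Icc (0 : ℝ) 1)
    (hord : ∀ x : Fin r → ℝ, Antitone x → (∀ k, 0 < x k) → Antitone fun k => s k (x k)) :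
    dfClosed rx q x (fun k => s k (x k)) (fun k => deriv (s k) (x k)) =
      baseDf rx q x (fun k => s k (x k)) + ∑ k, x k * deriv (s k) (x k) :=
  dfClosed_eq rx q (hord x hx.1.antitone hx.2) (fun k => (hs01 k _ (hx.2 k)).1) fun k hk =>
    deriv_eq_zero_of_nonneg (fun z hz => (hs01 k z hz).1) (hx.2 k) hk

lemma hasPartials_fit (hPT : Pᵀ = P) (hPP : P * P = P)
    (h : ∀ Y, IsThinSVD (P * Y) (W Y) (d Y) (V Y)) {Y : Matrix (Fin n) (Fin q) ℝ}
    (h0 : IsSimple (d Y)) (hs : ∀ k, DifferentiableAt ℝ (s k) (d Y k)) :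
    HasPartials (fit P d V s) Y := fun a b =>
  (hasLineDerivAt_fit_single hPT hPP h h0 hs b.1 a.1 b.2 a.2).lineDifferentiableAt

lemma trace_jacobian_fit (hPT : Pᵀ = P) (hPP : P * P = P) {rx : ℕ} (hrx : P.trace = rx)
    (hr : r = min rx q) (h : ∀ Y, IsThinSVD (P * Y) (W Y) (d Y) (V Y))
    {Y : Matrix (Fin n) (Fin q) ℝ} (h0 : IsSimple (d Y))
    (hs : ∀ k, DifferentiableAt ℝ (s k) (d Y k)) :
    (jacobian (fit P d V s) Y).trace =
      baseDf rx q (d Y) (fun k => s k (d Y k)) + ∑ k, d Y k * deriv (s k) (d Y k) := by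
  rw [← sum_lineDeriv_fit hPT hPP hrx hr h h0 hs, Matrix.trace, Fintype.sum_prod_type]
  rfl

end Estimator

section Law

variable {Ω : Type*} [MeasurableSpace Ω] {μ : Measure Ω}

lemma covariance_eq_integral_sub_mul [IsProbabilityMeasure μ] {F G : Ω → ℝ} {c : ℝ}
    (hF : MemLp F 2 μ) (hG : MemLp G 2 μ) (hc : ∫ ω, G ω ∂μ = c) :
    covariance F G μ = ∫ ω, (G ω - c) * F ω ∂μ := by
  rw [covariance_eq_sub hF hG, hc]
  have h1 : Integrable (fun ω => G ω * F ω) μ := hG.integrable_mul hF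
  have h2 : Integrable F μ := hF.integrable one_le_two
  simp only [sub_mul, Pi.mul_apply]
  rw [integral_sub h1 (h2.const_mul c), integral_const_mul, mul_comm c]
  simp only [mul_comm (F _)]

lemma hasLaw_gaussLaw [IsProbabilityMeasure μ] {ι : Type*} [Fintype ι] {e : ι → Ω → ℝ} {v : ℝ≥0}
    (he : ∀ a, HasLaw (e a) (gaussianReal 0 v) μ) (hind : iIndepFun e μ) (m₀ : ι → ℝ) :
    HasLaw (fun ω a => m₀ a + e a ω) (gaussLaw m₀ v) μ := by
  have hm : ∀ a, AEMeasurable (fun ω => m₀ a + e a ω) μ := fun a =>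
    (he a).aemeasurable.const_add _
  refine ⟨aemeasurable_pi_lambda _ hm, ?_⟩
  have hind' : iIndepFun (fun a ω => m₀ a + e a ω) μ :=
    hind.comp (fun a x => m₀ a + x) fun a => measurable_const_add (m₀ a)
  rw [(iIndepFun_iff_map_fun_eq_pi_map hm).1 hind', gaussLaw]
  congr 1
  funext a
  have h1 := (gaussianReal_const_add (he a) (m₀ a)).map_eq
  rwa [zero_add] at h1

end Law

section Unbiased

variable {n p q r : ℕ} {X : Matrix (Fin n) (Fin p) ℝ}
  {W : Matrix (Fin n) (Fin q) ℝ → Matrix (Fin n) (Fin r) ℝ}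
  {d : Matrix (Fin n) (Fin q) ℝ → Fin r → ℝ}
  {V : Matrix (Fin n) (Fin q) ℝ → Matrix (Fin q) (Fin r) ℝ} {s : Fin r → ℝ → ℝ}

lemma integral_coord (m₀ : Fin n × Fin q → ℝ) (v : ℝ≥0) (a : Fin n × Fin q) :
    ∫ y, y a ∂gaussLaw m₀ v = m₀ a := by
  have h1 : HasLaw (fun y : Fin n × Fin q → ℝ => y a) (gaussianReal (m₀ a) v) (gaussLaw m₀ v) :=
    (measurePreserving_eval (fun a => gaussianReal (m₀ a) v) a).hasLaw
  rw [h1.integral_eq, integral_id_gaussianReal]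

/-- The closed form is integrable and unbiased under the law of a vectorised normal response. -/
lemma integrable_dfClosed_and_integral_eq (hr : r = min X.rank q)
    (h : ∀ Y, IsThinSVD (hatMatrix X * Y) (W Y) (d Y) (V Y))
    (hs : ∀ k, LocallyLipschitzOn (Set.Ioi 0) (s k))
    (hs01 : ∀ k x, 0 < x → s k x ∈ Set.Icc (0 : ℝ) 1)
    (hord : ∀ x : Fin r → ℝ, Antitone x → (∀ k, 0 < x k) → Antitone fun k => s k (x k))
    (m₀ : Fin n × Fin q → ℝ) {v : ℝ≥0} (hv : v ≠ 0)
    (hR : ∀ k, Integrable (fun y => d (toMat y) k * deriv (s k) (d (toMat y) k))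
      (gaussLaw m₀ v)) :
    (∀ i j, MemLp (fun y => fit (hatMatrix X) d V s (toMat y) i j) 2 (gaussLaw m₀ v)) ∧
      Integrable (fun y => dfClosed X.rank q (d (toMat y)) (fun k => s k (d (toMat y) k))
        (fun k => deriv (s k) (d (toMat y) k))) (gaussLaw m₀ v) ∧
      ∫ y, dfClosed X.rank q (d (toMat y)) (fun k => s k (d (toMat y) k))
        (fun k => deriv (s k) (d (toMat y) k)) ∂gaussLaw m₀ v =
        effectiveDf (gaussLaw m₀ v) v (fit (hatMatrix X) d V s) toMat := by
  have hac := gaussLaw_absolutelyContinuous m₀ hv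
  have hsimple : ∀ᵐ y ∂gaussLaw m₀ v, IsSimple (d (toMat y)) :=
    hac.ae_le (ae_isSimple (hr.trans_le (min_le_left _ _)) (hr.trans_le (min_le_right _ _)) h)
  have hdiff : ∀ᵐ y ∂gaussLaw m₀ v, ∀ k, DifferentiableAt ℝ (s k) (d (toMat y) k) := by
    have h1 := ae_all_iff.2 fun k => hac.ae_le (ae_differentiableAt_weight h (hs k) k)
    filter_upwards [hsimple, h1] with y hy h2 k
    exact h2 k (hy.2 k)
  have hfit := memLp_fit (hatMatrix_transpose X) (hatMatrix_mul_self X) h hs hs01 hsimple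
  have hae : (fun y => baseDf X.rank q (d (toMat y)) (fun k => s k (d (toMat y) k)) +
      ∑ k, d (toMat y) k * deriv (s k) (d (toMat y) k)) =ᵐ[gaussLaw m₀ v] fun y =>
      dfClosed X.rank q (d (toMat y)) (fun k => s k (d (toMat y) k))
        (fun k => deriv (s k) (d (toMat y) k)) := by
    filter_upwards [hsimple] with y hy
    exact (dfClosed_eq_of_isSimple X.rank q hy hs01 hord).symm
  obtain ⟨hb, hE⟩ := integral_df_fit (hatMatrix_transpose X) (hatMatrix_mul_self X)
    (hatMatrix_trace X) hr h hs hs01 hord hv hsimple hdiff hR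
  refine ⟨hfit, (hb.add (integrable_finsetSum _ fun k _ => hR k)).congr hae, ?_⟩
  have hi : ∀ i j, Integrable (fun y => (y (i, j) - m₀ (i, j)) *
      fit (hatMatrix X) d V s (toMat y) i j) (gaussLaw m₀ v) := fun i j =>
    ((memLp_coord m₀ v (i, j)).sub (memLp_const _)).integrable_mul (hfit i j)
  rw [← integral_congr_ae hae, hE, effectiveDf, div_eq_inv_mul,
    integral_finsetSum _ fun i _ => integrable_finsetSum _ fun j _ => hi i j]
  congr 1
  refine Finset.sum_congr rfl fun i _ => ?_
  rw [integral_finsetSum _ fun j _ => hi i j]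
  exact Finset.sum_congr rfl fun j _ => (covariance_eq_integral_sub_mul (hfit i j)
    (memLp_coord m₀ v (i, j)) (integral_coord m₀ v (i, j))).symm

end Unbiased

end ReducedRank

open ReducedRank in
theorem theorem3 {n p q r : ℕ} (X : Matrix (Fin n) (Fin p) ℝ) (hr : r = min X.rank q)
    {Λ : Type*} (s : Fin r → ℝ → Λ → ℝ) (lam : Λ)
    -- the weights lie in `[0, 1]` and are ordered
    (hs : ∀ k x, 0 < x → s k x lam ∈ Set.Icc (0 : ℝ) 1)
    (hord : ∀ x : Fin r → ℝ, Antitone x → (∀ k, 0 < x k) → Antitone fun k => s k (x k) lam)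
    -- any choice of a singular value decomposition of the least squares fit, for every response
    (W : Matrix (Fin n) (Fin q) ℝ → Matrix (Fin n) (Fin r) ℝ)
    (d : Matrix (Fin n) (Fin q) ℝ → Fin r → ℝ)
    (V : Matrix (Fin n) (Fin q) ℝ → Matrix (Fin q) (Fin r) ℝ)
    (hsvd : ∀ Y, IsThinSVD (lsFit X Y) (W Y) (d Y) (V Y))
    -- the shrinkage estimator and the closed form, as functions of the response
    (Yt : Matrix (Fin n) (Fin q) ℝ → Matrix (Fin n) (Fin q) ℝ)
    (hYt : ∀ Y, Yt Y = shrink (W Y) (d Y) (V Y) fun k => s k (d Y k) lam)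
    (df : Matrix (Fin n) (Fin q) ℝ → ℝ)
    (hdf : ∀ Y, df Y = dfClosed X.rank q (d Y) (fun k => s k (d Y k) lam)
      fun k => deriv (fun x => s k x lam) (d Y k)) :
    -- the divergence of the estimator exists and is given by the closed form
    (∀ Y, StrictAnti (d Y) → (∀ k, 0 < d Y k) →
      (∀ k, DifferentiableAt ℝ (fun x => s k x lam) (d Y k)) →
      HasPartials Yt Y ∧ (jacobian Yt Y).trace = df Y) ∧
    -- for Gaussian errors, the closed form is unbiased for the effective degrees of freedom
    (∀ {Ω : Type*} [MeasurableSpace Ω] (P : Measure Ω) [IsProbabilityMeasure P]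
      (M : Matrix (Fin n) (Fin q) ℝ) (E Y : Ω → Matrix (Fin n) (Fin q) ℝ) (v : ℝ≥0), v ≠ 0 →
      (∀ ω, Y ω = M + E ω) →
      (∀ i j, HasLaw (fun ω => E ω i j) (gaussianReal 0 v) P) →
      iIndepFun (fun (a : Fin n × Fin q) ω => E ω a.1 a.2) P →
      (∀ k, LocallyLipschitzOn (Set.Ioi 0) fun x => s k x lam) →
      (∀ k, Integrable (fun ω => d (Y ω) k * deriv (fun x => s k x lam) (d (Y ω) k)) P) →
      (∀ i j, MemLp (fun ω => Yt (Y ω) i j) 2 P) ∧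
      Integrable (fun ω => df (Y ω)) P ∧
      ∫ ω, df (Y ω) ∂P = effectiveDf P v Yt Y) := by
  set σ : Fin r → ℝ → ℝ := fun k x => s k x lam with hσ
  have h : ∀ Y, IsThinSVD (hatMatrix X * Y) (W Y) (d Y) (V Y) := hsvd
  have hPT := hatMatrix_transpose X
  have hPP := hatMatrix_mul_self X
  obtain rfl : Yt = fit (hatMatrix X) d V σ := funext fun Y =>
    (hYt Y).trans ((h Y).shrink_eq _)
  refine ⟨fun Y hanti hpos hdiff => ?_, ?_⟩
  · have h0 : IsSimple (d Y) := ⟨hanti, hpos⟩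
    refine ⟨hasPartials_fit hPT hPP h h0 hdiff, ?_⟩
    rw [trace_jacobian_fit hPT hPP (hatMatrix_trace X) hr h h0 hdiff, hdf]
    exact (dfClosed_eq_of_isSimple (s := σ) X.rank q h0 hs hord).symm
  · intro Ω _ P _ M E Y v hv hY hE hind hlip hint
    have hlaw := hasLaw_gaussLaw (fun a : Fin n × Fin q => hE a.1 a.2) hind
      (fun a => M a.1 a.2)
    set m₀ : Fin n × Fin q → ℝ := fun a => M a.1 a.2 with hm₀
    set y : Ω → Fin n × Fin q → ℝ := fun ω a => m₀ a + E ω a.1 a.2 with hy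
    obtain rfl : Y = fun ω => toMat (y ω) := funext fun ω => by
      rw [hY]
      rfl
    -- the integrability of `dₖ sₖ'` is transferred from the sample space to the law
    have hR : ∀ k, Integrable (fun y => d (toMat y) k * deriv (σ k) (d (toMat y) k))
        (gaussLaw m₀ v) := by
      intro k
      have hc : Measurable fun y : Fin n × Fin q → ℝ => d (toMat y) k :=
        ((continuous_singularValue h k).comp continuous_toMat).measurable
      have hm : Measurable fun y : Fin n × Fin q → ℝ =>
          d (toMat y) k * deriv (σ k) (d (toMat y) k) :=
        hc.mul ((measurable_deriv (σ k)).comp hc)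
      rw [← hlaw.map_eq]
      exact (integrable_map_measure hm.aestronglyMeasurable hlaw.aemeasurable).2 (hint k)
    obtain ⟨h1, h2, h3⟩ := integrable_dfClosed_and_integral_eq hr h hlip hs hord m₀ hv hR
    have hdf' : df = fun Z => dfClosed X.rank q (d Z) (fun k => σ k (d Z k))
        fun k => deriv (σ k) (d Z k) := funext hdf
    subst hdf'
    refine ⟨fun i j => ?_, ?_, ?_⟩
    · have h4 := h1 i j
      rw [← hlaw.map_eq] at h4
      exact h4.comp_of_map hlaw.aemeasurable
    · have h4 := h2
      rw [← hlaw.map_eq] at h4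
      exact h4.comp_aemeasurable hlaw.aemeasurable
    · have h4 := hlaw.integral_comp h2.aestronglyMeasurable
      refine (h4.trans h3).trans ?_
      unfold effectiveDf
      congr 1
      refine Finset.sum_congr rfl fun i _ => Finset.sum_congr rfl fun j _ => ?_
      exact (hlaw.covariance_fun_comp (h1 i j).aestronglyMeasurable.aemeasurable
        (measurable_pi_apply (i, j)).aemeasurable).symm
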